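/- Let $J^k\mathbb{R}^3$ be the space of $k$-jets of functions $u=u(x,y,p)$ on $\mathbb{R}^3(x,y,p)$; such a function is regarded as the second order ODE $y''=u(x,y,p)$, $p=y'$. The pseudogroup of local diffeomorphisms of the plane $\mathbb{R}^2(x,y)$ (point transformations) acts on these equations, hence on $J^k\mathbb{R}^3$. Infinitesimally, a local smooth vector field $a\,\partial_x+b\,\partial_y$ on the plane prolongs to the vector field on $J^k\mathbb{R}^3$ $$\hat\xi=a\,\mathcal D_x+b\,\mathcal D_y+A\,\mathcal D_p+\sum_{|\zeta|\le k}\mathcal D_\zeta(f)\,\partial_{u_\zeta},\qquad f=B_0+B_1u-a\,u_x-b\,u_y-A\,u_p,$$ where $\mathcal D_x,\mathcal D_y,\mathcal D_p$ are the total derivatives, $\mathcal D_\zeta$ is their composition for the multi-index $\zeta$, and, with $D_x=\partial_x+p\,\partial_y$ and $\varphi=b-p\,a$, $A=D_x\varphi$, $B_0=D_x^2\varphi$, $B_1=\partial_y\varphi-2D_xa$. The stabilizer of $\theta\in J^k\mathbb{R}^3$ consists of the vector fields $a\,\partial_x+b\,\partial_y$, smooth near the base point of $\theta$, whose prolongation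 vanishes at $\theta$; the tangent space of the orbit of $\theta$ consists of the values at $\theta$ of the prolonged fields. A differential invariant of order $\le k$ on an open set of $J^k\mathbb{R}^3$ is a smooth function annihilated by all prolonged fields. Basic invariants of order $\le k$ near $\theta$ are finitely many differential invariants on a neighbourhood of $\theta$ with linearly independent differentials such that every differential invariant on an open subset of this neighbourhood is locally a smooth function of them. The number of basic invariants of pure order $k$ near $\theta$ is the number of invariants to be added to basic invariants of order $\le k-1$ (near the projection of $\theta$ to $J^{k-1}\mathbb{R}^3$) to get basic invariants of order $\le k$. A property holds at a generic point of $J^k\mathbb{R}^3$ if it holds outside the zero set of some nonzero polynomial in the coordinates $x,y,p,u_\zeta$. Then: 1. For every $k\ge5$ the stabilizer of a generic point of $J^k\mathbb{R}^3$ has codimension $k^2+6k+1$. 2. For every $k\ge5$ the tangent space of the orbit of a generic point of $J^k\mathbb{R}^3$ has codimension $\frac{k^3-25k+18}{6}$, and this is the number of basic differential invariants of order $\le k$ near a generic point. 3. For every $k>5$ the number of basic differential invariants of pure order $k$ near a generic point is $\frac{k(k-1)}{2}-4$. 4. For every $k\le4$ the orbit of a generic point of $J^k\mathbb{R}^3$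 under the pseudogroup is open; the stabilizer of a generic point has codimension $\dim J^k\mathbb{R}^3$, and there are no basic invariants of order $\le k$ near it (every invariant is locally constant). 5. For $k=5$, near a generic point there are $3$ basic invariants of order $\le 5$, and these are $3$ of pure order $5$. -/

import Mathlib

open scoped ContDiff Topology

noncomputable section

namespace PointODE

/-- The plane `ℝ²(x, y)` of independent and dependent variable. -/
abbrev Plane : Type := ℝ × ℝ

/-- The space `ℝ³(x, y, p)`, where `p = y'`. -/
abbrev Pt : Type := ℝ × ℝ × ℝ

/-- The projection `(x, y, p) ↦ (x, y)`. -/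
def Pt.base (w : Pt) : Plane := (w.1, w.2.1)

/-- `f` is of class `C^∞` on some neighbourhood of `x`. -/
def SmoothNear {E F : Type*} [NormedAddCommGroup E] [NormedSpace ℝ E]
    [NormedAddCommGroup F] [NormedSpace ℝ F] (f : E → F) (x : E) : Prop :=
  ∀ᶠ x' in 𝓝 x, ContDiffAt ℝ ∞ f x'

/-! ### Differentiation on `ℝ³(x, y, p)` -/

/-- The derivative of a function along a vector field on `ℝ³(x, y, p)`. -/
def along (X : Pt → Pt) (F : Pt → ℝ) : Pt → ℝ := fun w => fderiv ℝ F w (X w)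

/-- The coordinate derivation `∂/∂x`. -/
def pdx : (Pt → ℝ) → Pt → ℝ := along fun _ => (1, 0, 0)

/-- The coordinate derivation `∂/∂y`. -/
def pdy : (Pt → ℝ) → Pt → ℝ := along fun _ => (0, 1, 0)

/-- The coordinate derivation `∂/∂p`. -/
def pdp : (Pt → ℝ) → Pt → ℝ := along fun _ => (0, 0, 1)

/-- The operator `D_x = ∂/∂x + p ∂/∂y` on `ℝ³(x, y, p)`. -/
def Dx : (Pt → ℝ) → Pt → ℝ := along fun w => (1, w.2.2, 0)

/-- The partial derivative `∂_x^l ∂_y^m ∂_p^n F` for the multi-index `ζ = (l, m, n)`. -/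
def partialDeriv (ζ : ℕ × ℕ × ℕ) (F : Pt → ℝ) : Pt → ℝ :=
  pdx^[ζ.1] (pdy^[ζ.2.1] (pdp^[ζ.2.2] F))

/-! ### Jets -/

/-- Multi-indices `ζ = (l, m, n)` with `|ζ| = l + m + n ≤ k`. -/
abbrev JetIdx (k : ℕ) : Type := {ζ : ℕ × ℕ × ℕ // ζ.1 + ζ.2.1 + ζ.2.2 ≤ k}

instance instFiniteJetIdx (k : ℕ) : Finite (JetIdx k) := by
  refine Set.Finite.to_subtype (Set.Finite.subset
    ((Set.finite_Iic k).prod ((Set.finite_Iic k).prod (Set.finite_Iic k))) ?_)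
  rintro ⟨l, m, n⟩ h
  have h' : l + m + n ≤ k := h
  simp only [Set.mem_prod, Set.mem_Iic]
  omega

instance instFintypeJetIdx (k : ℕ) : Fintype (JetIdx k) := Fintype.ofFinite _

/-- The space `J^k ℝ³(x, y, p)` of `k`-jets of functions `u = u(x, y, p)`, with its standard
coordinates: the point `(x, y, p)` and the partial derivatives `u_ζ`, `|ζ| ≤ k`. -/
abbrev Jet (k : ℕ) : Type := Pt × (JetIdx k → ℝ)

/-- The `k`-jet of the function `f` at the point `z`. -/
def jetOf (k : ℕ) (f : Pt → ℝ) (z : Pt) : Jet k := (z, fun ζ => partialDeriv ζ.1 f z)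

/-- The projection `J^k ℝ³ → J^j ℝ³` for `j ≤ k`. -/
def Jet.proj {j k : ℕ} (h : j ≤ k) (θ : Jet k) : Jet j :=
  (θ.1, fun ζ => θ.2 ⟨ζ.1, ζ.2.trans h⟩)

/-- The Taylor polynomial of a jet, which is a function on `ℝ³` representing this jet. -/
def Jet.taylor {k : ℕ} (θ : Jet k) : Pt → ℝ := fun w =>
  ∑ ζ : JetIdx k, θ.2 ζ
    * ((w.1 - θ.1.1) ^ ζ.1.1 / (ζ.1.1.factorial : ℝ))
    * ((w.2.1 - θ.1.2.1) ^ ζ.1.2.1 / (ζ.1.2.1.factorial : ℝ))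
    * ((w.2.2 - θ.1.2.2) ^ ζ.1.2.2 / (ζ.1.2.2.factorial : ℝ))

/-- The coordinates of a jet as one family of real numbers. -/
def Jet.coords {k : ℕ} (θ : Jet k) : Fin 3 ⊕ JetIdx k → ℝ :=
  Sum.elim ![θ.1.1, θ.1.2.1, θ.1.2.2] θ.2

/-- A property holds at a generic point of `J^k ℝ³` if it holds off the zero set of some nonzero
polynomial in the jet coordinates. -/
def Generically (k : ℕ) (S : Jet k → Prop) : Prop :=
  ∃ P : MvPolynomial (Fin 3 ⊕ JetIdx k) ℝ, P ≠ 0 ∧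
    ∀ θ : Jet k, MvPolynomial.eval θ.coords P ≠ 0 → S θ

/-! ### Point transformations and their orbits -/

/-- The function `P = D_x Y / D_x X`, which is the transform of `p = dy/dx` under
`φ = (X, Y)`. -/
def slope (φ : Plane → Plane) : Pt → ℝ := fun w =>
  Dx (fun w => (φ w.base).2) w / Dx (fun w => (φ w.base).1) w

/-- The first prolongation `(x, y, p) ↦ (X, Y, P)` of `φ = (X, Y)`. -/
def lift₁ (φ : Plane → Plane) (w : Pt) : Pt := ((φ w.base).1, (φ w.base).2, slope φ w)

/-- The transform `U = (D_x P + u ∂P/∂p) / D_x X` of `u = d²y/dx²` under `φ = (X, Y)`. -/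
def lift₂ (φ : Plane → Plane) (w : Pt) (u : ℝ) : ℝ :=
  (Dx (slope φ) w + u * pdp (slope φ) w) / Dx (fun w => (φ w.base).1) w

/-- `φ` is a point transformation, that is, a local `C^∞` diffeomorphism of the plane. -/
def IsPointTransformation (φ : OpenPartialHomeomorph Plane Plane) : Prop :=
  ContDiffOn ℝ ∞ φ φ.source ∧ ContDiffOn ℝ ∞ φ.symm φ.target

/-- The orbit of the `k`-jet `θ` under the prolonged pseudogroup of point transformations:
all `θ'` such that some point transformation `φ`, whose prolongation is defined at the base
point of `θ`, maps an equation `y'' = f(x, y, y')` with `k`-jet `θ` to an equation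
`y'' = g(x, y, y')` with `k`-jet `θ'`. -/
def orbit {k : ℕ} (θ : Jet k) : Set (Jet k) :=
  {θ' | ∃ (φ : OpenPartialHomeomorph Plane Plane) (f g : Pt → ℝ),
    IsPointTransformation φ ∧ θ.1.base ∈ φ.source ∧
    Dx (fun w => (φ w.base).1) θ.1 ≠ 0 ∧ lift₁ φ θ.1 = θ'.1 ∧
    SmoothNear f θ.1 ∧ SmoothNear g θ'.1 ∧
    jetOf k f θ.1 = θ ∧ jetOf k g θ'.1 = θ' ∧
    ∀ᶠ w in 𝓝 θ.1, g (lift₁ φ w) = lift₂ φ w (f w)}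

/-! ### The prolonged Lie algebra of vector fields -/

/-- The vector fields `a ∂/∂x + b ∂/∂y` that are smooth near the point `q` of the plane,
`V = (a, b)`. -/
def localFields (q : Plane) : Submodule ℝ (Plane → Plane) where
  carrier := {V | SmoothNear V q}
  add_mem' {V W} hV hW := by
    filter_upwards [hV, hW] with x h₁ h₂ using h₁.add h₂
  zero_mem' := Filter.Eventually.of_forall fun _ => contDiffAt_const
  smul_mem' c V hV := by
    filter_upwards [hV] with x h using h.const_smul c

/-- The component `a` of `V`, as a function on `ℝ³(x, y, p)`. -/
def coefa (V : Plane → Plane) : Pt → ℝ := fun w => (V w.base).1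

/-- The component `b` of `V`, as a function on `ℝ³(x, y, p)`. -/
def coefb (V : Plane → Plane) : Pt → ℝ := fun w => (V w.base).2

/-- The function `φ = (dy - p dx)(V) = b - p a`. -/
def charFun (V : Plane → Plane) : Pt → ℝ := fun w => coefb V w - w.2.2 * coefa V w

/-- `A = D_x φ`, the coefficient at `∂/∂p` of the prolonged field. -/
def coefA (V : Plane → Plane) : Pt → ℝ := Dx (charFun V)

/-- `B₀ = D_x² φ`; the coefficient at `∂/∂u` of the prolonged field is `B₀ + u B₁`. -/
def coefB₀ (V : Plane → Plane) : Pt → ℝ := Dx (Dx (charFun V))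

/-- `B₁ = ∂φ/∂y - 2 D_x a`. -/
def coefB₁ (V : Plane → Plane) : Pt → ℝ := fun w => pdy (charFun V) w - 2 * Dx (coefa V) w

/-- The function `f = B₀ + B₁ u - a u_x - b u_y - A u_p` evaluated on `u = h(x, y, p)`. -/
def genFun (V : Plane → Plane) (h : Pt → ℝ) : Pt → ℝ := fun w =>
  coefB₀ V w + coefB₁ V w * h w - coefa V w * pdx h w - coefb V w * pdy h w
    - coefA V w * pdp h w

/-- The value at the jet `θ` of the prolongation to `J^k ℝ³` of the vector field `V`,
`a 𝒟_x + b 𝒟_y + A 𝒟_p + ∑ 𝒟_ζ(f) ∂/∂u_ζ`. A total derivative at `θ` is the ordinary derivative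
along a function `h` with jet `θ`, here the Taylor polynomial; so the coefficient at `∂/∂u_ζ` is
`∂^ζ f[h] + a ∂^ζ h_x + b ∂^ζ h_y + A ∂^ζ h_p` at the base point. It does not depend on the
derivatives of `h` of order `k + 1`, because these cancel. -/
def prolongVec {k : ℕ} (θ : Jet k) (V : Plane → Plane) : Jet k :=
  ((coefa V θ.1, coefb V θ.1, coefA V θ.1), fun ζ =>
    partialDeriv ζ.1 (genFun V θ.taylor) θ.1
      + coefa V θ.1 * partialDeriv ζ.1 (pdx θ.taylor) θ.1
      + coefb V θ.1 * partialDeriv ζ.1 (pdy θ.taylor) θ.1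
      + coefA V θ.1 * partialDeriv ζ.1 (pdp θ.taylor) θ.1)

/-! ### The prolongation is linear in the vector field -/

section Linearity

variable {E : Type*} [NormedAddCommGroup E] [NormedSpace ℝ E]

theorem SmoothNear.mul {z : E} {F G : E → ℝ} (hF : SmoothNear F z) (hG : SmoothNear G z) :
    SmoothNear (fun w => F w * G w) z := by
  filter_upwards [hF, hG] with w h₁ h₂ using ContDiffAt.mul h₁ h₂

theorem SmoothNear.sub {z : E} {F G : E → ℝ} (hF : SmoothNear F z) (hG : SmoothNear G z) :
    SmoothNear (fun w => F w - G w) z := by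
  filter_upwards [hF, hG] with w h₁ h₂ using ContDiffAt.sub h₁ h₂

theorem SmoothNear.add {z : E} {F G : E → ℝ} (hF : SmoothNear F z) (hG : SmoothNear G z) :
    SmoothNear (fun w => F w + G w) z := by
  filter_upwards [hF, hG] with w h₁ h₂ using ContDiffAt.add h₁ h₂

theorem SmoothNear.of_contDiff {z : E} {F : E → ℝ} (hF : ContDiff ℝ ∞ F) : SmoothNear F z :=
  Filter.Eventually.of_forall fun _ => hF.contDiffAt

theorem SmoothNear.along {z : Pt} {X : Pt → Pt} {F : Pt → ℝ} (hX : ContDiff ℝ ∞ X)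
    (hF : SmoothNear F z) : SmoothNear (along X F) z := by
  filter_upwards [hF] with w h
  exact (h.fderiv_right (m := ∞) (by simp)).clm_apply hX.contDiffAt

/-- An operator on functions which preserves smoothness near `z` and which acts linearly on the
germs at `z` of smooth functions. -/
structure GermLinear (z : Pt) (T : (Pt → ℝ) → Pt → ℝ) : Prop where
  smooth : ∀ F, SmoothNear F z → SmoothNear (T F) z
  comb : ∀ F G H : Pt → ℝ, SmoothNear F z → SmoothNear G z → ∀ c d : ℝ,
    H =ᶠ[𝓝 z] (fun w => c * F w + d * G w) → T H =ᶠ[𝓝 z] fun w => c * T F w + d * T G w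

theorem GermLinear.along (z : Pt) {X : Pt → Pt} (hX : ContDiff ℝ ∞ X) :
    GermLinear z (along X) where
  smooth _ hF := hF.along hX
  comb F G H hF hG c d h := by
    filter_upwards [hF, hG, h.eventuallyEq_nhds] with w h₁ h₂ h₃
    have d₁ := h₁.differentiableAt (by simp)
    have d₂ := h₂.differentiableAt (by simp)
    simp only [PointODE.along]
    rw [h₃.fderiv_eq, fderiv_fun_add (d₁.const_mul c) (d₂.const_mul d),
      fderiv_const_mul d₁, fderiv_const_mul d₂]
    simp

theorem GermLinear.comp {z : Pt} {S T : (Pt → ℝ) → Pt → ℝ} (hS : GermLinear z S)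
    (hT : GermLinear z T) : GermLinear z (fun F => S (T F)) where
  smooth F hF := hS.smooth _ (hT.smooth F hF)
  comb F G H hF hG c d h :=
    hS.comb _ _ _ (hT.smooth F hF) (hT.smooth G hG) c d (hT.comb F G H hF hG c d h)

theorem GermLinear.iterate {z : Pt} {T : (Pt → ℝ) → Pt → ℝ} (hT : GermLinear z T) (n : ℕ) :
    GermLinear z (T^[n]) := by
  induction n with
  | zero => exact ⟨fun _ h => h, fun _ _ _ _ _ _ _ h => h⟩
  | succ n ih => exact ih.comp hT

theorem germLinear_pdx (z : Pt) : GermLinear z pdx := GermLinear.along z contDiff_const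

theorem germLinear_pdy (z : Pt) : GermLinear z pdy := GermLinear.along z contDiff_const

theorem germLinear_pdp (z : Pt) : GermLinear z pdp := GermLinear.along z contDiff_const

theorem germLinear_Dx (z : Pt) : GermLinear z Dx := GermLinear.along z (by fun_prop)

theorem germLinear_partialDeriv (z : Pt) (ζ : ℕ × ℕ × ℕ) : GermLinear z (partialDeriv ζ) :=
  ((germLinear_pdx z).iterate ζ.1).comp
    (((germLinear_pdy z).iterate ζ.2.1).comp ((germLinear_pdp z).iterate ζ.2.2))

theorem smoothNear_comp_base {z : Pt} {V : Plane → Plane} (hV : SmoothNear V z.base) :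
    ∀ᶠ w in 𝓝 z, ContDiffAt ℝ ∞ (fun w : Pt => V w.base) w := by
  have hb : ContDiff ℝ ∞ Pt.base := by unfold Pt.base; fun_prop
  filter_upwards [hb.continuous.continuousAt.eventually hV] with w h
  exact h.comp w hb.contDiffAt

theorem smoothNear_coefa {z : Pt} {V : Plane → Plane} (hV : SmoothNear V z.base) :
    SmoothNear (coefa V) z := by
  filter_upwards [smoothNear_comp_base hV] with w h using h.fst

theorem smoothNear_coefb {z : Pt} {V : Plane → Plane} (hV : SmoothNear V z.base) :
    SmoothNear (coefb V) z := by
  filter_upwards [smoothNear_comp_base hV] with w h using h.snd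

theorem smoothNear_charFun {z : Pt} {V : Plane → Plane} (hV : SmoothNear V z.base) :
    SmoothNear (charFun V) z :=
  (smoothNear_coefb hV).sub
    ((SmoothNear.of_contDiff (by fun_prop)).mul (smoothNear_coefa hV))

theorem contDiff_taylor {k : ℕ} (θ : Jet k) : ContDiff ℝ ∞ θ.taylor := by
  unfold Jet.taylor
  fun_prop

theorem smoothNear_genFun {z : Pt} {V : Plane → Plane} (hV : SmoothNear V z.base) {h : Pt → ℝ}
    (hh : SmoothNear h z) : SmoothNear (genFun V h) z := by
  have ha := smoothNear_coefa hV
  have hb := smoothNear_coefb hV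
  have hc := smoothNear_charFun hV
  have hA : SmoothNear (coefA V) z := (germLinear_Dx z).smooth _ hc
  have hB₀ : SmoothNear (coefB₀ V) z := (germLinear_Dx z).smooth _ hA
  have hB₁ : SmoothNear (coefB₁ V) z := ((germLinear_pdy z).smooth _ hc).sub
    ((SmoothNear.of_contDiff contDiff_const).mul ((germLinear_Dx z).smooth _ ha))
  exact (((hB₀.add (hB₁.mul hh)).sub (ha.mul ((germLinear_pdx z).smooth _ hh))).sub
    (hb.mul ((germLinear_pdy z).smooth _ hh))).sub (hA.mul ((germLinear_pdp z).smooth _ hh))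

theorem prolongVec_comb {k : ℕ} (θ : Jet k) {V W : Plane → Plane}
    (hV : SmoothNear V θ.1.base) (hW : SmoothNear W θ.1.base) (c d : ℝ) :
    prolongVec θ (c • V + d • W) = c • prolongVec θ V + d • prolongVec θ W := by
  have hh : SmoothNear θ.taylor θ.1 := SmoothNear.of_contDiff (contDiff_taylor θ)
  have ea : coefa (c • V + d • W) = fun w => c * coefa V w + d * coefa W w := by
    funext w; simp [coefa]
  have eb : coefb (c • V + d • W) = fun w => c * coefb V w + d * coefb W w := by
    funext w; simp [coefb]
  have ec : charFun (c • V + d • W) = fun w => c * charFun V w + d * charFun W w := by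
    funext w; simp only [charFun, ea, eb]; ring
  have hcV := smoothNear_charFun hV
  have hcW := smoothNear_charFun hW
  have eA := (germLinear_Dx θ.1).comb _ _ _ hcV hcW c d (Filter.EventuallyEq.of_eq ec)
  have eB₀ := (germLinear_Dx θ.1).comb _ _ _ ((germLinear_Dx θ.1).smooth _ hcV)
    ((germLinear_Dx θ.1).smooth _ hcW) c d eA
  have ey := (germLinear_pdy θ.1).comb _ _ _ hcV hcW c d (Filter.EventuallyEq.of_eq ec)
  have ex := (germLinear_Dx θ.1).comb _ _ _ (smoothNear_coefa hV) (smoothNear_coefa hW) c d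
    (Filter.EventuallyEq.of_eq ea)
  have eg : genFun (c • V + d • W) θ.taylor =ᶠ[𝓝 θ.1]
      fun w => c * genFun V θ.taylor w + d * genFun W θ.taylor w := by
    filter_upwards [eA, eB₀, ey, ex] with w h₁ h₂ h₃ h₄
    simp only [genFun, coefA, coefB₀, coefB₁]
    rw [h₁, h₂, h₃, h₄, ea, eb]
    ring
  have eA' : coefA (c • V + d • W) θ.1 = c * coefA V θ.1 + d * coefA W θ.1 := eA.self_of_nhds
  have ez : ∀ ζ : ℕ × ℕ × ℕ, partialDeriv ζ (genFun (c • V + d • W) θ.taylor) θ.1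
      = c * partialDeriv ζ (genFun V θ.taylor) θ.1
        + d * partialDeriv ζ (genFun W θ.taylor) θ.1 := fun ζ =>
    ((germLinear_partialDeriv θ.1 ζ).comb _ _ _ (smoothNear_genFun hV hh)
      (smoothNear_genFun hW hh) c d eg).self_of_nhds
  ext ζ
  · simp [prolongVec, ea]
  · simp [prolongVec, eb]
  · simp [prolongVec, eA']
  · simp only [prolongVec, ez, ea, eb, eA', Prod.snd_add, Prod.smul_snd, Pi.add_apply,
      Pi.smul_apply, smul_eq_mul]
    ring

end Linearity

/-- The prolongation at `θ ∈ J^k ℝ³`, as a linear map from the vector fields on the plane that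
are smooth near the base point of `θ` to the tangent space of `J^k ℝ³` at `θ`. -/
def prolong {k : ℕ} (θ : Jet k) : localFields θ.1.base →ₗ[ℝ] Jet k where
  toFun V := prolongVec θ V.1
  map_add' V W := by
    have h := prolongVec_comb θ V.2 W.2 1 1
    simp only [one_smul] at h
    exact h
  map_smul' c V := by
    have h := prolongVec_comb θ V.2 V.2 c 0
    simp only [zero_smul, add_zero] at h
    exact h

/-- The stabilizer `St_k` of the jet `θ` in the Lie algebra of point transformations: the
fields whose prolongation vanishes at `θ`. -/
def stabilizer {k : ℕ} (θ : Jet k) : Submodule ℝ (localFields θ.1.base) :=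
  LinearMap.ker (prolong θ)

/-- The codimension of the stabilizer in the Lie algebra. -/
def stabilizerCodim {k : ℕ} (θ : Jet k) : ℕ :=
  Module.finrank ℝ (localFields θ.1.base ⧸ stabilizer θ)

/-- The tangent space at `θ` of the orbit through `θ`: the values at `θ` of all prolonged
fields. -/
def orbitTangent {k : ℕ} (θ : Jet k) : Submodule ℝ (Jet k) := LinearMap.range (prolong θ)

/-! ### Differential invariants -/

/-- `I` is a (smooth, absolute) differential invariant of order `≤ k` on the open set
`U ⊆ J^k ℝ³`: it is annihilated by all prolonged fields. -/
def IsInvariantOn {k : ℕ} (U : Set (Jet k)) (I : Jet k → ℝ) : Prop :=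
  ContDiffOn ℝ ∞ I U ∧
    ∀ θ ∈ U, ∀ V : localFields θ.1.base, fderiv ℝ I θ (prolong θ V) = 0

/-- The family `I` consists of basic differential invariants of order `≤ k` on the open set `U`:
they are invariants with linearly independent differentials, and every invariant on an open
subset of `U` is locally a smooth function of them. -/
structure IsBasicFamily {k : ℕ} {ι : Type} [Fintype ι] (U : Set (Jet k))
    (I : ι → Jet k → ℝ) : Prop where
  isOpen : IsOpen U
  invariant : ∀ i, IsInvariantOn U (I i)
  independent : ∀ θ ∈ U, LinearIndependent ℝ fun i => fderiv ℝ (I i) θ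
  complete : ∀ W ⊆ U, IsOpen W → ∀ J : Jet k → ℝ, IsInvariantOn W J → ∀ θ ∈ W,
    ∃ W' ⊆ W, IsOpen W' ∧ θ ∈ W' ∧
      ∃ (O : Set (ι → ℝ)) (F : (ι → ℝ) → ℝ), IsOpen O ∧ ContDiffOn ℝ ∞ F O ∧
        ∀ η ∈ W', (fun i => I i η) ∈ O ∧ J η = F fun i => I i η

/-- Near `θ` there are exactly `n` basic differential invariants of order `≤ k`. -/
def HasBasicInvariants {k : ℕ} (θ : Jet k) (n : ℕ) : Prop :=
  ∃ (U : Set (Jet k)) (I : Fin n → Jet k → ℝ), θ ∈ U ∧ IsBasicFamily U I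

/-- Near `θ` there are exactly `m` basic differential invariants of pure order `k`: some basic
invariants of order `≤ k - 1` near the projection of `θ` become basic invariants of
order `≤ k` near `θ` when `m` further invariants are added. -/
def HasPureOrderInvariants {k : ℕ} (θ : Jet k) (m : ℕ) : Prop :=
  ∃ (r : ℕ) (U₀ : Set (Jet (k - 1))) (I₀ : Fin r → Jet (k - 1) → ℝ)
    (U : Set (Jet k)) (K : Fin m → Jet k → ℝ),
    θ.proj (Nat.sub_le k 1) ∈ U₀ ∧ IsBasicFamily U₀ I₀ ∧
    θ ∈ U ∧ Set.MapsTo (Jet.proj (Nat.sub_le k 1)) U U₀ ∧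
    IsBasicFamily U (Sum.elim (fun i η => I₀ i (η.proj (Nat.sub_le k 1))) K)

end PointODE

end

/-! Everything rests on the rank of the prolongation `prolong θ`, a linear map whose kernel is the
stabilizer and whose range is the tangent space of the orbit. For `k ≥ 5` the generic rank is `k² +
6k + 1`, for `k ≤ 4` it is `dim J^k`, and the remaining statements follow from this by local theory
of orbits of constant dimension.

The upper bound holds at every jet with `k ≥ 3` (`finrank_orbitTangent_le`). The plane field has a
`k`-jet with `(k+1)(k+2)` coefficients. If this jet vanishes, only `B₀`, which contains second
derivatives of the field, can contribute, and it reaches only the `3k + 1` coordinates `u_ζ` with at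
least `k - 1` derivatives in `x, y`. This gives rank at most `k² + 6k + 3`. Two explicit fields of
degree `k`, adapted to the direction `p₀`, have prolongations in the same small subspace although
their `k`-jets are independent, so two dimensions are lost.

The lower bound needs a single jet, since independence of the prolongations of given polynomial
fields is the nonvanishing of a Gram determinant that is polynomial in the jet
(`generically_le_finrank`). The jet is that of `p⁴ + x²p²` at the origin. On `k² + 6k + 1` monomial
fields the equations for the stabilizer form a recursive linear system with only the zero solution
(`coefficients_eq_zero`): `p⁴` leaves few symmetries and `x²p²` removes the remaining scaling. For
`k = 4` three monomials are discarded, the rest being as many as `dim J^4`; lower orders follow by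
projection.

Invariants are obtained without flows or the Frobenius theorem. For a smooth family of plane maps,
differentiation of the pulled back equations in the parameter gives exactly the generating function
of the velocity field (`infinitesimal_slope`, `infinitesimal_genFun`, `fderiv_jetFamily`). Hence `φ₀
∘ (id + ∑ tᵢ Vᵢ)` yields a map `Φ(t, η)` on jets whose `t`-derivatives are tangent to orbits for all
small `t` (`exists_local_action`). Where the rank is constant, `(t, c) ↦ Φ(t, θ₀ + c)`, with `c` in
a complement of the tangent space, is a chart; its slices `c = const` have the orbit tangent spaces
as tangent spaces, so functions of `c` are invariants (`exists_invariants`). As many independent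
invariants as the codimension are basic, because an invariant is constant along the common kernel of
their differentials (`exists_local_factorization`, `exists_isBasicFamily`). For the pure order,
pullbacks of basic invariants of order `k - 1` are completed to a basic family. The same map `Φ` and
the submersion theorem show that an orbit with full tangent space is open (`isOpen_orbit`). -/

open scoped ContDiff Topology

noncomputable section

namespace PointODE

/-! ### Germs of smooth functions and directional derivatives -/

section SmoothGerms

variable {E F G : Type*} [NormedAddCommGroup E] [NormedSpace ℝ E]
  [NormedAddCommGroup F] [NormedSpace ℝ F] [NormedAddCommGroup G] [NormedSpace ℝ G]

theorem SmoothNear.contDiffAt {f : E → F} {x : E} (h : SmoothNear f x) : ContDiffAt ℝ ∞ f x :=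
  h.self_of_nhds

theorem SmoothNear.differentiableAt {f : E → F} {x : E} (h : SmoothNear f x) :
    DifferentiableAt ℝ f x :=
  h.contDiffAt.differentiableAt (by simp)

theorem SmoothNear.eventually {f : E → F} {x : E} (h : SmoothNear f x) :
    ∀ᶠ y in 𝓝 x, SmoothNear f y :=
  eventually_eventually_nhds.2 h

theorem SmoothNear.congr {f g : E → F} {x : E} (h : SmoothNear f x) (hfg : g =ᶠ[𝓝 x] f) :
    SmoothNear g x := by
  filter_upwards [h, hfg.eventuallyEq_nhds] with y h₁ h₂ using h₁.congr_of_eventuallyEq h₂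

theorem ContDiff.smoothNear {f : E → F} (h : ContDiff ℝ ∞ f) (x : E) : SmoothNear f x :=
  Filter.Eventually.of_forall fun _ => h.contDiffAt

theorem SmoothNear.comp {g : F → G} {f : E → F} {x : E} (hg : SmoothNear g (f x))
    (hf : SmoothNear f x) : SmoothNear (fun y => g (f y)) x := by
  filter_upwards [hf, hf.contDiffAt.continuousAt.eventually hg] with y h₁ h₂
  exact h₂.comp y h₁

theorem SmoothNear.prodMk {f : E → F} {g : E → G} {x : E} (hf : SmoothNear f x)
    (hg : SmoothNear g x) : SmoothNear (fun y => (f y, g y)) x := by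
  filter_upwards [hf, hg] with y h₁ h₂ using h₁.prodMk h₂

theorem SmoothNear.fst {f : E → F × G} {x : E} (hf : SmoothNear f x) :
    SmoothNear (fun y => (f y).1) x := by
  filter_upwards [hf] with y h using h.fst

theorem SmoothNear.snd {f : E → F × G} {x : E} (hf : SmoothNear f x) :
    SmoothNear (fun y => (f y).2) x := by
  filter_upwards [hf] with y h using h.snd

theorem SmoothNear.pi {ι : Type*} [Fintype ι] {f : E → ι → ℝ} {x : E}
    (hf : ∀ i, SmoothNear (fun y => f y i) x) : SmoothNear f x := by
  filter_upwards [Filter.eventually_all.2 hf] with y h using contDiffAt_pi.2 h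

theorem SmoothNear.sum {ι : Type*} {s : Finset ι} {f : ι → E → ℝ} {x : E}
    (hf : ∀ i ∈ s, SmoothNear (f i) x) : SmoothNear (fun y => ∑ i ∈ s, f i y) x := by
  have : ∀ᶠ y in 𝓝 x, ∀ i ∈ s, ContDiffAt ℝ ∞ (f i) y :=
    (Filter.eventually_all_finset s).2 hf
  filter_upwards [this] with y h using ContDiffAt.sum h

theorem SmoothNear.div {f g : E → ℝ} {x : E} (hf : SmoothNear f x) (hg : SmoothNear g x)
    (h0 : g x ≠ 0) : SmoothNear (fun y => f y / g y) x := by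
  filter_upwards [hf, hg, hg.contDiffAt.continuousAt.eventually_ne h0] with y h₁ h₂ h₃
  exact h₁.div h₂ h₃

theorem SmoothNear.const (c : F) (x : E) : SmoothNear (fun _ : E => c) x :=
  ContDiff.smoothNear contDiff_const x

theorem SmoothNear.pow {f : E → ℝ} {x : E} (hf : SmoothNear f x) (n : ℕ) :
    SmoothNear (fun y => f y ^ n) x := by
  filter_upwards [hf] with y h using h.pow n

/-- The derivative in the constant direction `v`. -/
def dirDeriv (v : E) (f : E → ℝ) : E → ℝ := fun x => fderiv ℝ f x v

theorem SmoothNear.fderiv {f : E → F} {x : E} (hf : SmoothNear f x) :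
    SmoothNear (fderiv ℝ f) x := by
  filter_upwards [hf] with y h using h.fderiv_right (m := ∞) (by simp)

theorem SmoothNear.fderiv_apply {f : E → F} {X : E → E} {x : E} (hf : SmoothNear f x)
    (hX : SmoothNear X x) : SmoothNear (fun y => _root_.fderiv ℝ f y (X y)) x := by
  filter_upwards [hf.fderiv, hX] with y h h' using h.clm_apply h'

theorem SmoothNear.dirDeriv {f : E → ℝ} {x : E} (hf : SmoothNear f x) (v : E) :
    SmoothNear (dirDeriv v f) x :=
  hf.fderiv_apply (SmoothNear.const v x)

theorem dirDeriv_congr {f g : E → ℝ} {x : E} (h : f =ᶠ[𝓝 x] g) (v : E) :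
    dirDeriv v f =ᶠ[𝓝 x] dirDeriv v g := by
  filter_upwards [h.eventuallyEq_nhds] with y hy
  simp only [dirDeriv, hy.fderiv_eq]

theorem dirDeriv_iterate_congr {f g : E → ℝ} {x : E} (h : f =ᶠ[𝓝 x] g) (v : E) (n : ℕ) :
    (dirDeriv v)^[n] f =ᶠ[𝓝 x] (dirDeriv v)^[n] g := by
  induction n with
  | zero => exact h
  | succ n ih =>
    simp only [Function.iterate_succ_apply']
    exact dirDeriv_congr ih v

theorem SmoothNear.dirDeriv_iterate {f : E → ℝ} {x : E} (hf : SmoothNear f x) (v : E) (n : ℕ) :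
    SmoothNear ((PointODE.dirDeriv v)^[n] f) x := by
  induction n with
  | zero => exact hf
  | succ n ih =>
    simp only [Function.iterate_succ_apply']
    exact ih.dirDeriv v

theorem dirDeriv_comm {f : E → ℝ} {x : E} (hf : SmoothNear f x) (v w : E) :
    dirDeriv v (dirDeriv w f) =ᶠ[𝓝 x] dirDeriv w (dirDeriv v f) := by
  filter_upwards [hf] with y hy
  have hd : DifferentiableAt ℝ (fderiv ℝ f) y :=
    (hy.fderiv_right (m := ∞) (by simp)).differentiableAt (by simp)
  have key : ∀ a b : E, dirDeriv a (dirDeriv b f) y = fderiv ℝ (fderiv ℝ f) y a b := by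
    intro a b
    have h := hd.hasFDerivAt.clm_apply (hasFDerivAt_const b y)
    have h' : fderiv ℝ (dirDeriv b f) y = _ := h.fderiv
    simp [dirDeriv, h']
  rw [key, key]
  exact (hy.isSymmSndFDerivAt (by simpa using (WithTop.coe_le_coe.2 (le_top : (2 : ℕ∞) ≤ ⊤) : (2 : WithTop ℕ∞) ≤ ∞))).eq v w

theorem dirDeriv_iterate_comm {f : E → ℝ} {x : E} (hf : SmoothNear f x) (v w : E) (n : ℕ) :
    (dirDeriv v)^[n] (dirDeriv w f) =ᶠ[𝓝 x] dirDeriv w ((dirDeriv v)^[n] f) := by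
  induction n with
  | zero => rfl
  | succ n ih =>
    simp only [Function.iterate_succ_apply']
    exact (dirDeriv_congr ih v).trans (dirDeriv_comm (hf.dirDeriv_iterate v n) v w)

theorem dirDeriv_add_apply {f g : E → ℝ} {x : E} (hf : DifferentiableAt ℝ f x)
    (hg : DifferentiableAt ℝ g x) (v : E) :
    dirDeriv v (fun y => f y + g y) x = dirDeriv v f x + dirDeriv v g x := by
  simp [dirDeriv, fderiv_fun_add hf hg]

theorem dirDeriv_mul_apply {f g : E → ℝ} {x : E} (hf : DifferentiableAt ℝ f x)
    (hg : DifferentiableAt ℝ g x) (v : E) :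
    dirDeriv v (fun y => f y * g y) x = dirDeriv v f x * g x + f x * dirDeriv v g x := by
  simp [dirDeriv, fderiv_fun_mul hf hg]; ring

theorem dirDeriv_mul {f g : E → ℝ} {x : E} (hf : SmoothNear f x) (hg : SmoothNear g x) (v : E) :
    dirDeriv v (fun y => f y * g y) =ᶠ[𝓝 x]
      fun y => dirDeriv v f y * g y + f y * dirDeriv v g y := by
  filter_upwards [hf.eventually, hg.eventually] with y h₁ h₂
  exact dirDeriv_mul_apply h₁.differentiableAt h₂.differentiableAt v

end SmoothGerms

/-! ### Calculus of the partial derivatives on `ℝ³` -/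

section JetCalculus

variable {z : Pt} {F G : Pt → ℝ}

theorem pdx_eq : pdx = dirDeriv ((1, 0, 0) : Pt) := rfl
theorem pdy_eq : pdy = dirDeriv ((0, 1, 0) : Pt) := rfl
theorem pdp_eq : pdp = dirDeriv ((0, 0, 1) : Pt) := rfl

theorem partialDeriv_eq (ζ : ℕ × ℕ × ℕ) : partialDeriv ζ F =
    (dirDeriv ((1, 0, 0) : Pt))^[ζ.1] ((dirDeriv ((0, 1, 0) : Pt))^[ζ.2.1]
      ((dirDeriv ((0, 0, 1) : Pt))^[ζ.2.2] F)) := rfl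

theorem SmoothNear.pdx (hF : SmoothNear F z) : SmoothNear (pdx F) z := hF.dirDeriv _
theorem SmoothNear.pdy (hF : SmoothNear F z) : SmoothNear (pdy F) z := hF.dirDeriv _
theorem SmoothNear.pdp (hF : SmoothNear F z) : SmoothNear (pdp F) z := hF.dirDeriv _

theorem SmoothNear.Dx (hF : SmoothNear F z) : SmoothNear (Dx F) z := (germLinear_Dx z).smooth _ hF

theorem fderiv_apply_eq (F : Pt → ℝ) (w v : Pt) :
    fderiv ℝ F w v = v.1 * pdx F w + v.2.1 * pdy F w + v.2.2 * pdp F w := by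
  have : v = v.1 • ((1, 0, 0) : Pt) + v.2.1 • ((0, 1, 0) : Pt) + v.2.2 • ((0, 0, 1) : Pt) := by
    ext <;> simp
  conv_lhs => rw [this]
  simp only [map_add, map_smul, smul_eq_mul]
  rfl

theorem Dx_eq (F : Pt → ℝ) (w : Pt) : Dx F w = pdx F w + w.2.2 * pdy F w := by
  simp [Dx, along, fderiv_apply_eq]

theorem smoothNear_px : SmoothNear (fun w : Pt => w.1) z := ContDiff.smoothNear contDiff_fst z
theorem smoothNear_pp : SmoothNear (fun w : Pt => w.2.2) z :=
  ContDiff.smoothNear (contDiff_snd.comp contDiff_snd) z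

theorem partialDeriv_congr (h : F =ᶠ[𝓝 z] G) (ζ : ℕ × ℕ × ℕ) :
    partialDeriv ζ F =ᶠ[𝓝 z] partialDeriv ζ G :=
  dirDeriv_iterate_congr (dirDeriv_iterate_congr (dirDeriv_iterate_congr h _ _) _ _) _ _

theorem partialDeriv_add (hF : SmoothNear F z) (hG : SmoothNear G z) (ζ : ℕ × ℕ × ℕ) :
    partialDeriv ζ (fun w => F w + G w) z = partialDeriv ζ F z + partialDeriv ζ G z := by
  have := ((germLinear_partialDeriv z ζ).comb F G (fun w => F w + G w) hF hG 1 1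
    (by simp)).self_of_nhds
  simpa using this

theorem partialDeriv_sub (hF : SmoothNear F z) (hG : SmoothNear G z) (ζ : ℕ × ℕ × ℕ) :
    partialDeriv ζ (fun w => F w - G w) z = partialDeriv ζ F z - partialDeriv ζ G z := by
  have := ((germLinear_partialDeriv z ζ).comb F G (fun w => F w - G w) hF hG 1 (-1)
    (Filter.Eventually.of_forall fun w => by simp; ring)).self_of_nhds
  simp only [this]; ring

theorem partialDeriv_const_mul (hF : SmoothNear F z) (c : ℝ) (ζ : ℕ × ℕ × ℕ) :
    partialDeriv ζ (fun w => c * F w) z = c * partialDeriv ζ F z := by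
  have := ((germLinear_partialDeriv z ζ).comb F F (fun w => c * F w) hF hF c 0
    (Filter.Eventually.of_forall fun w => by simp)).self_of_nhds
  simpa using this

theorem partialDeriv_dirDeriv (hF : SmoothNear F z) (ζ : ℕ × ℕ × ℕ) (v : Pt) :
    partialDeriv ζ (dirDeriv v F) =ᶠ[𝓝 z] dirDeriv v (partialDeriv ζ F) := by
  simp only [partialDeriv_eq]
  refine (dirDeriv_iterate_congr (dirDeriv_iterate_congr (dirDeriv_iterate_comm hF _ _ _) _ _)
    _ _).trans ?_
  refine (dirDeriv_iterate_congr (dirDeriv_iterate_comm (hF.dirDeriv_iterate _ _) _ _ _)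
    _ _).trans ?_
  exact dirDeriv_iterate_comm ((hF.dirDeriv_iterate _ _).dirDeriv_iterate _ _) _ _ _

theorem partialDeriv_pdx (hF : SmoothNear F z) (l m n : ℕ) :
    partialDeriv (l, m, n) (pdx F) z = partialDeriv (l + 1, m, n) F z := by
  rw [pdx_eq, (partialDeriv_dirDeriv hF _ _).self_of_nhds]
  simp only [partialDeriv_eq, Function.iterate_succ_apply']

theorem partialDeriv_pdy (hF : SmoothNear F z) (l m n : ℕ) :
    partialDeriv (l, m, n) (pdy F) z = partialDeriv (l, m + 1, n) F z := by
  simp only [partialDeriv_eq, pdy_eq, Function.iterate_succ_apply]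
  exact (dirDeriv_iterate_congr (dirDeriv_iterate_congr (dirDeriv_iterate_comm hF _ _ _) _ _)
    _ _).self_of_nhds

theorem partialDeriv_pdp (F : Pt → ℝ) (l m n : ℕ) :
    partialDeriv (l, m, n) (pdp F) z = partialDeriv (l, m, n + 1) F z := by
  simp only [partialDeriv_eq, pdp_eq, Function.iterate_succ_apply]

theorem partialDeriv_zero (F : Pt → ℝ) : partialDeriv (0, 0, 0) F = F := rfl

/-- Leibniz rule cut off after two terms, because the second derivatives of a linear factor vanish.
-/
theorem dirDeriv_iterate_clm_mul {E : Type*} [NormedAddCommGroup E] [NormedSpace ℝ E]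
    {f : E → ℝ} {x : E} (hf : SmoothNear f x) (ℓ : E →L[ℝ] ℝ) (v : E) (n : ℕ) :
    (dirDeriv v)^[n] (fun y => ℓ y * f y) =ᶠ[𝓝 x]
      fun y => ℓ y * (dirDeriv v)^[n] f y + n * ℓ v * (dirDeriv v)^[n - 1] f y := by
  induction n with
  | zero => simp
  | succ n ih =>
    simp only [Function.iterate_succ_apply']
    refine (dirDeriv_congr ih v).trans ?_
    filter_upwards [(hf.dirDeriv_iterate v n).eventually,
      (hf.dirDeriv_iterate v (n - 1)).eventually] with y h₁ h₂
    have hℓ : DifferentiableAt ℝ ℓ y := ℓ.differentiableAt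
    rw [dirDeriv_add_apply (hℓ.fun_mul h₁.differentiableAt)
      (h₂.differentiableAt.const_mul _), dirDeriv_mul_apply hℓ h₁.differentiableAt]
    have e1 : dirDeriv v ℓ y = ℓ v := by simp [dirDeriv]
    have e2 : dirDeriv v (fun y => n * ℓ v * (dirDeriv v)^[n - 1] f y) y
        = n * ℓ v * (dirDeriv v)^[n] f y := by
      -- For `n = 0` the truncated index `n - 1` is harmless, since its coefficient is zero.
      rcases n with _ | n
      · simp [dirDeriv]
      · simp only [dirDeriv]
        rw [fderiv_const_mul h₂.differentiableAt]
        simp only [Function.iterate_succ_apply']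
        rfl
    rw [e1, e2, Nat.add_sub_cancel]
    push_cast
    ring

theorem partialDeriv_clm_mul (hF : SmoothNear F z) (ℓ : Pt →L[ℝ] ℝ) (l m n : ℕ) :
    partialDeriv (l, m, n) (fun w => ℓ w * F w) z = ℓ z * partialDeriv (l, m, n) F z
      + l * ℓ (1, 0, 0) * partialDeriv (l - 1, m, n) F z
      + m * ℓ (0, 1, 0) * partialDeriv (l, m - 1, n) F z
      + n * ℓ (0, 0, 1) * partialDeriv (l, m, n - 1) F z := by
  set T₁ := (dirDeriv ((1, 0, 0) : Pt))^[l]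
  set T₂ := (dirDeriv ((0, 1, 0) : Pt))^[m]
  have L₁ : GermLinear z T₁ := (germLinear_pdx z).iterate l
  have L₂ : GermLinear z T₂ := (germLinear_pdy z).iterate m
  have s : ∀ i, SmoothNear ((dirDeriv ((0, 0, 1) : Pt))^[i] F) z := fun i =>
    hF.dirDeriv_iterate _ i
  have hℓ : SmoothNear (fun w => ℓ w) z := ContDiff.smoothNear ℓ.contDiff z
  have e₁ := dirDeriv_iterate_clm_mul hF ℓ ((0, 0, 1) : Pt) n
  have e₂ := L₂.comb _ _ _ (hℓ.mul (s n)) (s (n - 1)) 1 (n * ℓ (0, 0, 1))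
    (e₁.trans (by simp))
  have e₃ := dirDeriv_iterate_clm_mul (s n) ℓ ((0, 1, 0) : Pt) m
  have e₄ : T₂ ((dirDeriv ((0, 0, 1) : Pt))^[n] (fun w => ℓ w * F w)) =ᶠ[𝓝 z] fun w =>
      1 * (1 * (ℓ w * T₂ ((dirDeriv ((0, 0, 1) : Pt))^[n] F) w)
        + (m * ℓ (0, 1, 0)) * (dirDeriv ((0, 1, 0) : Pt))^[m - 1]
          ((dirDeriv ((0, 0, 1) : Pt))^[n] F) w)
        + (n * ℓ (0, 0, 1)) * T₂ ((dirDeriv ((0, 0, 1) : Pt))^[n - 1] F) w := by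
    filter_upwards [e₂, e₃] with w h₂ h₃
    rw [h₂]
    simp only [T₂, h₃]
    ring
  have sA : SmoothNear (fun w => ℓ w * T₂ ((dirDeriv ((0, 0, 1) : Pt))^[n] F) w) z :=
    hℓ.mul (L₂.smooth _ (s n))
  have sB : SmoothNear ((dirDeriv ((0, 1, 0) : Pt))^[m - 1]
      ((dirDeriv ((0, 0, 1) : Pt))^[n] F)) z := (s n).dirDeriv_iterate _ _
  have sC : SmoothNear (T₂ ((dirDeriv ((0, 0, 1) : Pt))^[n - 1] F)) z := L₂.smooth _ (s _)
  have e₅ := L₁.comb _ _ _ (((SmoothNear.const 1 z).mul sA).add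
    ((SmoothNear.const (m * ℓ (0, 1, 0)) z).mul sB)) sC 1 (n * ℓ (0, 0, 1)) e₄
  have e₆ := L₁.comb _ _ _ sA sB 1 (m * ℓ (0, 1, 0)) Filter.EventuallyEq.rfl
  have e₇ := dirDeriv_iterate_clm_mul (L₂.smooth _ (s n)) ℓ ((1, 0, 0) : Pt) l
  have h₅ := e₅.self_of_nhds
  have h₆ := e₆.self_of_nhds
  have h₇ := e₇.self_of_nhds
  simp only [partialDeriv_eq]
  change T₁ (T₂ _) z = _
  simp only [h₅, h₆]
  simp only [T₁, h₇]
  simp only [T₂]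
  ring

theorem partialDeriv_p_mul (hF : SmoothNear F z) (l m n : ℕ) :
    partialDeriv (l, m, n) (fun w => w.2.2 * F w) z = z.2.2 * partialDeriv (l, m, n) F z
      + n * partialDeriv (l, m, n - 1) F z := by
  have := partialDeriv_clm_mul hF ((ContinuousLinearMap.snd ℝ ℝ ℝ).comp
    (ContinuousLinearMap.snd ℝ ℝ (ℝ × ℝ))) l m n
  simpa using this

theorem partialDeriv_x_mul (hF : SmoothNear F z) (l m n : ℕ) :
    partialDeriv (l, m, n) (fun w => w.1 * F w) z = z.1 * partialDeriv (l, m, n) F z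
      + l * partialDeriv (l - 1, m, n) F z := by
  have := partialDeriv_clm_mul hF (ContinuousLinearMap.fst ℝ ℝ (ℝ × ℝ)) l m n
  simpa using this

end JetCalculus

/-! ### Weighted order of vanishing -/

section Vanishing

variable {z : Pt} {F G : Pt → ℝ} {c e e₁ e₂ : ℕ}

theorem pdx_mul (hF : SmoothNear F z) (hG : SmoothNear G z) :
    pdx (fun w => F w * G w) =ᶠ[𝓝 z] fun w => pdx F w * G w + F w * pdx G w :=
  dirDeriv_mul hF hG _

theorem pdy_mul (hF : SmoothNear F z) (hG : SmoothNear G z) :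
    pdy (fun w => F w * G w) =ᶠ[𝓝 z] fun w => pdy F w * G w + F w * pdy G w :=
  dirDeriv_mul hF hG _

theorem pdp_mul (hF : SmoothNear F z) (hG : SmoothNear G z) :
    pdp (fun w => F w * G w) =ᶠ[𝓝 z] fun w => pdp F w * G w + F w * pdp G w :=
  dirDeriv_mul hF hG _

/-- `F` vanishes at `z` to order `e`, where `∂/∂x` and `∂/∂y` count once and `∂/∂p` counts
`c` times. -/
def Vanish (c : ℕ) (z : Pt) (e : ℕ) (F : Pt → ℝ) : Prop :=
  ∀ l m n, l + m + c * n < e → partialDeriv (l, m, n) F z = 0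

theorem Vanish.mono (h : Vanish c z e₁ F) (he : e₂ ≤ e₁) : Vanish c z e₂ F :=
  fun l m n hl => h l m n (hl.trans_le he)

theorem Vanish.zero (c : ℕ) (z : Pt) (F : Pt → ℝ) : Vanish c z 0 F :=
  fun _ _ _ h => absurd h (Nat.not_lt_zero _)

theorem Vanish.congr (h : Vanish c z e F) (hG : G =ᶠ[𝓝 z] F) : Vanish c z e G :=
  fun l m n hl => by rw [(partialDeriv_congr hG _).self_of_nhds, h l m n hl]

theorem Vanish.add (h₁ : Vanish c z e F) (h₂ : Vanish c z e G) (hF : SmoothNear F z)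
    (hG : SmoothNear G z) : Vanish c z e (fun w => F w + G w) := fun l m n hl => by
  rw [partialDeriv_add hF hG, h₁ l m n hl, h₂ l m n hl, add_zero]

theorem Vanish.sub (h₁ : Vanish c z e F) (h₂ : Vanish c z e G) (hF : SmoothNear F z)
    (hG : SmoothNear G z) : Vanish c z e (fun w => F w - G w) := fun l m n hl => by
  rw [partialDeriv_sub hF hG, h₁ l m n hl, h₂ l m n hl, sub_zero]

theorem Vanish.const_mul (h : Vanish c z e F) (hF : SmoothNear F z) (a : ℝ) :
    Vanish c z e (fun w => a * F w) := fun l m n hl => by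
  rw [partialDeriv_const_mul hF, h l m n hl, mul_zero]

theorem Vanish.pdx (h : Vanish c z e F) (hF : SmoothNear F z) : Vanish c z (e - 1) (pdx F) :=
  fun l m n hl => by
    rw [partialDeriv_pdx hF, h]
    omega

theorem Vanish.pdy (h : Vanish c z e F) (hF : SmoothNear F z) : Vanish c z (e - 1) (pdy F) :=
  fun l m n hl => by
    rw [partialDeriv_pdy hF, h]
    omega

theorem Vanish.pdp (h : Vanish c z e F) : Vanish c z (e - c) (pdp F) :=
  fun l m n hl => by
    rw [partialDeriv_pdp, h]
    rw [Nat.mul_succ]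
    omega

/-- By the Leibniz rule one derivative is moved onto one factor, whose order drops by the weight of
that derivative. The induction runs over the unweighted order `l + m + n`, since for `c = 0` a
derivative in `p` does not lower the weighted one. Truncated subtraction of orders only increases
the sum that has to be reached. -/
theorem Vanish.mul (h₁ : Vanish c z e₁ F) (h₂ : Vanish c z e₂ G) (hF : SmoothNear F z)
    (hG : SmoothNear G z) : Vanish c z (e₁ + e₂) (fun w => F w * G w) := by
  suffices H : ∀ N e₁ e₂ (F G : Pt → ℝ) l m n, l + m + n = N → SmoothNear F z →
      SmoothNear G z → Vanish c z e₁ F → Vanish c z e₂ G → l + m + c * n < e₁ + e₂ →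
      partialDeriv (l, m, n) (fun w => F w * G w) z = 0 from
    fun l m n hl => H _ e₁ e₂ F G l m n rfl hF hG h₁ h₂ hl
  intro N
  induction N with
  | zero =>
    intro e₁ e₂ F G l m n hN hF hG h₁ h₂ hl
    obtain ⟨rfl, rfl, rfl⟩ : l = 0 ∧ m = 0 ∧ n = 0 := by omega
    rw [partialDeriv_zero]
    rcases Nat.eq_zero_or_pos e₁ with h | h
    · have : G z = 0 := h₂ 0 0 0 (by omega)
      simp [this]
    · have : F z = 0 := h₁ 0 0 0 (by omega)
      simp [this]
  | succ N ih =>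
    intro e₁ e₂ F G l m n hN hF hG h₁ h₂ hl
    have hFG := hF.mul hG
    rcases l with _ | l
    · rcases m with _ | m
      · rcases n with _ | n
        · omega
        · rw [← partialDeriv_pdp, (partialDeriv_congr (pdp_mul hF hG) _).self_of_nhds,
          partialDeriv_add (hF.pdp.mul hG) (hF.mul hG.pdp),
            ih (e₁ - c) e₂ _ _ _ _ _ (by omega) hF.pdp hG h₁.pdp h₂ (by
              rw [Nat.mul_succ] at hl; omega),
            ih e₁ (e₂ - c) _ _ _ _ _ (by omega) hF hG.pdp h₁ h₂.pdp (by
              rw [Nat.mul_succ] at hl; omega), add_zero]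
      · rw [← partialDeriv_pdy hFG, (partialDeriv_congr (pdy_mul hF hG) _).self_of_nhds,
          partialDeriv_add (hF.pdy.mul hG) (hF.mul hG.pdy),
          ih (e₁ - 1) e₂ _ _ _ _ _ (by omega) hF.pdy hG (h₁.pdy hF) h₂ (by omega),
          ih e₁ (e₂ - 1) _ _ _ _ _ (by omega) hF hG.pdy h₁ (h₂.pdy hG) (by omega), add_zero]
    · rw [← partialDeriv_pdx hFG, (partialDeriv_congr (pdx_mul hF hG) _).self_of_nhds,
          partialDeriv_add (hF.pdx.mul hG) (hF.mul hG.pdx),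
        ih (e₁ - 1) e₂ _ _ _ _ _ (by omega) hF.pdx hG (h₁.pdx hF) h₂ (by omega),
        ih e₁ (e₂ - 1) _ _ _ _ _ (by omega) hF hG.pdx h₁ (h₂.pdx hG) (by omega), add_zero]

theorem Vanish.mul_smooth (h₁ : Vanish c z e F) (hF : SmoothNear F z) (hG : SmoothNear G z) :
    Vanish c z e (fun w => F w * G w) :=
  h₁.mul (Vanish.zero c z G) hF hG

theorem Vanish.smooth_mul (h₁ : Vanish c z e F) (hF : SmoothNear F z) (hG : SmoothNear G z) :
    Vanish c z e (fun w => G w * F w) :=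
  ((Vanish.zero c z G).mul h₁ hG hF).mono (by omega)

theorem Vanish.pow (h : Vanish c z 1 F) (hF : SmoothNear F z) (n : ℕ) :
    Vanish c z n (fun w => F w ^ n) := by
  induction n with
  | zero => exact Vanish.zero _ _ _
  | succ n ih =>
    simp only [pow_succ]
    exact ih.mul h (hF.pow n) hF

theorem Vanish.Dx (h : Vanish c z e F) (hF : SmoothNear F z) : Vanish c z (e - 1) (Dx F) := by
  have : PointODE.Dx F = fun w => PointODE.pdx F w + w.2.2 * PointODE.pdy F w :=
    funext (Dx_eq F)
  rw [this]
  exact (h.pdx hF).add ((h.pdy hF).smooth_mul hF.pdy smoothNear_pp) hF.pdx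
    (smoothNear_pp.mul hF.pdy)

/-- The recursive form of vanishing in the ordinary sense; it makes the chain rule usable by
induction on the order. -/
theorem vanish_one_succ (hF : SmoothNear F z) :
    Vanish 1 z (e + 1) F ↔
      F z = 0 ∧ Vanish 1 z e (pdx F) ∧ Vanish 1 z e (pdy F) ∧ Vanish 1 z e (pdp F) := by
  constructor
  · exact fun h => ⟨h 0 0 0 (by omega), h.pdx hF, h.pdy hF, h.pdp⟩
  · rintro ⟨h₀, hx, hy, hp⟩ l m n hl
    rcases l with _ | l
    · rcases m with _ | m
      · rcases n with _ | n
        · exact h₀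
        · rw [← partialDeriv_pdp]
          exact hp _ _ _ (by omega)
      · rw [← partialDeriv_pdy hF]
        exact hy _ _ _ (by omega)
    · rw [← partialDeriv_pdx hF]
      exact hx _ _ _ (by omega)

theorem dirDeriv_comp_apply {Λ : Pt → Pt} {w : Pt} (hF : DifferentiableAt ℝ F (Λ w))
    (hΛ : DifferentiableAt ℝ Λ w) (v : Pt) :
    dirDeriv v (fun w => F (Λ w)) w =
      pdx F (Λ w) * dirDeriv v (fun w => (Λ w).1) w
      + pdy F (Λ w) * dirDeriv v (fun w => (Λ w).2.1) w
      + pdp F (Λ w) * dirDeriv v (fun w => (Λ w).2.2) w := by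
  have h : fderiv ℝ (fun w => F (Λ w)) w v = fderiv ℝ F (Λ w) (fderiv ℝ Λ w v) := by
    have := fderiv_comp w hF hΛ
    change fderiv ℝ (F ∘ Λ) w v = _
    rw [this]; rfl
  simp only [dirDeriv, h]
  rw [fderiv_apply_eq]
  have h2 : DifferentiableAt ℝ (fun w => (Λ w).2) w := hΛ.snd
  rw [fderiv.fst hΛ, fderiv.fst h2, fderiv.snd h2, fderiv.snd hΛ]
  simp [mul_comm]

/-- Each first derivative of the composite is a combination, with smooth coefficients, of composites
of first derivatives of `F`, which vanish to order `e` by induction. Only weight one is possible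
here, because `Λ` mixes the three directions. -/
theorem Vanish.comp {Λ : Pt → Pt} (hΛ : SmoothNear Λ z) (hF : SmoothNear F (Λ z))
    (h : Vanish 1 (Λ z) e F) : Vanish 1 z e (fun w => F (Λ w)) := by
  induction e generalizing F with
  | zero => exact Vanish.zero _ _ _
  | succ e ih =>
    obtain ⟨h₀, hx, hy, hp⟩ := (vanish_one_succ hF).1 h
    have key : ∀ v : Pt, Vanish 1 z e (dirDeriv v fun w => F (Λ w)) := by
      intro v
      have s1 := hF.pdx.comp hΛ
      have s2 := hF.pdy.comp hΛ
      have s3 := hF.pdp.comp hΛ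
      have t1 := (hΛ.fst).dirDeriv v
      have t2 := (hΛ.snd.fst).dirDeriv v
      have t3 := (hΛ.snd.snd).dirDeriv v
      refine ((((ih hF.pdx hx).mul_smooth s1 t1).add ((ih hF.pdy hy).mul_smooth s2 t2)
        (s1.mul t1) (s2.mul t2)).add ((ih hF.pdp hp).mul_smooth s3 t3)
        ((s1.mul t1).add (s2.mul t2)) (s3.mul t3)).congr ?_
      filter_upwards [hΛ.eventually, hΛ.contDiffAt.continuousAt.eventually hF.eventually]
        with w h₁ h₂
      exact dirDeriv_comp_apply h₂.differentiableAt h₁.differentiableAt v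
    exact (vanish_one_succ (hF.comp hΛ)).2 ⟨h₀, key _, key _, key _⟩

theorem jetOf_eq_iff {k : ℕ} (hF : SmoothNear F z) (hG : SmoothNear G z) :
    jetOf k F z = jetOf k G z ↔ Vanish 1 z (k + 1) (fun w => F w - G w) := by
  constructor
  · intro h l m n hl
    have := congrFun (congrArg Prod.snd h) ⟨(l, m, n), by simp; omega⟩
    simp only [jetOf] at this
    rw [partialDeriv_sub hF hG, this, sub_self]
  · intro h
    refine Prod.ext rfl (funext fun ⟨⟨l, m, n⟩, hζ⟩ => ?_)
    have := h l m n (by simp at hζ; omega)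
    rw [partialDeriv_sub hF hG, sub_eq_zero] at this
    exact this

end Vanishing

/-! ### Jets, Taylor polynomials and the prolongation on representatives -/

section Representation

variable {z : Pt} {V : Plane → Plane}

/-- The function of which the coefficients of the prolonged field are the derivatives. -/
def prolongFun (V : Plane → Plane) (h : Pt → ℝ) (z : Pt) : Pt → ℝ := fun w =>
  genFun V h w + coefa V z * pdx h w + coefb V z * pdy h w + coefA V z * pdp h w

theorem smoothNear_coefA (hV : SmoothNear V z.base) : SmoothNear (coefA V) z :=
  (smoothNear_charFun hV).Dx

theorem smoothNear_coefB₀ (hV : SmoothNear V z.base) : SmoothNear (coefB₀ V) z :=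
  (smoothNear_charFun hV).Dx.Dx

theorem smoothNear_coefB₁ (hV : SmoothNear V z.base) : SmoothNear (coefB₁ V) z :=
  (smoothNear_charFun hV).pdy.sub ((SmoothNear.const 2 z).mul (smoothNear_coefa hV).Dx)

theorem smoothNear_prolongFun (hV : SmoothNear V z.base) {h : Pt → ℝ} (hh : SmoothNear h z) :
    SmoothNear (prolongFun V h z) z :=
  (((smoothNear_genFun hV hh).add ((SmoothNear.const _ z).mul hh.pdx)).add
    ((SmoothNear.const _ z).mul hh.pdy)).add ((SmoothNear.const _ z).mul hh.pdp)

theorem partialDeriv_prolongFun (hV : SmoothNear V z.base) {h : Pt → ℝ} (hh : SmoothNear h z)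
    (ζ : ℕ × ℕ × ℕ) : partialDeriv ζ (prolongFun V h z) z =
      partialDeriv ζ (genFun V h) z + coefa V z * partialDeriv ζ (pdx h) z
        + coefb V z * partialDeriv ζ (pdy h) z + coefA V z * partialDeriv ζ (pdp h) z := by
  have s := smoothNear_genFun hV hh
  have sx := (SmoothNear.const (coefa V z) z).mul hh.pdx
  have sy := (SmoothNear.const (coefb V z) z).mul hh.pdy
  have sp := (SmoothNear.const (coefA V z) z).mul hh.pdp
  unfold prolongFun
  rw [partialDeriv_add ((s.add sx).add sy) sp, partialDeriv_add (s.add sx) sy,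
    partialDeriv_add s sx, partialDeriv_const_mul hh.pdx, partialDeriv_const_mul hh.pdy,
    partialDeriv_const_mul hh.pdp]

/-- The divided monomial `(x - x₀)^i (y - y₀)^j (p - p₀)^n / (i! j! n!)`. -/
def monomialAt (z : Pt) (i j n : ℕ) : Pt → ℝ := fun w =>
  ((w.1 - z.1) ^ i / (i.factorial : ℝ)) * ((w.2.1 - z.2.1) ^ j / (j.factorial : ℝ))
    * ((w.2.2 - z.2.2) ^ n / (n.factorial : ℝ))

theorem contDiff_monomialAt (z : Pt) (i j n : ℕ) : ContDiff ℝ ∞ (monomialAt z i j n) := by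
  unfold monomialAt; fun_prop

theorem hasDerivAt_divided_pow (a t : ℝ) (i : ℕ) :
    HasDerivAt (fun t => (t - a) ^ (i + 1) / ((i + 1).factorial : ℝ))
      ((t - a) ^ i / (i.factorial : ℝ)) t := by
  have h := (((hasDerivAt_id t).sub_const a).pow (i + 1)).div_const ((i + 1).factorial : ℝ)
  refine h.congr_deriv ?_
  have h1 : (i.factorial : ℝ) ≠ 0 := by positivity
  have h2 : ((i : ℝ) + 1) ≠ 0 := by positivity
  rw [Nat.factorial_succ]
  push_cast
  simp
  field_simp

theorem dirDeriv_apply_of_hasDerivAt {E : Type*} [NormedAddCommGroup E] [NormedSpace ℝ E]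
    {f : E → ℝ} {x v : E} {d : ℝ} (hf : DifferentiableAt ℝ f x)
    (h : HasDerivAt (fun t : ℝ => f (x + t • v)) d 0) : dirDeriv v f x = d := by
  have hl : HasDerivAt (fun t : ℝ => x + t • v) v 0 := by
    simpa using ((hasDerivAt_id (0 : ℝ)).smul_const v).const_add x
  have hf' : HasFDerivAt f (fderiv ℝ f x) (x + (0 : ℝ) • v) := by
    simpa using hf.hasFDerivAt
  exact (hf'.comp_hasDerivAt (0 : ℝ) hl).unique h

theorem pdx_monomialAt_succ (z : Pt) (i j n : ℕ) :
    pdx (monomialAt z (i + 1) j n) = monomialAt z i j n := by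
  funext w
  refine dirDeriv_apply_of_hasDerivAt
    ((contDiff_monomialAt z _ _ _).contDiffAt.differentiableAt (by simp)) ?_
  have h := (hasDerivAt_divided_pow z.1 (w.1 + 0) i).comp_const_add w.1 0
  simpa [monomialAt] using (h.mul_const ((w.2.1 - z.2.1) ^ j / (j.factorial : ℝ))).mul_const
    ((w.2.2 - z.2.2) ^ n / (n.factorial : ℝ))

theorem pdy_monomialAt_succ (z : Pt) (i j n : ℕ) :
    pdy (monomialAt z i (j + 1) n) = monomialAt z i j n := by
  funext w
  refine dirDeriv_apply_of_hasDerivAt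
    ((contDiff_monomialAt z _ _ _).contDiffAt.differentiableAt (by simp)) ?_
  have h := (hasDerivAt_divided_pow z.2.1 (w.2.1 + 0) j).comp_const_add w.2.1 0
  simpa [monomialAt] using (h.const_mul ((w.1 - z.1) ^ i / (i.factorial : ℝ))).mul_const
    ((w.2.2 - z.2.2) ^ n / (n.factorial : ℝ))

theorem pdp_monomialAt_succ (z : Pt) (i j n : ℕ) :
    pdp (monomialAt z i j (n + 1)) = monomialAt z i j n := by
  funext w
  refine dirDeriv_apply_of_hasDerivAt
    ((contDiff_monomialAt z _ _ _).contDiffAt.differentiableAt (by simp)) ?_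
  have h := (hasDerivAt_divided_pow z.2.2 (w.2.2 + 0) n).comp_const_add w.2.2 0
  simpa [monomialAt] using h.const_mul (((w.1 - z.1) ^ i / (i.factorial : ℝ))
    * ((w.2.1 - z.2.1) ^ j / (j.factorial : ℝ)))

theorem dirDeriv_eq_zero_of_invariant {E : Type*} [NormedAddCommGroup E] [NormedSpace ℝ E]
    {f : E → ℝ} {x v : E} (hf : DifferentiableAt ℝ f x) (h : ∀ t : ℝ, f (x + t • v) = f x) :
    dirDeriv v f x = 0 :=
  dirDeriv_apply_of_hasDerivAt hf (by simpa only [h] using hasDerivAt_const (0 : ℝ) (f x))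

theorem pdx_monomialAt_zero (z : Pt) (j n : ℕ) : pdx (monomialAt z 0 j n) = fun _ => 0 :=
  funext fun w => dirDeriv_eq_zero_of_invariant
    ((contDiff_monomialAt z _ _ _).contDiffAt.differentiableAt (by simp))
    (by intro t; simp [monomialAt])

theorem pdy_monomialAt_zero (z : Pt) (i n : ℕ) : pdy (monomialAt z i 0 n) = fun _ => 0 :=
  funext fun w => dirDeriv_eq_zero_of_invariant
    ((contDiff_monomialAt z _ _ _).contDiffAt.differentiableAt (by simp))
    (by intro t; simp [monomialAt])

theorem pdp_monomialAt_zero (z : Pt) (i j : ℕ) : pdp (monomialAt z i j 0) = fun _ => 0 :=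
  funext fun w => dirDeriv_eq_zero_of_invariant
    ((contDiff_monomialAt z _ _ _).contDiffAt.differentiableAt (by simp))
    (by intro t; simp [monomialAt])

theorem partialDeriv_monomialAt (z : Pt) (l m n i j r : ℕ) :
    partialDeriv (l, m, n) (monomialAt z i j r) z = if l = i ∧ m = j ∧ n = r then 1 else 0 := by
  have hs : ∀ i j r, SmoothNear (monomialAt z i j r) z := fun i j r =>
    ContDiff.smoothNear (contDiff_monomialAt z i j r) z
  have h0 : ∀ ζ, partialDeriv ζ (fun _ : Pt => (0 : ℝ)) z = 0 := by
    intro ζ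
    have := partialDeriv_const_mul (SmoothNear.const (0 : ℝ) z) 0 ζ
    simpa using this
  induction l generalizing i with
  | succ l ih =>
    rw [← partialDeriv_pdx (hs _ _ _)]
    rcases i with _ | i
    · rw [pdx_monomialAt_zero, h0]; simp
    · rw [pdx_monomialAt_succ, ih]; simp
  | zero =>
    induction m generalizing j with
    | succ m ih =>
      rw [← partialDeriv_pdy (hs _ _ _)]
      rcases j with _ | j
      · rw [pdy_monomialAt_zero, h0]; simp
      · rw [pdy_monomialAt_succ, ih]; simp
    | zero =>
      induction n generalizing r with
      | succ n ih =>
        rw [← partialDeriv_pdp]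
        rcases r with _ | r
        · rw [pdp_monomialAt_zero, h0]; simp
        · rw [pdp_monomialAt_succ, ih]; simp
      | zero =>
        rw [partialDeriv_zero]
        rcases i with _ | i <;> rcases j with _ | j <;> rcases r with _ | r <;>
          simp [monomialAt]

theorem partialDeriv_sum {ι : Type*} (s : Finset ι) (F : ι → Pt → ℝ)
    (hF : ∀ i ∈ s, SmoothNear (F i) z) (ζ : ℕ × ℕ × ℕ) :
    partialDeriv ζ (fun w => ∑ i ∈ s, F i w) z = ∑ i ∈ s, partialDeriv ζ (F i) z := by
  classical
  induction s using Finset.induction_on with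
  | empty =>
    have := partialDeriv_const_mul (SmoothNear.const (0 : ℝ) z) 0 ζ
    simpa using this
  | insert a s ha ih =>
    simp only [Finset.sum_insert ha]
    rw [partialDeriv_add (hF a (by simp)) (SmoothNear.sum fun i hi => hF i (by simp [hi])),
      ih fun i hi => hF i (by simp [hi])]

theorem taylor_eq {k : ℕ} (θ : Jet k) : θ.taylor = fun w =>
    ∑ ζ : JetIdx k, θ.2 ζ * monomialAt θ.1 ζ.1.1 ζ.1.2.1 ζ.1.2.2 w := by
  funext w
  simp only [Jet.taylor, monomialAt, mul_assoc]

/-- The divided monomials are dual to the partial derivatives at the base point. -/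
theorem jetOf_taylor {k : ℕ} (θ : Jet k) : jetOf k θ.taylor θ.1 = θ := by
  refine Prod.ext rfl (funext fun ⟨⟨l, m, n⟩, hζ⟩ => ?_)
  have hs : ∀ i j r, SmoothNear (monomialAt θ.1 i j r) θ.1 := fun i j r =>
    ContDiff.smoothNear (contDiff_monomialAt θ.1 i j r) θ.1
  simp only [jetOf, taylor_eq]
  rw [partialDeriv_sum _ _ fun ζ _ => (SmoothNear.const _ _).mul (hs _ _ _)]
  simp only [partialDeriv_const_mul (hs _ _ _), partialDeriv_monomialAt]
  rw [Finset.sum_eq_single ⟨(l, m, n), hζ⟩]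
  · simp
  · rintro ⟨⟨i, j, r⟩, hξ⟩ _ hne
    rw [if_neg, mul_zero]
    rintro ⟨rfl, rfl, rfl⟩
    exact hne rfl
  · simp

theorem smoothNear_taylor {k : ℕ} (θ : Jet k) (z : Pt) : SmoothNear θ.taylor z :=
  ContDiff.smoothNear (contDiff_taylor θ) z

/-- The prolongation at a jet can be computed on any function which represents this jet. -/
theorem prolongVec_jetOf {k : ℕ} {h : Pt → ℝ} (hh : SmoothNear h z)
    (hV : SmoothNear V z.base) : prolongVec (jetOf k h z) V =
      ((coefa V z, coefb V z, coefA V z), fun ζ => partialDeriv ζ.1 (prolongFun V h z) z) := by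
  set θ := jetOf k h z with hθ
  have hz : θ.1 = z := rfl
  set t := θ.taylor
  have ht : SmoothNear t z := smoothNear_taylor θ z
  have hjet : jetOf k t z = jetOf k h z := by
    rw [← hθ]; exact jetOf_taylor θ
  set e : Pt → ℝ := fun w => t w - h w with he
  have se : SmoothNear e z := ht.sub hh
  have hve : Vanish 1 z (k + 1) e := (jetOf_eq_iff ht hh).1 hjet
  have sa := smoothNear_coefa hV
  have sb := smoothNear_coefb hV
  have sA := smoothNear_coefA hV
  have sB := smoothNear_coefB₁ hV
  have hone : ∀ F : Pt → ℝ, SmoothNear F z → Vanish 1 z 1 (fun w => F w - F z) := by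
    intro F hF l m n hl
    obtain ⟨rfl, rfl, rfl⟩ : l = 0 ∧ m = 0 ∧ n = 0 := by omega
    simp [partialDeriv_zero]
  have sub : ∀ v : Pt, dirDeriv v e =ᶠ[𝓝 z] fun w => dirDeriv v t w - dirDeriv v h w := by
    intro v
    filter_upwards [ht.eventually, hh.eventually] with w h₁ h₂
    simp [he, dirDeriv, fderiv_fun_sub h₁.differentiableAt h₂.differentiableAt]
  have sa' := sa.sub (SmoothNear.const (coefa V z) z)
  have sb' := sb.sub (SmoothNear.const (coefb V z) z)
  have sA' := sA.sub (SmoothNear.const (coefA V z) z)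
  -- The term `B₀` cancels, and the derivatives of the error `e` enter only multiplied by `a -
  -- a(z)`, `b - b(z)` or `A - A(z)`. Each such factor restores the one order of vanishing that the
  -- derivative of `e` has lost.
  have key : Vanish 1 z (k + 1) (fun w => prolongFun V t z w - prolongFun V h z w) := by
    have v1 := hve.smooth_mul se sB
    have v2 := ((hone _ sa).mul (hve.pdx se) sa' se.pdx).mono (e₂ := k + 1) (by omega)
    have v3 := ((hone _ sb).mul (hve.pdy se) sb' se.pdy).mono (e₂ := k + 1) (by omega)
    have v4 := ((hone _ sA).mul hve.pdp sA' se.pdp).mono (e₂ := k + 1) (by omega)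
    refine (((v1.sub v2 (sB.mul se) (sa'.mul se.pdx)).sub v3
      ((sB.mul se).sub (sa'.mul se.pdx)) (sb'.mul se.pdy)).sub v4
      (((sB.mul se).sub (sa'.mul se.pdx)).sub (sb'.mul se.pdy)) (sA'.mul se.pdp)).congr ?_
    filter_upwards [sub (1, 0, 0), sub (0, 1, 0), sub (0, 0, 1)] with w h₁ h₂ h₃
    simp only [pdx_eq, pdy_eq, pdp_eq, prolongFun, genFun]
    rw [h₁, h₂, h₃]
    simp only [he]
    ring
  refine Prod.ext rfl (funext fun ⟨⟨l, m, n⟩, hζ⟩ => ?_)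
  have h1 := key l m n (by simp at hζ; omega)
  rw [partialDeriv_sub (smoothNear_prolongFun hV ht) (smoothNear_prolongFun hV hh),
    sub_eq_zero] at h1
  change _ = partialDeriv (l, m, n) (prolongFun V h z) z
  rw [← h1, partialDeriv_prolongFun hV ht]
  rfl

theorem prolongVec_eq {k : ℕ} (θ : Jet k) (hV : SmoothNear V θ.1.base) : prolongVec θ V =
    ((coefa V θ.1, coefb V θ.1, coefA V θ.1),
      fun ζ => partialDeriv ζ.1 (prolongFun V θ.taylor θ.1) θ.1) := by
  conv_lhs => rw [← jetOf_taylor θ]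
  exact prolongVec_jetOf (smoothNear_taylor θ _) hV

theorem proj_jetOf {j k : ℕ} (h : j ≤ k) (f : Pt → ℝ) (z : Pt) :
    (jetOf k f z).proj h = jetOf j f z := rfl

/-- The Taylor polynomial of `θ` also represents the projected jet, so both sides are computed on
the same function. -/
theorem prolongVec_proj {j k : ℕ} (h : j ≤ k) (θ : Jet k) (hV : SmoothNear V θ.1.base) :
    prolongVec (θ.proj h) V = (prolongVec θ V).proj h := by
  have : θ.proj h = jetOf j θ.taylor θ.1 := by
    rw [← proj_jetOf h, jetOf_taylor]
  rw [this, prolongVec_jetOf (smoothNear_taylor θ _) hV, prolongVec_eq θ hV]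
  rfl

end Representation

/-! ### Dimension of the jet spaces -/

section Counting

/-- The pairs `(i, j)` with `i + j ≤ d`. -/
def triangle (d : ℕ) : Finset (ℕ × ℕ) := (Finset.range (d + 1)).biUnion Finset.HasAntidiagonal.antidiagonal

theorem mem_triangle {d : ℕ} {s : ℕ × ℕ} : s ∈ triangle d ↔ s.1 + s.2 ≤ d := by
  simp [triangle]

theorem two_mul_card_triangle (d : ℕ) : 2 * (triangle d).card = (d + 1) * (d + 2) := by
  have hd : (triangle d).card = ∑ i ∈ Finset.range (d + 1), (i + 1) := by
    rw [triangle, Finset.card_biUnion]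
    · simp
    · intro i _ j _ hij
      rw [Function.onFun, Finset.disjoint_left]
      intro s hs hs'
      simp only [Finset.HasAntidiagonal.mem_antidiagonal] at hs hs'
      omega
  rw [hd]
  induction d with
  | zero => simp
  | succ d ih =>
    rw [Finset.sum_range_succ, mul_add, ih]
    · ring
    · rw [triangle, Finset.card_biUnion]
      · simp
      · intro i _ j _ hij
        rw [Function.onFun, Finset.disjoint_left]
        intro s hs hs'
        simp only [Finset.HasAntidiagonal.mem_antidiagonal] at hs hs'
        omega

/-- Slicing by the exponent of `p` turns the count into a sum of triangular numbers. -/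
theorem six_mul_card_jetIdx (k : ℕ) :
    6 * Fintype.card (JetIdx k) = (k + 1) * (k + 2) * (k + 3) := by
  have h : Fintype.card (JetIdx k) = ∑ n ∈ Finset.range (k + 1), (triangle (k - n)).card := by
    rw [Fintype.card_of_subtype ((Finset.range (k + 1)).biUnion fun n =>
      (triangle (k - n)).image fun s => (s.1, s.2, n))]
    · rw [Finset.card_biUnion]
      · refine Finset.sum_congr rfl fun n _ => Finset.card_image_of_injective _ ?_
        rintro ⟨a, b⟩ ⟨c, d⟩ h
        simpa using h
      · intro i _ j _ hij
        rw [Function.onFun, Finset.disjoint_left]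
        rintro ⟨a, b, c⟩ hs hs'
        simp only [Finset.mem_image, Prod.mk.injEq] at hs hs'
        obtain ⟨_, _, _, _, rfl⟩ := hs
        obtain ⟨_, _, _, _, rfl⟩ := hs'
        exact hij rfl
    · rintro ⟨l, m, n⟩
      simp only [Finset.mem_biUnion, Finset.mem_range, Finset.mem_image, mem_triangle,
        Prod.mk.injEq, Prod.exists]
      constructor
      · rintro ⟨n', h1, a, b, h2, rfl, rfl, rfl⟩
        omega
      · intro h
        exact ⟨n, by omega, l, m, by omega, rfl, rfl, rfl⟩
  have h2 : ∑ n ∈ Finset.range (k + 1), (triangle (k - n)).card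
      = ∑ n ∈ Finset.range (k + 1), (triangle n).card := by
    rw [← Finset.sum_range_reflect]
    refine Finset.sum_congr rfl fun n hn => ?_
    simp only [Finset.mem_range] at hn
    congr 2
    omega
  rw [h, h2]
  have h3 : ∀ k : ℕ, 6 * ∑ n ∈ Finset.range (k + 1), (triangle n).card
      = (k + 1) * (k + 2) * (k + 3) := by
    intro k
    induction k with
    | zero => have := two_mul_card_triangle 0; simp; omega
    | succ k ih =>
      have := two_mul_card_triangle (k + 1)
      rw [Finset.sum_range_succ, mul_add, ih]
      linear_combination 3 * this
  exact h3 k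

theorem finrank_jet (k : ℕ) : Module.finrank ℝ (Jet k) = 3 + Fintype.card (JetIdx k) := by
  rw [Module.finrank_prod, Module.finrank_prod, Module.finrank_prod, Module.finrank_fintype_fun_eq_card]
  simp

end Counting

/-! ### A rank estimate -/

section LinearAlgebra

/-- Modulo `E` the map `f` factors through the range of `g`, and there it kills the `m`-dimensional
span of the vectors `g (u i)`. So its rank modulo `E` is at most `dim B - m`. The source `F` may
have infinite dimension, as the space of local fields does. -/
theorem finrank_range_add_le {F A B : Type*} [AddCommGroup F] [Module ℝ F] [AddCommGroup A]
    [Module ℝ A] [FiniteDimensional ℝ A] [AddCommGroup B] [Module ℝ B] [FiniteDimensional ℝ B]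
    (f : F →ₗ[ℝ] A) (g : F →ₗ[ℝ] B) (E : Submodule ℝ A) {m : ℕ} (u : Fin m → F)
    (hg : ∀ v, g v = 0 → f v ∈ E) (hu : ∀ i, f (u i) ∈ E)
    (hi : LinearIndependent ℝ fun i => g (u i)) :
    Module.finrank ℝ (LinearMap.range f) + m ≤ Module.finrank ℝ B + Module.finrank ℝ E := by
  -- A linear section of `g` over its range realizes the factorization: `f v` and `f (s (g v))`
  -- differ by an element of `E`.
  obtain ⟨s, hs⟩ := g.rangeRestrict.exists_rightInverse_of_surjective g.range_rangeRestrict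
  have hs' : ∀ b : LinearMap.range g, g (s b) = b := fun b =>
    congrArg Subtype.val (LinearMap.congr_fun hs b)
  set h := f.comp s
  let w : Fin m → LinearMap.range g := fun i => ⟨g (u i), u i, rfl⟩
  have hw : LinearIndependent ℝ w :=
    LinearIndependent.of_comp (LinearMap.range g).subtype hi
  obtain ⟨W', hW'⟩ := Submodule.exists_isCompl (Submodule.span ℝ (Set.range w))
  have hdiff : ∀ v, ∀ b : LinearMap.range g, g v = b → f v - h b ∈ E := by
    intro v b hb
    have : f v - h b = f (v - s b) := by simp [h]
    rw [this]
    exact hg _ (by rw [map_sub, hs', hb, sub_self])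
  have hspan : ∀ b ∈ Submodule.span ℝ (Set.range w), h b ∈ E := by
    intro b hb
    have : Submodule.span ℝ (Set.range w) ≤ E.comap h := by
      rw [Submodule.span_le]
      rintro _ ⟨i, rfl⟩
      have := E.sub_mem (hu i) (hdiff (u i) (w i) rfl)
      simpa using this
    exact this hb
  have hle : LinearMap.range f ≤ W'.map h ⊔ E := by
    rintro _ ⟨v, rfl⟩
    have hv : (⟨g v, v, rfl⟩ : LinearMap.range g) ∈ Submodule.span ℝ (Set.range w) ⊔ W' := by
      rw [hW'.sup_eq_top]; trivial
    obtain ⟨b₁, h₁, b₂, h₂, h₁₂⟩ := Submodule.mem_sup.1 hv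
    refine Submodule.mem_sup.2 ⟨h b₂, ⟨b₂, h₂, rfl⟩, f v - h b₂, ?_, by abel⟩
    have e1 := hdiff v (b₁ + b₂) (congrArg Subtype.val h₁₂.symm)
    have e2 := E.add_mem e1 (hspan b₁ h₁)
    rw [map_add] at e2
    convert! e2 using 1
    abel
  have d1 : Module.finrank ℝ (Submodule.span ℝ (Set.range w)) = m := by
    simpa using finrank_span_eq_card hw
  have d2 := Submodule.finrank_add_eq_of_isCompl hW'
  have d3 : Module.finrank ℝ (LinearMap.range g) ≤ Module.finrank ℝ B := Submodule.finrank_le _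
  have d4 : Module.finrank ℝ (W'.map h) ≤ Module.finrank ℝ W' := Submodule.finrank_map_le h W'
  have d5 := Submodule.finrank_mono hle
  have d6 := Submodule.finrank_add_le_finrank_add_finrank (W'.map h) E
  omega

end LinearAlgebra

/-! ### Upper bound for the rank at every jet -/

section UpperBound

variable {k : ℕ}

/-- The jets in `J^k ℝ³` tangent to the fibre with vanishing derivatives of order less than
`k - 1` in `x, y`. -/
def highSubspace (k : ℕ) : Submodule ℝ (Jet k) where
  carrier := {v | v.1 = 0 ∧ ∀ ζ : JetIdx k, ζ.1.1 + ζ.1.2.1 + 1 < k → v.2 ζ = 0}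
  add_mem' := by
    rintro v w ⟨h₁, h₂⟩ ⟨h₃, h₄⟩
    exact ⟨by simp [h₁, h₃], fun ζ h => by simp [h₂ ζ h, h₄ ζ h]⟩
  zero_mem' := ⟨rfl, fun _ _ => rfl⟩
  smul_mem' := by
    rintro c v ⟨h₁, h₂⟩
    exact ⟨by simp [h₁], fun ζ h => by simp [h₂ ζ h]⟩

/-- The free coordinates have `l + m = k - 1` with `n = 0` or `n = 1`, or `l + m = k` with `n = 0`;
these are `k + k + (k + 1)` in number. -/
theorem finrank_highSubspace_le (hk : 1 ≤ k) : Module.finrank ℝ (highSubspace k) ≤ 3 * k + 1 := by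
  let A := Finset.HasAntidiagonal.antidiagonal (k - 1)
  let B := Finset.HasAntidiagonal.antidiagonal k
  let f : highSubspace k →ₗ[ℝ] ((A → ℝ) × (A → ℝ)) × (B → ℝ) :=
    { toFun := fun v => ((fun s => v.1.2 ⟨(s.1.1, s.1.2, 0), by
          have := Finset.HasAntidiagonal.mem_antidiagonal.1 s.2; simp; omega⟩,
        fun s => v.1.2 ⟨(s.1.1, s.1.2, 1), by
          have := Finset.HasAntidiagonal.mem_antidiagonal.1 s.2; simp; omega⟩),
        fun s => v.1.2 ⟨(s.1.1, s.1.2, 0), by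
          have := Finset.HasAntidiagonal.mem_antidiagonal.1 s.2; simp; omega⟩)
      map_add' := fun _ _ => rfl
      map_smul' := fun _ _ => rfl }
  have hf : Function.Injective f := by
    rw [injective_iff_map_eq_zero]
    rintro ⟨⟨v₁, v₂⟩, h₁, h₂⟩ hv
    have e1 := congrArg (fun t => t.1.1) hv
    have e2 := congrArg (fun t => t.1.2) hv
    have e3 := congrArg (fun t => t.2) hv
    refine Subtype.ext (Prod.ext h₁ (funext fun ⟨⟨l, m, n⟩, hζ⟩ => ?_))
    by_cases hlm : l + m + 1 < k
    · exact h₂ _ hlm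
    · simp only at hζ
      by_cases hlm' : l + m = k
      · obtain rfl : n = 0 := by omega
        exact congrFun e3 ⟨(l, m), by simp [B, hlm']⟩
      · have hA : (l, m) ∈ A := by simp [A]; omega
        obtain rfl | rfl : n = 0 ∨ n = 1 := by omega
        · exact congrFun e1 ⟨(l, m), hA⟩
        · exact congrFun e2 ⟨(l, m), hA⟩
  refine (LinearMap.finrank_le_finrank_of_injective hf).trans ?_
  rw [Module.finrank_prod, Module.finrank_prod, Module.finrank_fintype_fun_eq_card,
    Module.finrank_fintype_fun_eq_card]
  simp only [Fintype.card_coe, A, B, Finset.Nat.card_antidiagonal]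
  omega

theorem dirDeriv_eq_zero_of_invariant' {E : Type*} [NormedAddCommGroup E] [NormedSpace ℝ E]
    {f : E → ℝ} {x v : E} (h : ∀ t : ℝ, f (x + t • v) = f x) : dirDeriv v f x = 0 := by
  by_cases hf : DifferentiableAt ℝ f x
  · exact dirDeriv_eq_zero_of_invariant hf h
  · simp [dirDeriv, fderiv_zero_of_not_differentiableAt hf]

theorem pdp_comp_base (f : Plane → ℝ) : pdp (fun w => f w.base) = fun _ => 0 :=
  funext fun _ => dirDeriv_eq_zero_of_invariant' fun t => by simp [Pt.base]

theorem partialDeriv_comp_base_succ (f : Plane → ℝ) (z : Pt) (l m n : ℕ) :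
    partialDeriv (l, m, n + 1) (fun w => f w.base) z = 0 := by
  rw [← partialDeriv_pdp, pdp_comp_base]
  simpa using partialDeriv_const_mul (SmoothNear.const (0 : ℝ) z) 0 (l, m, n)

theorem vanish_comp_base {f : Plane → ℝ} {z : Pt} {e : ℕ}
    (h : ∀ l m, l + m < e → partialDeriv (l, m, 0) (fun w => f w.base) z = 0) (c : ℕ) :
    Vanish c z e (fun w => f w.base) := by
  intro l m n hl
  rcases n with _ | n
  · exact h l m (by omega)
  · exact partialDeriv_comp_base_succ f z l m n

theorem vanish_one_one {F : Pt → ℝ} {z : Pt} (h : F z = 0) : Vanish 1 z 1 F := by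
  intro l m n hl
  obtain ⟨rfl, rfl, rfl⟩ : l = 0 ∧ m = 0 ∧ n = 0 := by omega
  simpa [partialDeriv_zero] using h

/-- The partial derivatives of order at most `d` at the point `z` of the components of a plane
field. -/
def planeJet (z : Pt) (d : ℕ) :
    localFields z.base →ₗ[ℝ] (triangle d → ℝ) × (triangle d → ℝ) where
  toFun V := (fun s => partialDeriv (s.1.1, s.1.2, 0) (coefa V.1) z,
    fun s => partialDeriv (s.1.1, s.1.2, 0) (coefb V.1) z)
  map_add' V W := by
    refine Prod.ext (funext fun s => ?_) (funext fun s => ?_)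
    · exact partialDeriv_add (smoothNear_coefa V.2) (smoothNear_coefa W.2) _
    · exact partialDeriv_add (smoothNear_coefb V.2) (smoothNear_coefb W.2) _
  map_smul' c V := by
    refine Prod.ext (funext fun s => ?_) (funext fun s => ?_)
    · exact partialDeriv_const_mul (smoothNear_coefa V.2) c _
    · exact partialDeriv_const_mul (smoothNear_coefb V.2) c _

/-- Weight zero for `∂/∂p` measures vanishing in `x, y` alone. As `A` and `B₁` contain only first
derivatives of the field, every term of the generating function other than `B₀` vanishes to order `k
- 1` in this sense. Hence `B₀` is the only term about which something has to be assumed. -/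
theorem prolongVec_mem_highSubspace (θ : Jet k) {V : Plane → Plane}
    (hV : SmoothNear V θ.1.base) (ha : Vanish 0 θ.1 k (coefa V)) (hb : Vanish 0 θ.1 k (coefb V))
    (ha0 : coefa V θ.1 = 0) (hb0 : coefb V θ.1 = 0) (hA0 : coefA V θ.1 = 0)
    (hB : ∀ l m n, l + m + n ≤ k → l + m + 1 < k → partialDeriv (l, m, n) (coefB₀ V) θ.1 = 0) :
    prolongVec θ V ∈ highSubspace k := by
  rw [prolongVec_eq θ hV]
  refine ⟨by simp [ha0, hb0, hA0], ?_⟩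
  rintro ⟨⟨l, m, n⟩, hζ⟩ hlm
  simp only at hζ hlm ⊢
  have sa := smoothNear_coefa hV
  have sb := smoothNear_coefb hV
  have sφ := smoothNear_charFun hV
  have sA := smoothNear_coefA hV
  have sB := smoothNear_coefB₁ hV
  have sB₀ := smoothNear_coefB₀ hV
  have st := smoothNear_taylor θ θ.1
  have vφ : Vanish 0 θ.1 k (charFun V) :=
    hb.sub (ha.smooth_mul sa smoothNear_pp) sb (smoothNear_pp.mul sa)
  have vA : Vanish 0 θ.1 (k - 1) (coefA V) := vφ.Dx sφ
  have vB : Vanish 0 θ.1 (k - 1) (coefB₁ V) :=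
    (vφ.pdy sφ).sub ((ha.Dx sa).const_mul sa.Dx 2) sφ.pdy ((SmoothNear.const 2 _).mul sa.Dx)
  have v1 := vB.mul_smooth sB st
  have v2 := (ha.mul_smooth sa st.pdx).mono (Nat.sub_le k 1)
  have v3 := (hb.mul_smooth sb st.pdy).mono (Nat.sub_le k 1)
  have v4 := vA.mul_smooth sA st.pdp
  have v := (((v1.sub v2 (sB.mul st) (sa.mul st.pdx)).sub v3
      ((sB.mul st).sub (sa.mul st.pdx)) (sb.mul st.pdy)).sub v4
      (((sB.mul st).sub (sa.mul st.pdx)).sub (sb.mul st.pdy)) (sA.mul st.pdp)) l m n (by omega)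
  have e : prolongFun V θ.taylor θ.1 = fun w => coefB₀ V w +
      (coefB₁ V w * θ.taylor w - coefa V w * pdx θ.taylor w - coefb V w * pdy θ.taylor w
        - coefA V w * pdp θ.taylor w) := by
    funext w
    simp only [prolongFun, genFun, ha0, hb0, hA0]
    ring
  rw [e, partialDeriv_add sB₀ ((((sB.mul st).sub (sa.mul st.pdx)).sub (sb.mul st.pdy)).sub
    (sA.mul st.pdp)), v, hB l m n hζ hlm, add_zero]

/-- A field with zero `k`-jet vanishes to order `k + 1`, and the two derivatives in `B₀` leave order
`k - 1`. -/
theorem prolongVec_mem_highSubspace_of_planeJet (hk : 1 ≤ k) (θ : Jet k)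
    (V : localFields θ.1.base) (h : planeJet θ.1 k V = 0) : prolong θ V ∈ highSubspace k := by
  have ha : Vanish 0 θ.1 (k + 1) (coefa V.1) := vanish_comp_base (f := fun q => (V.1 q).1)
    (fun l m hl => congrFun (congrArg Prod.fst h) ⟨(l, m), mem_triangle.2 (by simp; omega)⟩) 0
  have hb : Vanish 0 θ.1 (k + 1) (coefb V.1) := vanish_comp_base (f := fun q => (V.1 q).2)
    (fun l m hl => congrFun (congrArg Prod.snd h) ⟨(l, m), mem_triangle.2 (by simp; omega)⟩) 0
  have sa := smoothNear_coefa V.2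
  have sb := smoothNear_coefb V.2
  have vφ : Vanish 0 θ.1 (k + 1) (charFun V.1) :=
    hb.sub (ha.smooth_mul sa smoothNear_pp) sb (smoothNear_pp.mul sa)
  have vA := vφ.Dx (smoothNear_charFun V.2)
  have vB := vA.Dx (smoothNear_charFun V.2).Dx
  exact prolongVec_mem_highSubspace θ V.2 (ha.mono (by omega)) (hb.mono (by omega))
    (ha 0 0 0 (by omega)) (hb 0 0 0 (by omega)) (vA 0 0 0 (by omega))
    fun l m n _ hl => vB l m n (by omega)

/-- The function `y - y₀ - p₀ (x - x₀)`. -/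
def adaptedY (z : Pt) (q : Plane) : ℝ := q.2 - z.2.1 - z.2.2 * (q.1 - z.1)

/-- The first of two fields of degree `d + 3` the flat prolongation of which has higher order
than expected. -/
def flatField₁ (z : Pt) (d : ℕ) : Plane → Plane := fun q =>
  (adaptedY z q ^ (d + 3), z.2.2 * adaptedY z q ^ (d + 3))

/-- The second of these fields. -/
def flatField₂ (z : Pt) (d : ℕ) : Plane → Plane := fun q =>
  ((d + 3) * (q.1 - z.1) * adaptedY z q ^ (d + 2),
    2 * adaptedY z q ^ (d + 3) + z.2.2 * ((d + 3) * (q.1 - z.1) * adaptedY z q ^ (d + 2)))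

theorem contDiff_flatField₁ (z : Pt) (d : ℕ) : ContDiff ℝ ∞ (flatField₁ z d) := by
  unfold flatField₁ adaptedY; fun_prop

theorem contDiff_flatField₂ (z : Pt) (d : ℕ) : ContDiff ℝ ∞ (flatField₂ z d) := by
  unfold flatField₂ adaptedY; fun_prop

theorem Dx_apply_of_hasDerivAt {F : Pt → ℝ} {w : Pt} {d : ℝ} (hF : DifferentiableAt ℝ F w)
    (h : HasDerivAt (fun t : ℝ => F (w.1 + t, w.2.1 + t * w.2.2, w.2.2)) d 0) : Dx F w = d := by
  refine dirDeriv_apply_of_hasDerivAt (v := ((1, w.2.2, 0) : Pt)) hF ?_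
  have : ∀ t : ℝ, w + t • ((1, w.2.2, 0) : Pt) = (w.1 + t, w.2.1 + t * w.2.2, w.2.2) := by
    intro t; ext <;> simp
  simpa only [this] using h

/-- This is `D_x Y = p - p₀` for the adapted coordinate `Y`, in integrated form: along the flow of
`D_x` it is affine in `t`. Every application of `D_x` thus trades a factor `Y` for a factor `p -
p₀`. -/
theorem adaptedY_flow (z w : Pt) (t : ℝ) :
    adaptedY z (Pt.base (w.1 + t, w.2.1 + t * w.2.2, w.2.2)) =
      adaptedY z w.base + t * (w.2.2 - z.2.2) := by
  simp only [adaptedY, Pt.base]; ring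

theorem hasDerivAt_affine_pow (a b : ℝ) (n : ℕ) :
    HasDerivAt (fun t : ℝ => (a + t * b) ^ (n + 1)) ((n + 1) * a ^ n * b) 0 := by
  have := (((hasDerivAt_id (0 : ℝ)).mul_const b).const_add a).fun_pow (n + 1)
  simpa using this

theorem coefA_flatField₁ (z : Pt) (d : ℕ) : coefA (flatField₁ z d) = fun w =>
    -((d + 3) * (w.2.2 - z.2.2) ^ 2 * adaptedY z w.base ^ (d + 2)) := by
  funext w
  have hc : ContDiff ℝ ∞ (charFun (flatField₁ z d)) := by
    unfold charFun coefa coefb flatField₁ adaptedY Pt.base; fun_prop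
  refine Dx_apply_of_hasDerivAt (hc.contDiffAt.differentiableAt (by simp)) ?_
  have h := (hasDerivAt_affine_pow (adaptedY z w.base) (w.2.2 - z.2.2) (d + 2)).const_mul
    (-(w.2.2 - z.2.2))
  refine (h.congr_deriv (by push_cast; ring)).congr_of_eventuallyEq
    (Filter.Eventually.of_forall fun t => ?_)
  simp only [charFun, coefa, coefb, flatField₁, adaptedY_flow]
  ring

theorem coefB₀_flatField₁ (z : Pt) (d : ℕ) : coefB₀ (flatField₁ z d) = fun w =>
    -((d + 3) * (d + 2)) * ((w.2.2 - z.2.2) ^ 3 * adaptedY z w.base ^ (d + 1)) := by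
  funext w
  change Dx (coefA (flatField₁ z d)) w = _
  rw [coefA_flatField₁]
  refine Dx_apply_of_hasDerivAt (ContDiffAt.differentiableAt (n := ∞) (ContDiff.contDiffAt (by
    unfold adaptedY Pt.base; fun_prop)) (by simp)) ?_
  have h := (hasDerivAt_affine_pow (adaptedY z w.base) (w.2.2 - z.2.2) (d + 1)).const_mul
    (-((d + 3) * (w.2.2 - z.2.2) ^ 2))
  refine (h.congr_deriv (by push_cast; ring)).congr_of_eventuallyEq
    (Filter.Eventually.of_forall fun t => ?_)
  simp only [adaptedY_flow]
  ring

theorem coefA_flatField₂ (z : Pt) (d : ℕ) : coefA (flatField₂ z d) = fun w =>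
    (d + 3) * (w.2.2 - z.2.2) * adaptedY z w.base ^ (d + 2)
      - (d + 3) * (d + 2) * (w.2.2 - z.2.2) ^ 2 * ((w.1 - z.1) * adaptedY z w.base ^ (d + 1)) := by
  funext w
  have hc : ContDiff ℝ ∞ (charFun (flatField₂ z d)) := by
    unfold charFun coefa coefb flatField₂ adaptedY Pt.base; fun_prop
  refine Dx_apply_of_hasDerivAt (hc.contDiffAt.differentiableAt (by simp)) ?_
  have h1 := (hasDerivAt_affine_pow (adaptedY z w.base) (w.2.2 - z.2.2) (d + 2)).const_mul 2
  have h2 := (((hasDerivAt_id (0 : ℝ)).const_add (w.1 - z.1)).mul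
    (hasDerivAt_affine_pow (adaptedY z w.base) (w.2.2 - z.2.2) (d + 1))).const_mul
    (-((d + 3) * (w.2.2 - z.2.2)))
  refine ((h1.add h2).congr_deriv (by push_cast; simp; ring)).congr_of_eventuallyEq
    (Filter.Eventually.of_forall fun t => ?_)
  simp only [charFun, coefa, coefb, flatField₂, adaptedY_flow, Pi.add_apply, Pi.mul_apply, id]
  simp only [Pt.base]
  ring

/-- The coefficient `2` in the field is chosen so that the terms with `(p - p₀)² Y^(d+1)` cancel,
and the rest is divisible by `(p - p₀)³`. -/
theorem coefB₀_flatField₂ (z : Pt) (d : ℕ) : coefB₀ (flatField₂ z d) = fun w =>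
    -((d + 3) * (d + 2) * (d + 1)) *
      ((w.2.2 - z.2.2) ^ 3 * ((w.1 - z.1) * adaptedY z w.base ^ d)) := by
  funext w
  change Dx (coefA (flatField₂ z d)) w = _
  rw [coefA_flatField₂]
  refine Dx_apply_of_hasDerivAt (ContDiffAt.differentiableAt (n := ∞) (ContDiff.contDiffAt (by
    unfold adaptedY Pt.base; fun_prop)) (by simp)) ?_
  have h1 := (hasDerivAt_affine_pow (adaptedY z w.base) (w.2.2 - z.2.2) (d + 1)).const_mul
    ((d + 3) * (w.2.2 - z.2.2))
  have h2 := (((hasDerivAt_id (0 : ℝ)).const_add (w.1 - z.1)).mul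
    (hasDerivAt_affine_pow (adaptedY z w.base) (w.2.2 - z.2.2) d)).const_mul
    (-((d + 3) * (d + 2) * (w.2.2 - z.2.2) ^ 2))
  refine ((h1.add h2).congr_deriv (by push_cast; simp; ring)).congr_of_eventuallyEq
    (Filter.Eventually.of_forall fun t => ?_)
  simp only [adaptedY_flow, Pi.add_apply, Pi.mul_apply, id]
  ring

theorem vanish_adaptedY (z : Pt) (c : ℕ) : Vanish c z 1 fun w => adaptedY z w.base :=
  vanish_comp_base (fun l m h => by
    obtain ⟨rfl, rfl⟩ : l = 0 ∧ m = 0 := by omega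
    simp [partialDeriv_zero, adaptedY, Pt.base]) c

theorem vanish_sub_fst (z : Pt) (c : ℕ) : Vanish c z 1 fun w => w.1 - z.1 :=
  vanish_comp_base (f := fun q => q.1 - z.1) (fun l m h => by
    obtain ⟨rfl, rfl⟩ : l = 0 ∧ m = 0 := by omega
    simp [partialDeriv_zero, Pt.base]) c

theorem smoothNear_adaptedY (z w : Pt) : SmoothNear (fun w : Pt => adaptedY z w.base) w :=
  ContDiff.smoothNear (by unfold adaptedY Pt.base; fun_prop) w

theorem smoothNear_sub_fst (z w : Pt) : SmoothNear (fun w : Pt => w.1 - z.1) w :=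
  ContDiff.smoothNear (by fun_prop) w

theorem smoothNear_sub_p (z w : Pt) : SmoothNear (fun w : Pt => w.2.2 - z.2.2) w :=
  ContDiff.smoothNear (by fun_prop) w

theorem pdy_iterate_adaptedY (z : Pt) (n : ℕ) :
    partialDeriv (0, n, 0) (fun w => adaptedY z w.base ^ n) z = n.factorial := by
  induction n with
  | zero => simp [partialDeriv_zero]
  | succ n ih =>
    rw [← partialDeriv_pdy ((smoothNear_adaptedY z z).pow _)]
    have : pdy (fun w => adaptedY z w.base ^ (n + 1))
        = fun w => ((n : ℝ) + 1) * adaptedY z w.base ^ n := by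
      funext w
      refine dirDeriv_apply_of_hasDerivAt ((smoothNear_adaptedY z w).pow _).differentiableAt ?_
      have h := hasDerivAt_affine_pow (adaptedY z w.base) 1 n
      refine (h.congr_deriv (by ring)).congr_of_eventuallyEq
        (Filter.Eventually.of_forall fun t => ?_)
      simp only [adaptedY, Pt.base]
      congr 1
      simp
      ring
    rw [this, partialDeriv_const_mul ((smoothNear_adaptedY z z).pow _), ih, Nat.factorial_succ]
    push_cast
    ring

/-- In `x, y` alone `B₀` vanishes only to order `d + 1`, which is too little. Counted with `p`, the
factor `(p - p₀)³` raises the order to `d + 4`, beyond every derivative in a jet of order `d + 3`.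
-/
theorem prolongVec_flatField₁ {d : ℕ} (θ : Jet (d + 3)) :
    prolongVec θ (flatField₁ θ.1 d) ∈ highSubspace (d + 3) := by
  have sY := smoothNear_adaptedY θ.1 θ.1
  have vY := (vanish_adaptedY θ.1 0).pow sY (d + 3)
  have y0 : adaptedY θ.1 θ.1.base = 0 := by simp [adaptedY, Pt.base]
  refine prolongVec_mem_highSubspace θ (ContDiff.smoothNear (contDiff_flatField₁ _ _) _) vY
    (vY.smooth_mul (sY.pow _) (SmoothNear.const θ.1.2.2 θ.1)) ?_ ?_ ?_ ?_
  · simp [coefa, flatField₁, y0]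
  · simp [coefb, flatField₁, y0]
  · simp [coefA_flatField₁]
  · intro l m n hn _
    rw [coefB₀_flatField₁]
    have sq := (smoothNear_sub_p θ.1 θ.1)
    have := (((vanish_one_one (F := fun w : Pt => w.2.2 - θ.1.2.2) (by simp)).pow sq 3).mul
      ((vanish_adaptedY θ.1 1).pow sY (d + 1)) (sq.pow 3) (sY.pow _)).const_mul
        ((sq.pow 3).mul (sY.pow _)) (-(((d : ℝ) + 3) * (d + 2)))
    exact this l m n (by omega)

/-- Again `B₀` has total order `d + 4`, now from `(p - p₀)³ (x - x₀) Y^d`. -/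
theorem prolongVec_flatField₂ {d : ℕ} (θ : Jet (d + 3)) :
    prolongVec θ (flatField₂ θ.1 d) ∈ highSubspace (d + 3) := by
  have sY := smoothNear_adaptedY θ.1 θ.1
  have sX := smoothNear_sub_fst θ.1 θ.1
  have vY := (vanish_adaptedY θ.1 0).pow sY
  have y0 : adaptedY θ.1 θ.1.base = 0 := by simp [adaptedY, Pt.base]
  have sa : SmoothNear (coefa (flatField₂ θ.1 d)) θ.1 :=
    smoothNear_coefa (ContDiff.smoothNear (contDiff_flatField₂ _ _) _)
  have va : Vanish 0 θ.1 (d + 3) (coefa (flatField₂ θ.1 d)) :=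
    ((((vanish_sub_fst θ.1 0).smooth_mul sX (SmoothNear.const ((d : ℝ) + 3) θ.1)).mul (vY (d + 2))
      ((SmoothNear.const _ _).mul sX) (sY.pow _))).mono (by omega)
  refine prolongVec_mem_highSubspace θ (ContDiff.smoothNear (contDiff_flatField₂ _ _) _) va
    (((vY (d + 3)).const_mul (sY.pow _) 2).add (va.const_mul sa _)
      ((SmoothNear.const _ _).mul (sY.pow _)) ((SmoothNear.const _ _).mul sa)) ?_ ?_ ?_ ?_
  · simp [coefa, flatField₂, Pt.base]
  · simp [coefb, flatField₂, Pt.base, adaptedY]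
  · simp [coefA_flatField₂]
  · intro l m n hn _
    rw [coefB₀_flatField₂]
    have sq := (smoothNear_sub_p θ.1 θ.1)
    have s2 := sX.mul (sY.pow d)
    have := (((vanish_one_one (F := fun w : Pt => w.2.2 - θ.1.2.2) (by simp)).pow sq 3).mul
      ((vanish_sub_fst θ.1 1).mul ((vanish_adaptedY θ.1 1).pow sY d) sX (sY.pow d))
        (sq.pow 3) s2).const_mul
        ((sq.pow 3).mul s2) (-(((d : ℝ) + 3) * (d + 2) * (d + 1)))
    exact this l m n (by omega)

/-- The rank estimate gives `(k + 1)(k + 2) + (3k + 1) - 2`, the last term being due to the two flat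
fields. -/
theorem finrank_orbitTangent_le (hk : 3 ≤ k) (θ : Jet k) :
    Module.finrank ℝ (orbitTangent θ) ≤ k ^ 2 + 6 * k + 1 := by
  obtain ⟨d, rfl⟩ := Nat.exists_eq_add_of_le' hk
  let u : Fin 2 → localFields θ.1.base :=
    ![⟨flatField₁ θ.1 d, ContDiff.smoothNear (contDiff_flatField₁ _ _) _⟩,
      ⟨flatField₂ θ.1 d, ContDiff.smoothNear (contDiff_flatField₂ _ _) _⟩]
  have h := finrank_range_add_le (prolong θ) (planeJet θ.1 (d + 3)) (highSubspace (d + 3)) u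
    (prolongVec_mem_highSubspace_of_planeJet (by omega) θ)
    (by
      intro i
      fin_cases i
      · exact prolongVec_flatField₁ θ
      · exact prolongVec_flatField₂ θ)
    (by
      rw [Fintype.linearIndependent_iff]
      intro c hst
      rw [Fin.sum_univ_two] at hst
      set s := c 0
      set t := c 1
      suffices s = 0 ∧ t = 0 by
        intro i
        fin_cases i
        exacts [this.1, this.2]
      have hf : ((d + 3).factorial : ℝ) ≠ 0 := by positivity
      have sY := (smoothNear_adaptedY θ.1 θ.1).pow (d + 3)
      have key := pdy_iterate_adaptedY θ.1 (d + 3)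
      -- The pure `y`-derivative of top order suffices for independence: the combination of
      -- components `b - p₀ a` vanishes on the first field and is `2 (d + 3)!` on the second.
      let i : triangle (d + 3) := ⟨(0, d + 3), mem_triangle.2 (by simp)⟩
      have ea := congrFun (congrArg Prod.fst hst) i
      have eb := congrFun (congrArg Prod.snd hst) i
      set T := partialDeriv (0, d + 3, 0) (coefa (flatField₂ θ.1 d)) θ.1 with hT
      have sa : SmoothNear (coefa (flatField₂ θ.1 d)) θ.1 :=
        smoothNear_coefa (ContDiff.smoothNear (contDiff_flatField₂ _ _) _)
      have b1 : partialDeriv (0, d + 3, 0) (coefb (flatField₁ θ.1 d)) θ.1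
          = θ.1.2.2 * (d + 3).factorial := by
        rw [← key, ← partialDeriv_const_mul sY]; rfl
      have b2 : partialDeriv (0, d + 3, 0) (coefb (flatField₂ θ.1 d)) θ.1
          = 2 * (d + 3).factorial + θ.1.2.2 * T := by
        rw [← key, hT, ← partialDeriv_const_mul sY, ← partialDeriv_const_mul sa,
          ← partialDeriv_add ((SmoothNear.const _ _).mul sY) ((SmoothNear.const _ _).mul sa)]
        rfl
      change s * partialDeriv (0, d + 3, 0) (coefa (flatField₁ θ.1 d)) θ.1 + t * T = 0 at ea
      change s * partialDeriv (0, d + 3, 0) (coefb (flatField₁ θ.1 d)) θ.1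
        + t * partialDeriv (0, d + 3, 0) (coefb (flatField₂ θ.1 d)) θ.1 = 0 at eb
      have a1 : partialDeriv (0, d + 3, 0) (coefa (flatField₁ θ.1 d)) θ.1
          = (d + 3).factorial := key
      rw [a1] at ea
      rw [b1, b2] at eb
      have ht : t = 0 := by
        have : t * (2 * ((d + 3).factorial : ℝ)) = 0 := by linear_combination eb - θ.1.2.2 * ea
        rcases mul_eq_zero.1 this with h | h
        · exact h
        · exact absurd h (by positivity)
      refine ⟨?_, ht⟩
      rw [ht, zero_mul, add_zero] at ea
      exact (mul_eq_zero.1 ea).resolve_right hf)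
  have h1 := finrank_highSubspace_le (k := d + 3) (by omega)
  have h2 : Module.finrank ℝ ((triangle (d + 3) → ℝ) × (triangle (d + 3) → ℝ))
      = (d + 3 + 1) * (d + 3 + 2) := by
    rw [Module.finrank_prod, Module.finrank_fintype_fun_eq_card, Fintype.card_coe,
      ← two_mul_card_triangle]
    ring
  rw [h2] at h
  change Module.finrank ℝ (LinearMap.range (prolong θ)) ≤ _
  nlinarith

end UpperBound

/-! ### The coefficients of the prolongation in terms of `a` and `b` -/

section Expansion

variable {z : Pt} {V : Plane → Plane}

theorem dirDeriv_sub_apply {E : Type*} [NormedAddCommGroup E] [NormedSpace ℝ E]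
    {f g : E → ℝ} {x : E} (hf : DifferentiableAt ℝ f x)
    (hg : DifferentiableAt ℝ g x) (v : E) :
    dirDeriv v (fun y => f y - g y) x = dirDeriv v f x - dirDeriv v g x := by
  simp [dirDeriv, fderiv_fun_sub hf hg]

theorem pdx_p (w : Pt) : pdx (fun w => w.2.2) w = 0 :=
  dirDeriv_eq_zero_of_invariant' fun t => by simp

theorem pdy_p (w : Pt) : pdy (fun w => w.2.2) w = 0 :=
  dirDeriv_eq_zero_of_invariant' fun t => by simp

theorem pdx_sub_p_mul {F G : Pt → ℝ} {w : Pt} (hF : SmoothNear F w) (hG : SmoothNear G w) :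
    pdx (fun w => F w - w.2.2 * G w) w = pdx F w - w.2.2 * pdx G w := by
  have hp := smoothNear_pp (z := w)
  have h := dirDeriv_sub_apply hF.differentiableAt (hp.mul hG).differentiableAt (1, 0, 0)
  have h' := dirDeriv_mul_apply hp.differentiableAt hG.differentiableAt (1, 0, 0)
  rw [h'] at h
  have h0 := pdx_p w
  simp only [pdx_eq] at h0 ⊢
  rw [h, h0]; ring

theorem pdy_sub_p_mul {F G : Pt → ℝ} {w : Pt} (hF : SmoothNear F w) (hG : SmoothNear G w) :
    pdy (fun w => F w - w.2.2 * G w) w = pdy F w - w.2.2 * pdy G w := by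
  have hp := smoothNear_pp (z := w)
  have h := dirDeriv_sub_apply hF.differentiableAt (hp.mul hG).differentiableAt (0, 1, 0)
  have h' := dirDeriv_mul_apply hp.differentiableAt hG.differentiableAt (0, 1, 0)
  rw [h'] at h
  have h0 := pdy_p w
  simp only [pdy_eq] at h0 ⊢
  rw [h, h0]; ring

/-- The operator `D_x` annihilates `p`, which therefore behaves as a constant. -/
theorem Dx_sub_p_mul {F G : Pt → ℝ} {w : Pt} (hF : SmoothNear F w) (hG : SmoothNear G w) :
    Dx (fun w => F w - w.2.2 * G w) w = Dx F w - w.2.2 * Dx G w := by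
  rw [Dx_eq, pdx_sub_p_mul hF hG, pdy_sub_p_mul hF hG, Dx_eq, Dx_eq]; ring

theorem Dx_congr {F G : Pt → ℝ} (h : F =ᶠ[𝓝 z] G) : Dx F =ᶠ[𝓝 z] Dx G := by
  filter_upwards [h.eventuallyEq_nhds] with w hw
  simp only [Dx, along, hw.fderiv_eq]

theorem pdy_charFun (hV : SmoothNear V z.base) :
    pdy (charFun V) z = pdy (coefb V) z - z.2.2 * pdy (coefa V) z :=
  pdy_sub_p_mul (smoothNear_coefb hV) (smoothNear_coefa hV)

theorem coefA_eq_Dx (hV : SmoothNear V z.base) :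
    coefA V z = Dx (coefb V) z - z.2.2 * Dx (coefa V) z :=
  Dx_sub_p_mul (smoothNear_coefb hV) (smoothNear_coefa hV)

theorem eventually_base {P : Plane → Prop} (h : ∀ᶠ q in 𝓝 z.base, P q) :
    ∀ᶠ w in 𝓝 z, P w.base := by
  have hb : Continuous Pt.base := by unfold Pt.base; fun_prop
  exact hb.continuousAt.eventually h

theorem coefB₀_eq_Dx (hV : SmoothNear V z.base) :
    coefB₀ V z = Dx (Dx (coefb V)) z - z.2.2 * Dx (Dx (coefa V)) z := by
  have h : coefA V =ᶠ[𝓝 z] fun w => Dx (coefb V) w - w.2.2 * Dx (coefa V) w := by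
    filter_upwards [eventually_base hV.eventually] with w hw using coefA_eq_Dx hw
  exact ((Dx_congr h).self_of_nhds).trans
    (Dx_sub_p_mul (smoothNear_coefb hV).Dx (smoothNear_coefa hV).Dx)

theorem Dx_Dx {F : Pt → ℝ} (hF : SmoothNear F z) : Dx (Dx F) z =
    pdx (pdx F) z + 2 * z.2.2 * pdx (pdy F) z + z.2.2 ^ 2 * pdy (pdy F) z := by
  have h : Dx F = fun w => pdx F w - w.2.2 * (fun w => -pdy F w) w := by
    funext w; rw [Dx_eq]; ring
  have hn : SmoothNear (fun w => -pdy F w) z := by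
    have := (SmoothNear.const (-1 : ℝ) z).mul hF.pdy
    simpa using this
  have e : ∀ v : Pt, dirDeriv v (fun w => -pdy F w) z = -dirDeriv v (pdy F) z := by
    intro v; simp [dirDeriv]
  have c : pdy (pdx F) z = pdx (pdy F) z := (dirDeriv_comm hF _ _).self_of_nhds
  rw [h, Dx_sub_p_mul hF.pdx hn, Dx_eq, Dx_eq, c]
  simp only [pdx_eq, pdy_eq] at e ⊢
  rw [e, e]
  ring

end Expansion

/-! ### The prolongation at the model equation `u = p⁴ + x² p²` -/

section ModelJet

variable {V : Plane → Plane}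

/-- The function `p⁴ + x² p²`. -/
def modelFun : Pt → ℝ := fun w => w.2.2 ^ 4 + w.1 ^ 2 * w.2.2 ^ 2

theorem contDiff_modelFun : ContDiff ℝ ∞ modelFun := by unfold modelFun; fun_prop

theorem smoothNear_modelFun (z : Pt) : SmoothNear modelFun z := ContDiff.smoothNear contDiff_modelFun z

theorem pdx_modelFun (w : Pt) : pdx modelFun w = 2 * w.1 * w.2.2 ^ 2 := by
  refine dirDeriv_apply_of_hasDerivAt (smoothNear_modelFun w).differentiableAt ?_
  have h := (((hasDerivAt_affine_pow w.1 1 1).mul_const (w.2.2 ^ 2))).const_add (w.2.2 ^ 4)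
  refine (h.congr_deriv (by push_cast; ring)).congr_of_eventuallyEq
    (Filter.Eventually.of_forall fun t => ?_)
  simp [modelFun]

theorem pdy_modelFun (w : Pt) : pdy modelFun w = 0 :=
  dirDeriv_eq_zero_of_invariant' fun t => by simp [modelFun]

theorem pdp_modelFun (w : Pt) : pdp modelFun w = 4 * w.2.2 ^ 3 + 2 * w.1 ^ 2 * w.2.2 := by
  refine dirDeriv_apply_of_hasDerivAt (smoothNear_modelFun w).differentiableAt ?_
  have h := (hasDerivAt_affine_pow w.2.2 1 3).add
    ((hasDerivAt_affine_pow w.2.2 1 1).const_mul (w.1 ^ 2))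
  refine (h.congr_deriv (by push_cast; ring)).congr_of_eventuallyEq
    (Filter.Eventually.of_forall fun t => ?_)
  simp [modelFun]

/-- One step of reading off the coefficients of a polynomial in `p` written in Horner form. The
factors `n + 1` accumulate to the factorials in the expansion of the generating function. -/
theorem partialDeriv_horner {c F : Pt → ℝ} (hc : SmoothNear c 0) (hF : SmoothNear F 0)
    (h : ∀ l m n, partialDeriv (l, m, n + 1) c 0 = 0) :
    (∀ l m, partialDeriv (l, m, 0) (fun w => c w + w.2.2 * F w) 0 = partialDeriv (l, m, 0) c 0) ∧
    ∀ l m n, partialDeriv (l, m, n + 1) (fun w => c w + w.2.2 * F w) 0 =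
      (n + 1) * partialDeriv (l, m, n) F 0 := by
  constructor
  · intro l m
    rw [partialDeriv_add hc (smoothNear_pp.mul hF), partialDeriv_p_mul hF]
    simp
  · intro l m n
    rw [partialDeriv_add hc (smoothNear_pp.mul hF), partialDeriv_p_mul hF, h]
    simp

theorem partialDeriv_xx_mul {F : Pt → ℝ} (hF : SmoothNear F 0) (l m n : ℕ) :
    partialDeriv (l, m, n) (fun w => w.1 * (w.1 * F w)) 0 =
      l * (l - 1 : ℕ) * partialDeriv (l - 2, m, n) F 0 := by
  rw [partialDeriv_x_mul (smoothNear_px.mul hF), partialDeriv_x_mul hF l,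
    partialDeriv_x_mul hF (l - 1), Nat.sub_sub]
  simp only [Prod.fst_zero, zero_mul, zero_add, mul_assoc]

/-- The derivatives at the origin of the prolongation of `V` evaluated on `p⁴ + x² p²`. -/
theorem partialDeriv_genFun_modelFun (hV : SmoothNear V ((0 : Pt).base)) (A B : ℕ → ℕ → ℝ)
    (hA : ∀ l m, A l m = partialDeriv (l, m, 0) (coefa V) 0)
    (hB : ∀ l m, B l m = partialDeriv (l, m, 0) (coefb V) 0) (l m : ℕ) :
    partialDeriv (l, m, 0) (genFun V modelFun) 0 = B (l + 2) m ∧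
    partialDeriv (l, m, 1) (genFun V modelFun) 0 =
      2 * B (l + 1) (m + 1) - A (l + 2) m - 2 * (l * (l - 1 : ℕ) * B (l - 2 + 1) m) ∧
    partialDeriv (l, m, 2) (genFun V modelFun) 0 =
      2 * (B l (m + 2) - 2 * A (l + 1) (m + 1) - l * (l - 1 : ℕ) * B (l - 2) (m + 1)
        - 2 * (l * A (l - 1) m)) ∧
    partialDeriv (l, m, 3) (genFun V modelFun) 0 =
      6 * (-A l (m + 2) - 4 * B (l + 1) m - l * (l - 1 : ℕ) * A (l - 2) (m + 1)) ∧
    partialDeriv (l, m, 4) (genFun V modelFun) 0 = 24 * (2 * A (l + 1) m - 3 * B l (m + 1)) ∧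
    partialDeriv (l, m, 5) (genFun V modelFun) 0 = 120 * A l (m + 1) := by
  set a := coefa V with ha
  set b := coefb V with hb
  have sa : SmoothNear a 0 := smoothNear_coefa hV
  have sb : SmoothNear b 0 := smoothNear_coefb hV
  have a0 : ∀ l m n, partialDeriv (l, m, n + 1) a 0 = 0 := fun l m n =>
    partialDeriv_comp_base_succ (fun q => (V q).1) 0 l m n
  have b0 : ∀ l m n, partialDeriv (l, m, n + 1) b 0 = 0 := fun l m n =>
    partialDeriv_comp_base_succ (fun q => (V q).2) 0 l m n
  have sx := smoothNear_px (z := 0)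
  have two := SmoothNear.const (2 : ℝ) (0 : Pt)
  -- The functions `c0, …, c5` are the coefficients of `1, p, …, p⁵` in the generating function on
  -- the model. There are no higher powers: `B₀` is cubic in `p`, while `B₁` is linear and `A`
  -- quadratic, and these multiply polynomials of degree four and three.
  set c0 : Pt → ℝ := pdx (pdx b) with hc0
  set c1 : Pt → ℝ := fun w => 2 * pdx (pdy b) w - pdx (pdx a) w - 2 * (w.1 * (w.1 * pdx b w)) with hc1
  set c2 : Pt → ℝ := fun w => pdy (pdy b) w - 2 * pdx (pdy a) w - w.1 * (w.1 * pdy b w)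
    - 2 * (w.1 * a w) with hc2
  set c3 : Pt → ℝ := fun w => -1 * pdy (pdy a) w - 4 * pdx b w - w.1 * (w.1 * pdy a w) with hc3
  set c4 : Pt → ℝ := fun w => 2 * pdx a w - 3 * pdy b w with hc4
  set c5 : Pt → ℝ := pdy a with hc5
  have s1a := two.mul sb.pdy.pdx
  have s1b := sx.mul (sx.mul sb.pdx)
  have s1 : SmoothNear c1 0 := (s1a.sub sa.pdx.pdx).sub (two.mul s1b)
  have s2a := two.mul sa.pdy.pdx
  have s2b := sx.mul (sx.mul sb.pdy)
  have s2c := two.mul (sx.mul sa)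
  have s2 : SmoothNear c2 0 := ((sb.pdy.pdy.sub s2a).sub s2b).sub s2c
  have s3a := (SmoothNear.const (-1 : ℝ) (0 : Pt)).mul sa.pdy.pdy
  have s3b := (SmoothNear.const (4 : ℝ) (0 : Pt)).mul sb.pdx
  have s3c := sx.mul (sx.mul sa.pdy)
  have s3 : SmoothNear c3 0 := (s3a.sub s3b).sub s3c
  have s4a := two.mul sa.pdx
  have s4b := (SmoothNear.const (3 : ℝ) (0 : Pt)).mul sb.pdy
  have s4 : SmoothNear c4 0 := s4a.sub s4b
  have d0 : ∀ l m n, partialDeriv (l, m, n) c0 0 = partialDeriv (l + 2, m, n) b 0 := by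
    intro l m n
    rw [hc0, partialDeriv_pdx sb.pdx, partialDeriv_pdx sb]
  have d1 : ∀ l m n, partialDeriv (l, m, n) c1 0 = 2 * partialDeriv (l + 1, m + 1, n) b 0
      - partialDeriv (l + 2, m, n) a 0
      - 2 * (l * (l - 1 : ℕ) * partialDeriv (l - 2 + 1, m, n) b 0) := by
    intro l m n
    rw [hc1, partialDeriv_sub (s1a.sub sa.pdx.pdx) (two.mul s1b), partialDeriv_sub s1a sa.pdx.pdx,
      partialDeriv_const_mul sb.pdy.pdx, partialDeriv_const_mul s1b, partialDeriv_xx_mul sb.pdx,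
      partialDeriv_pdx sb.pdy, partialDeriv_pdy sb, partialDeriv_pdx sa.pdx, partialDeriv_pdx sa,
      partialDeriv_pdx sb]
  have d2 : ∀ l m n, partialDeriv (l, m, n) c2 0 = partialDeriv (l, m + 2, n) b 0
      - 2 * partialDeriv (l + 1, m + 1, n) a 0
      - l * (l - 1 : ℕ) * partialDeriv (l - 2, m + 1, n) b 0
      - 2 * (l * partialDeriv (l - 1, m, n) a 0) := by
    intro l m n
    rw [hc2, partialDeriv_sub ((sb.pdy.pdy.sub s2a).sub s2b) s2c,
      partialDeriv_sub (sb.pdy.pdy.sub s2a) s2b, partialDeriv_sub sb.pdy.pdy s2a,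
      partialDeriv_const_mul sa.pdy.pdx, partialDeriv_const_mul (sx.mul sa),
      partialDeriv_xx_mul sb.pdy, partialDeriv_x_mul sa,
      partialDeriv_pdx sa.pdy, partialDeriv_pdy sa, partialDeriv_pdy sb.pdy, partialDeriv_pdy sb,
      partialDeriv_pdy sb]
    simp
  have d3 : ∀ l m n, partialDeriv (l, m, n) c3 0 = -partialDeriv (l, m + 2, n) a 0
      - 4 * partialDeriv (l + 1, m, n) b 0
      - l * (l - 1 : ℕ) * partialDeriv (l - 2, m + 1, n) a 0 := by
    intro l m n
    rw [hc3, partialDeriv_sub (s3a.sub s3b) s3c, partialDeriv_sub s3a s3b,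
      partialDeriv_const_mul sa.pdy.pdy, partialDeriv_const_mul sb.pdx,
      partialDeriv_xx_mul sa.pdy, partialDeriv_pdy sa.pdy, partialDeriv_pdy sa,
      partialDeriv_pdx sb, partialDeriv_pdy sa]
    ring
  have d4 : ∀ l m n, partialDeriv (l, m, n) c4 0 = 2 * partialDeriv (l + 1, m, n) a 0
      - 3 * partialDeriv (l, m + 1, n) b 0 := by
    intro l m n
    rw [hc4, partialDeriv_sub s4a s4b, partialDeriv_const_mul sa.pdx, partialDeriv_const_mul sb.pdy,
      partialDeriv_pdx sa, partialDeriv_pdy sb]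
  have d5 : ∀ l m n, partialDeriv (l, m, n) c5 0 = partialDeriv (l, m + 1, n) a 0 := by
    intro l m n
    rw [hc5, partialDeriv_pdy sa]
  have sp := smoothNear_pp (z := 0)
  set F4 : Pt → ℝ := fun w => c4 w + w.2.2 * c5 w
  set F3 : Pt → ℝ := fun w => c3 w + w.2.2 * F4 w
  set F2 : Pt → ℝ := fun w => c2 w + w.2.2 * F3 w
  set F1 : Pt → ℝ := fun w => c1 w + w.2.2 * F2 w
  have t4 : SmoothNear F4 0 := s4.add (sp.mul sa.pdy)
  have t3 : SmoothNear F3 0 := s3.add (sp.mul t4)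
  have t2 : SmoothNear F2 0 := s2.add (sp.mul t3)
  have t1 : SmoothNear F1 0 := s1.add (sp.mul t2)
  have hgen : genFun V modelFun =ᶠ[𝓝 0] fun w => c0 w + w.2.2 * F1 w := by
    filter_upwards [eventually_base hV.eventually] with w hw
    have wa := smoothNear_coefa hw
    have wb := smoothNear_coefb hw
    simp only [genFun, coefB₁, pdx_modelFun, pdy_modelFun, pdp_modelFun]
    rw [coefB₀_eq_Dx hw, coefA_eq_Dx hw, pdy_charFun hw, Dx_Dx wa, Dx_Dx wb, Dx_eq, Dx_eq]
    simp only [F1, F2, F3, F4, hc0, hc1, hc2, hc3, hc4, hc5, modelFun, ← ha, ← hb]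
    ring
  have z0 := partialDeriv_horner sb.pdx.pdx t1 (fun l m n => by rw [d0, b0])
  have z1 := partialDeriv_horner s1 t2 (fun l m n => by rw [d1, b0, b0, a0]; ring)
  have z2 := partialDeriv_horner s2 t3 (fun l m n => by rw [d2, b0, b0, a0, a0]; ring)
  have z3 := partialDeriv_horner s3 t4 (fun l m n => by rw [d3, b0, a0, a0]; ring)
  have z4 := partialDeriv_horner s4 sa.pdy (fun l m n => by rw [d4, b0, a0]; ring)
  simp only [hA, hB]
  refine ⟨?_, ?_, ?_, ?_, ?_, ?_⟩ <;> rw [(partialDeriv_congr hgen _).self_of_nhds]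
  · rw [z0.1, d0]
  · rw [z0.2, z1.1, d1]; simp
  · rw [z0.2, z1.2, z2.1, d2]; norm_num
  · rw [z0.2, z1.2, z2.2, z3.1, d3]; push_cast; ring
  · rw [z0.2, z1.2, z2.2, z3.2, z4.1, d4]; push_cast; ring
  · rw [z0.2, z1.2, z2.2, z3.2, z4.2, d5]; push_cast; ring

end ModelJet

/-! ### Triviality of the normalized stabilizer of the model jet -/

section Coefficients

/-- The linear system for the derivatives of a field in the stabilizer of the jet of
`p⁴ + x² p²` has only the zero solution among fields normalized by the support conditions. -/
theorem coefficients_eq_zero {k : ℕ} (hk : 4 ≤ k) (A B : ℕ → ℕ → ℝ)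
    (hA0 : A 0 0 = 0) (hB0 : B 0 0 = 0) (hB1 : B 1 0 = 0)
    (r0 : ∀ l m, l + m ≤ k → B (l + 2) m = 0)
    (r1 : ∀ l m, l + m + 1 ≤ k →
      2 * B (l + 1) (m + 1) - A (l + 2) m - 2 * (l * (l - 1 : ℕ) * B (l - 2 + 1) m) = 0)
    (r2 : ∀ l m, l + m + 2 ≤ k → B l (m + 2) - 2 * A (l + 1) (m + 1)
      - l * (l - 1 : ℕ) * B (l - 2) (m + 1) - 2 * (l * A (l - 1) m) = 0)
    (r3 : ∀ l m, l + m + 3 ≤ k →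
      -A l (m + 2) - 4 * B (l + 1) m - l * (l - 1 : ℕ) * A (l - 2) (m + 1) = 0)
    (r4 : ∀ l m, l + m + 4 ≤ k → 2 * A (l + 1) m - 3 * B l (m + 1) = 0)
    (r5 : ∀ l m, l + m + 5 ≤ k → A l (m + 1) = 0)
    (sA : ∀ l m, A l m ≠ 0 → l + m < k ∨ 1 ≤ l ∧ l + m = k ∨ 2 ≤ l ∧ l + m = k + 1)
    (sB : ∀ l m, B l m ≠ 0 →
      l + m < k ∨ 1 ≤ l ∧ l + m = k ∨ 2 ≤ l ∧ l + m = k + 1 ∨ 2 ≤ l ∧ l + m = k + 2)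
    (h4 : k = 4 → A 0 1 = 0 ∧ B 1 1 = 0 ∧ B 0 2 = 0) (l m : ℕ) : A l m = 0 ∧ B l m = 0 := by
  have a01 : A 0 1 = 0 := by
    rcases Nat.lt_or_ge 4 k with h | h
    · exact r5 0 0 (by omega)
    · exact (h4 (by omega)).1
  have e20 := r1 0 0 (by omega)
  have e11 := r2 0 0 (by omega)
  have e02 := r3 0 0 (by omega)
  have b20 := r0 0 0 (by omega)
  have e1 := r4 0 0 (by omega)
  simp only [Nat.cast_zero, zero_mul, mul_zero, sub_zero, zero_add, hB1] at e20 e11 e02 e1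
  -- The coefficients of `p⁴` with one further derivative give `2 A₂₀ = 3 B₁₁` and `2 A₁₁ = 3 B₀₂`,
  -- incompatible with `A₂₀ = 2 B₁₁` and `B₀₂ = 2 A₁₁` unless all vanish. These two relations have
  -- order five, so for `k = 4` they are replaced by assumptions.
  have deg2 : B 1 1 = 0 ∧ B 0 2 = 0 := by
    rcases Nat.lt_or_ge 4 k with h | h
    · have f1 := r4 1 0 (by omega)
      have f2 := r4 0 1 (by omega)
      norm_num at f1 f2
      constructor <;> linarith
    · exact (h4 (by omega)).2
  obtain ⟨b11, b02⟩ := deg2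
  have a20 : A 2 0 = 0 := by linarith
  have a11 : A 1 1 = 0 := by linarith
  have a02 : A 0 2 = 0 := by linarith
  -- Here the term `x²p²` acts. The equation `u = p⁴` alone admits the scaling with `2 A₁₀ = 3 B₀₁`;
  -- the relation `r2` at `(2, 0)` couples these two coefficients to `B₂₂` and `A₃₁`, which already
  -- vanish, and gives `B₀₁ + 2 A₁₀ = 0`.
  have b22 := r0 0 2 (by omega)
  have e31 := r1 1 1 (by omega)
  have e22 := r2 2 0 (by omega)
  norm_num at b22 e31 e22
  have b01 : B 0 1 = 0 := by linarith
  have a10 : A 1 0 = 0 := by linarith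
  suffices H : ∀ d l m, l + m = d → A l m = 0 ∧ B l m = 0 from H _ l m rfl
  intro d
  induction d using Nat.strong_induction_on with
  | _ d ih =>
  intro l m hlm
  by_cases hd : d ≤ 2
  · have : (l = 0 ∧ m = 0) ∨ (l = 1 ∧ m = 0) ∨ (l = 0 ∧ m = 1) ∨ (l = 2 ∧ m = 0) ∨
        (l = 1 ∧ m = 1) ∨ (l = 0 ∧ m = 2) := by omega
    rcases this with ⟨rfl, rfl⟩ | ⟨rfl, rfl⟩ | ⟨rfl, rfl⟩ | ⟨rfl, rfl⟩ | ⟨rfl, rfl⟩ | ⟨rfl, rfl⟩ <;>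
      exact ⟨by assumption, by assumption⟩
  -- In degree `d ≥ 3` all contributions of `x²p²`, and `B (l + 1) m` in `r3`, have lower degree and
  -- vanish by induction. For `l < 2` the truncated indices do not matter because of the factor `l
  -- (l - 1)`.
  have q1 : ∀ l m, l + m + 2 = d → l + m + 1 ≤ k → 2 * B (l + 1) (m + 1) - A (l + 2) m = 0 := by
    intro l m h1 h2
    have hr := r1 l m h2
    rcases Nat.lt_or_ge l 2 with h | h
    · have : (l : ℝ) * (l - 1 : ℕ) = 0 := by interval_cases l <;> simp
      rw [this] at hr
      linarith
    · rw [(ih (l - 2 + 1 + m) (by omega) (l - 2 + 1) m rfl).2] at hr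
      linarith
  have q2 : ∀ l m, l + m + 2 = d → l + m + 2 ≤ k → B l (m + 2) - 2 * A (l + 1) (m + 1) = 0 := by
    intro l m h1 h2
    have := r2 l m h2
    have e1 : (l : ℝ) * (l - 1 : ℕ) * B (l - 2) (m + 1) = 0 := by
      rcases Nat.lt_or_ge l 2 with h | h
      · have : (l : ℝ) * (l - 1 : ℕ) = 0 := by interval_cases l <;> simp
        rw [this, zero_mul]
      · rw [(ih (l - 2 + (m + 1)) (by omega) _ _ rfl).2, mul_zero]
    have e2 : (l : ℝ) * A (l - 1) m = 0 := by
      rw [(ih (l - 1 + m) (by omega) _ _ rfl).1, mul_zero]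
    linarith
  have q3 : ∀ l m, l + m + 2 = d → l + m + 3 ≤ k → A l (m + 2) = 0 := by
    intro l m h1 h2
    have := r3 l m h2
    have e1 : (l : ℝ) * (l - 1 : ℕ) * A (l - 2) (m + 1) = 0 := by
      rcases Nat.lt_or_ge l 2 with h | h
      · have : (l : ℝ) * (l - 1 : ℕ) = 0 := by interval_cases l <;> simp
        rw [this, zero_mul]
      · rw [(ih (l - 2 + (m + 1)) (by omega) _ _ rfl).1, mul_zero]
    rw [e1, (ih (l + 1 + m) (by omega) _ _ rfl).2] at this
    linarith
  have bhigh : ∀ l m, l + m + 2 = d → B (l + 2) m = 0 := by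
    intro l m h1
    by_cases h : l + m ≤ k
    · exact r0 l m h
    · by_contra hne
      have := sB _ _ hne
      omega
  have azero : ∀ l m, (¬ (l + m < k ∨ 1 ≤ l ∧ l + m = k ∨ 2 ≤ l ∧ l + m = k + 1)) → A l m = 0 :=
    fun l m h => by
      by_contra hne
      exact h (sA _ _ hne)
  have bzero : ∀ l m, (¬ (l + m < k ∨ 1 ≤ l ∧ l + m = k ∨ 2 ≤ l ∧ l + m = k + 1 ∨
      2 ≤ l ∧ l + m = k + 2)) → B l m = 0 := fun l m h => by
    by_contra hne
    exact h (sB _ _ hne)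
  -- The relations `2B = A` and `B = 2A`, for the same pair of coefficients, force both to vanish.
  -- Above degree `k` the support condition excludes first index one.
  have hB1 : ∀ m, m + 1 = d → B 1 m = 0 := by
    intro m h1
    by_cases hk' : d ≤ k
    · obtain ⟨m, rfl⟩ : ∃ j, m = j + 2 := ⟨m - 2, by omega⟩
      have f1 := q1 0 (m + 1) (by omega) (by omega)
      have f2 := q2 1 m (by omega) (by omega)
      simp only [zero_add] at f1
      norm_num at f1 f2
      linarith
    · exact bzero _ _ (by omega)
  have hAhigh : ∀ l m, l + m + 2 = d → A (l + 2) m = 0 := by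
    intro l m h1
    by_cases hk' : d ≤ k + 1
    · have f1 := q1 l m h1 (by omega)
      have : B (l + 1) (m + 1) = 0 := by
        rcases l with _ | l
        · exact hB1 _ (by omega)
        · exact bhigh l (m + 1) (by omega)
      linarith
    · exact azero _ _ (by omega)
  have hA0' : ∀ m, m = d → A 0 m = 0 := by
    intro m h1
    by_cases hk' : d < k
    · obtain ⟨m, rfl⟩ : ∃ j, m = j + 2 := ⟨m - 2, by omega⟩
      exact q3 0 m (by omega) (by omega)
    · exact azero _ _ (by omega)
  -- The only relation tying the two together is `B 0 (m + 1) = 2 A 1 m`. A second one comes from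
  -- `r3` below degree `k`, and from the support condition on `B` in degree `k` itself.
  have hAB : ∀ m, m + 1 = d → A 1 m = 0 ∧ B 0 (m + 1) = 0 := by
    intro m h1
    obtain ⟨m, rfl⟩ : ∃ j, m = j + 1 := ⟨m - 1, by omega⟩
    rcases Nat.lt_or_ge k d with h | h
    · exact ⟨azero _ _ (by omega), bzero _ _ (by omega)⟩
    · have f2 := q2 0 m (by omega) (by omega)
      simp only [zero_add] at f2
      rcases Nat.lt_or_ge d k with h' | h'
      · obtain ⟨j, rfl⟩ : ∃ j, m = j + 1 := ⟨m - 1, by omega⟩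
        have f3 := q3 1 j (by omega) (by omega)
        exact ⟨f3, by linarith⟩
      · have f3 := bzero 0 (m + 2) (by omega)
        exact ⟨by linarith, f3⟩
  rcases l with _ | _ | l
  · refine ⟨hA0' m (by omega), ?_⟩
    obtain ⟨m, rfl⟩ : ∃ j, m = j + 1 := ⟨m - 1, by omega⟩
    exact (hAB m (by omega)).2
  · exact ⟨(hAB m (by omega)).1, hB1 m (by omega)⟩
  · exact ⟨hAhigh l m (by omega), bhigh l m (by omega)⟩

end Coefficients

/-! ### Polynomial dependence of the prolongation on the jet -/

section PolynomialDependence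

variable {k : ℕ}

/-- Functions of a jet and a point which are polynomial in the coordinates of both. -/
inductive PolyFamily {k : ℕ} : (Jet k → Pt → ℝ) → Prop
  | const (c : ℝ) : PolyFamily fun _ _ => c
  | coord (i : Fin 3 ⊕ JetIdx k) : PolyFamily fun θ _ => θ.coords i
  | x : PolyFamily fun _ w => w.1
  | y : PolyFamily fun _ w => w.2.1
  | p : PolyFamily fun _ w => w.2.2
  | add {F G : Jet k → Pt → ℝ} : PolyFamily F → PolyFamily G → PolyFamily fun θ w => F θ w + G θ w
  | mul {F G : Jet k → Pt → ℝ} : PolyFamily F → PolyFamily G → PolyFamily fun θ w => F θ w * G θ w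

variable {F G : Jet k → Pt → ℝ}

theorem PolyFamily.contDiff (h : PolyFamily F) (θ : Jet k) : ContDiff ℝ ∞ (F θ) := by
  induction h with
  | const c => exact contDiff_const
  | coord i => exact contDiff_const
  | x => exact contDiff_fst
  | y => exact contDiff_fst.comp contDiff_snd
  | p => exact contDiff_snd.comp contDiff_snd
  | add _ _ ih₁ ih₂ => exact ih₁.add ih₂
  | mul _ _ ih₁ ih₂ => exact ih₁.mul ih₂

theorem PolyFamily.differentiableAt (h : PolyFamily F) (θ : Jet k) (w : Pt) :
    DifferentiableAt ℝ (F θ) w :=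
  (h.contDiff θ).contDiffAt.differentiableAt (by simp)

theorem PolyFamily.sub (hF : PolyFamily F) (hG : PolyFamily G) :
    PolyFamily fun θ w => F θ w - G θ w := by
  convert! hF.add ((PolyFamily.const (-1)).mul hG) using 3
  ring

theorem PolyFamily.pow (hF : PolyFamily F) (n : ℕ) : PolyFamily fun θ w => F θ w ^ n := by
  induction n with
  | zero => simpa using PolyFamily.const 1
  | succ n ih => simpa only [pow_succ] using ih.mul hF

theorem PolyFamily.div_const (hF : PolyFamily F) (c : ℝ) : PolyFamily fun θ w => F θ w / c := by
  simpa only [div_eq_mul_inv] using hF.mul (PolyFamily.const c⁻¹)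

theorem PolyFamily.sum {ι : Type*} (s : Finset ι) {F : ι → Jet k → Pt → ℝ}
    (h : ∀ i ∈ s, PolyFamily (F i)) : PolyFamily fun θ w => ∑ i ∈ s, F i θ w := by
  classical
  induction s using Finset.induction_on with
  | empty => simpa using PolyFamily.const 0
  | insert a s ha ih =>
    simp only [Finset.sum_insert ha]
    exact (h a (by simp)).add (ih fun i hi => h i (by simp [hi]))

/-- Differentiation concerns the point only, so the jet coordinates count as constants. -/
theorem PolyFamily.dirDeriv (h : PolyFamily F) (v : Pt) :
    PolyFamily fun θ => dirDeriv v (F θ) := by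
  induction h with
  | const c => convert! PolyFamily.const 0 using 3; simp [PointODE.dirDeriv]
  | coord i => convert! PolyFamily.const 0 using 3; simp [PointODE.dirDeriv]
  | x =>
    convert! PolyFamily.const v.1 using 3
    exact dirDeriv_apply_of_hasDerivAt (by fun_prop) (by
      simpa using (hasDerivAt_id (0 : ℝ)).mul_const v.1)
  | y =>
    convert! PolyFamily.const v.2.1 using 3
    exact dirDeriv_apply_of_hasDerivAt (by fun_prop) (by
      simpa using (hasDerivAt_id (0 : ℝ)).mul_const v.2.1)
  | p =>
    convert! PolyFamily.const v.2.2 using 3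
    exact dirDeriv_apply_of_hasDerivAt (by fun_prop) (by
      simpa using (hasDerivAt_id (0 : ℝ)).mul_const v.2.2)
  | add h₁ h₂ ih₁ ih₂ =>
    convert! ih₁.add ih₂ using 3
    exact dirDeriv_add_apply (h₁.differentiableAt _ _) (h₂.differentiableAt _ _) v
  | mul h₁ h₂ ih₁ ih₂ =>
    convert! (ih₁.mul h₂).add (h₁.mul ih₂) using 3
    exact dirDeriv_mul_apply (h₁.differentiableAt _ _) (h₂.differentiableAt _ _) v

theorem PolyFamily.pdx (h : PolyFamily F) : PolyFamily fun θ => pdx (F θ) := h.dirDeriv _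

theorem PolyFamily.pdy (h : PolyFamily F) : PolyFamily fun θ => pdy (F θ) := h.dirDeriv _

theorem PolyFamily.pdp (h : PolyFamily F) : PolyFamily fun θ => pdp (F θ) := h.dirDeriv _

theorem PolyFamily.Dx (h : PolyFamily F) : PolyFamily fun θ => Dx (F θ) := by
  convert! h.pdx.add (PolyFamily.p.mul h.pdy) using 3
  exact Dx_eq _ _

theorem PolyFamily.dirDeriv_iterate (h : PolyFamily F) (v : Pt) (n : ℕ) :
    PolyFamily fun θ => (PointODE.dirDeriv v)^[n] (F θ) := by
  induction n with
  | zero => exact h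
  | succ n ih =>
    simp only [Function.iterate_succ_apply']
    exact ih.dirDeriv v

theorem PolyFamily.partialDeriv (h : PolyFamily F) (ζ : ℕ × ℕ × ℕ) :
    PolyFamily fun θ => partialDeriv ζ (F θ) :=
  ((h.dirDeriv_iterate _ _).dirDeriv_iterate _ _).dirDeriv_iterate _ _

/-- At the base point of the jet the point coordinates become jet coordinates themselves. -/
theorem PolyFamily.exists_eval (h : PolyFamily F) :
    ∃ Q : MvPolynomial (Fin 3 ⊕ JetIdx k) ℝ, ∀ θ : Jet k,
      F θ θ.1 = MvPolynomial.eval θ.coords Q := by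
  induction h with
  | const c => exact ⟨MvPolynomial.C c, fun θ => by simp⟩
  | coord i => exact ⟨MvPolynomial.X i, fun θ => by simp⟩
  | x => exact ⟨MvPolynomial.X (Sum.inl 0), fun θ => by simp [Jet.coords]⟩
  | y => exact ⟨MvPolynomial.X (Sum.inl 1), fun θ => by simp [Jet.coords]⟩
  | p => exact ⟨MvPolynomial.X (Sum.inl 2), fun θ => by simp [Jet.coords]⟩
  | add _ _ ih₁ ih₂ =>
    obtain ⟨P, hP⟩ := ih₁
    obtain ⟨Q, hQ⟩ := ih₂
    exact ⟨P + Q, fun θ => by rw [map_add, ← hP, ← hQ]⟩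
  | mul _ _ ih₁ ih₂ =>
    obtain ⟨P, hP⟩ := ih₁
    obtain ⟨Q, hQ⟩ := ih₂
    exact ⟨P * Q, fun θ => by rw [map_mul, ← hP, ← hQ]⟩

theorem polyFamily_taylor : PolyFamily fun θ : Jet k => θ.taylor := by
  have hx : PolyFamily fun (θ : Jet k) w => w.1 - θ.1.1 :=
    PolyFamily.x.sub (PolyFamily.coord (Sum.inl 0))
  have hy : PolyFamily fun (θ : Jet k) w => w.2.1 - θ.1.2.1 :=
    PolyFamily.y.sub (PolyFamily.coord (Sum.inl 1))
  have hp : PolyFamily fun (θ : Jet k) w => w.2.2 - θ.1.2.2 :=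
    PolyFamily.p.sub (PolyFamily.coord (Sum.inl 2))
  have hu : ∀ ζ, PolyFamily fun (θ : Jet k) _ => θ.2 ζ := fun ζ => PolyFamily.coord (Sum.inr ζ)
  exact PolyFamily.sum Finset.univ fun ζ _ =>
    (((hu ζ).mul ((hx.pow _).div_const _)).mul ((hy.pow _).div_const _)).mul
      ((hp.pow _).div_const _)

/-- The components of the prolongation of a polynomial field are polynomial in the jet. -/
theorem exists_eval_prolongVec {V : Plane → Plane}
    (ha : PolyFamily fun _ : Jet k => coefa V) (hb : PolyFamily fun _ : Jet k => coefb V)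
    (i : Fin 3 ⊕ JetIdx k) : ∃ Q : MvPolynomial (Fin 3 ⊕ JetIdx k) ℝ, ∀ θ : Jet k,
      (prolongVec θ V).coords i = MvPolynomial.eval θ.coords Q := by
  have hφ : PolyFamily fun _ : Jet k => charFun V := hb.sub (PolyFamily.p.mul ha)
  have hA : PolyFamily fun _ : Jet k => coefA V := hφ.Dx
  have hB₀ : PolyFamily fun _ : Jet k => coefB₀ V := hA.Dx
  have hB₁ : PolyFamily fun _ : Jet k => coefB₁ V := hφ.pdy.sub ((PolyFamily.const 2).mul ha.Dx)
  have ht := polyFamily_taylor (k := k)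
  have hg : PolyFamily fun θ : Jet k => genFun V θ.taylor :=
    (((hB₀.add (hB₁.mul ht)).sub (ha.mul ht.pdx)).sub (hb.mul ht.pdy)).sub (hA.mul ht.pdp)
  rcases i with i | ζ
  · fin_cases i
    · exact ha.exists_eval
    · exact hb.exists_eval
    · exact hA.exists_eval
  · exact ((((hg.partialDeriv ζ.1).add (ha.mul (ht.pdx.partialDeriv ζ.1))).add
      (hb.mul (ht.pdy.partialDeriv ζ.1))).add (hA.mul (ht.pdp.partialDeriv ζ.1))).exists_eval

end PolynomialDependence

/-! ### Generic properties and semicontinuity of the rank -/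

section Generic

variable {k : ℕ}

theorem Generically.mono {S T : Jet k → Prop} (h : Generically k S) (hST : ∀ θ, S θ → T θ) :
    Generically k T := by
  obtain ⟨P, h0, hP⟩ := h
  exact ⟨P, h0, fun θ hθ => hST θ (hP θ hθ)⟩

theorem Generically.and {S T : Jet k → Prop} (hS : Generically k S) (hT : Generically k T) :
    Generically k fun θ => S θ ∧ T θ := by
  obtain ⟨P, h0, hP⟩ := hS
  obtain ⟨Q, h0', hQ⟩ := hT
  refine ⟨P * Q, mul_ne_zero h0 h0', fun θ hθ => ?_⟩
  rw [map_mul] at hθ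
  exact ⟨hP θ (left_ne_zero_of_mul hθ), hQ θ (right_ne_zero_of_mul hθ)⟩

theorem continuous_coords : Continuous fun θ : Jet k => θ.coords := by
  refine continuous_pi fun i => ?_
  rcases i with i | ζ
  · fin_cases i
    · exact continuous_fst.comp continuous_fst
    · exact (continuous_fst.comp continuous_snd).comp continuous_fst
    · exact (continuous_snd.comp continuous_snd).comp continuous_fst
  · exact (continuous_apply ζ).comp continuous_snd

/-- A property which holds generically holds near a generic point. -/
theorem Generically.eventually {S : Jet k → Prop} (h : Generically k S) :
    Generically k fun θ => ∀ᶠ η in 𝓝 θ, S η := by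
  obtain ⟨P, h0, hP⟩ := h
  refine ⟨P, h0, fun θ hθ => ?_⟩
  have hc : Continuous fun θ : Jet k => MvPolynomial.eval θ.coords P :=
    (MvPolynomial.continuous_eval P).comp continuous_coords
  filter_upwards [hc.continuousAt.eventually_ne hθ] with η hη using hP η hη

/-- The coordinates of the projected jet are among those of the jet, so the same polynomial in
renamed variables serves; injectivity of the renaming keeps it nonzero. -/
theorem Generically.proj {j k : ℕ} (hjk : j ≤ k) {S : Jet j → Prop} (h : Generically j S) :
    Generically k fun θ => S (θ.proj hjk) := by
  obtain ⟨P, h0, hP⟩ := h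
  let f : Fin 3 ⊕ JetIdx j → Fin 3 ⊕ JetIdx k := Sum.map id fun ζ => ⟨ζ.1, ζ.2.trans hjk⟩
  have hf : Function.Injective f :=
    Function.injective_id.sumMap fun a b h => Subtype.ext (Subtype.mk.inj h)
  refine ⟨MvPolynomial.rename f P, fun h => h0 (MvPolynomial.rename_injective f hf (by simpa using h)),
    fun θ hθ => hP _ ?_⟩
  rw [MvPolynomial.eval_rename] at hθ
  have : (θ.proj hjk).coords = θ.coords ∘ f := by
    funext i
    rcases i with i | ζ <;> rfl
  rwa [this]

/-- The coordinates as a linear isomorphism. -/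
def coordsEquiv (k : ℕ) : Jet k ≃ₗ[ℝ] (Fin 3 ⊕ JetIdx k → ℝ) where
  toFun := Jet.coords
  map_add' θ η := by
    funext i
    rcases i with i | ζ
    · fin_cases i <;> rfl
    · rfl
  map_smul' c θ := by
    funext i
    rcases i with i | ζ
    · fin_cases i <;> rfl
    · rfl
  invFun v := ((v (Sum.inl 0), v (Sum.inl 1), v (Sum.inl 2)), fun ζ => v (Sum.inr ζ))
  left_inv _ := rfl
  right_inv v := by
    funext i
    rcases i with i | ζ
    · fin_cases i <;> rfl
    · rfl

/-- Gram criterion over the reals: `c M Mᵀ = 0` gives `|c M|² = 0`, hence `c M = 0`. One determinant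
replaces the choice of a nonzero minor. -/
theorem linearIndependent_rows_iff {ι κ : Type*} [Fintype ι] [DecidableEq ι] [Fintype κ]
    (M : Matrix ι κ ℝ) : LinearIndependent ℝ M.row ↔ (M * M.transpose).det ≠ 0 := by
  rw [← not_iff_not, not_not, ← Matrix.exists_vecMul_eq_zero_iff, Fintype.linearIndependent_iff]
  push Not
  constructor
  · rintro ⟨c, hc, i, hi⟩
    refine ⟨c, fun h => hi (by simp [h]), ?_⟩
    have : Matrix.vecMul c M = 0 := by
      rw [← hc]
      funext j
      simp [Matrix.vecMul, dotProduct, Finset.sum_apply, Matrix.row]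
    rw [← Matrix.vecMul_vecMul, this, Matrix.zero_vecMul]
  · rintro ⟨c, hc, h⟩
    have h0 : Matrix.vecMul c M = 0 := by
      have : dotProduct (Matrix.vecMul c M) (Matrix.vecMul c M) = 0 := by
        rw [← Matrix.vecMul_vecMul, Matrix.vecMul_transpose] at h
        have := congrArg (fun v => dotProduct c v) h
        simp only [dotProduct_zero] at this
        rw [Matrix.dotProduct_mulVec] at this
        exact this
      exact dotProduct_self_eq_zero.1 this
    refine ⟨c, ?_, Function.ne_iff.1 hc⟩
    rw [← h0]
    funext j
    simp [Matrix.vecMul, dotProduct, Finset.sum_apply, Matrix.row]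

/-- If polynomial fields have linearly independent prolongations at one jet, then the rank of the
prolongation is at least their number at a generic jet. -/
theorem generically_le_finrank {ι : Type*} [Fintype ι] (V : ι → Plane → Plane)
    (hs : ∀ i, ContDiff ℝ ∞ (V i))
    (ha : ∀ i, PolyFamily fun _ : Jet k => coefa (V i))
    (hb : ∀ i, PolyFamily fun _ : Jet k => coefb (V i)) (θ₀ : Jet k)
    (hi : LinearIndependent ℝ fun i => prolongVec θ₀ (V i)) :
    Generically k fun θ => Fintype.card ι ≤ Module.finrank ℝ (orbitTangent θ) := by
  classical
  choose Q hQ using fun i => exists_eval_prolongVec (ha i) (hb i)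
  let M : Matrix ι (Fin 3 ⊕ JetIdx k) (MvPolynomial (Fin 3 ⊕ JetIdx k) ℝ) := Q
  -- The Gram determinant of the prolongations is the polynomial that witnesses genericity; the jet
  -- `θ₀` shows that it is nonzero.
  have hM : ∀ θ : Jet k, MvPolynomial.eval θ.coords (M * M.transpose).det ≠ 0 ↔
      LinearIndependent ℝ fun i => prolongVec θ (V i) := by
    intro θ
    have e : (M.map (MvPolynomial.eval θ.coords)).row = fun i => coordsEquiv k (prolongVec θ (V i)) := by
      funext i j
      exact (hQ i j θ).symm
    rw [RingHom.map_det, RingHom.mapMatrix_apply, Matrix.map_mul, Matrix.transpose_map,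
      ← linearIndependent_rows_iff, e]
    exact (LinearMap.linearIndependent_iff (coordsEquiv k).toLinearMap
      (coordsEquiv k).ker)
  refine ⟨(M * M.transpose).det, fun h => (hM θ₀).2 hi (by rw [h, map_zero]), fun θ hθ => ?_⟩
  have h := (hM θ).1 hθ
  rw [← finrank_span_eq_card h]
  refine Submodule.finrank_mono (Submodule.span_le.2 ?_)
  rintro _ ⟨i, rfl⟩
  exact ⟨⟨V i, ContDiff.smoothNear (hs i) _⟩, rfl⟩

end Generic

/-! ### Lower bound for the generic rank -/

section LowerBound

/-- The field `x^i y^j / (i! j!) ∂/∂x` or `x^i y^j / (i! j!) ∂/∂y`. -/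
def monomialField : (ℕ × ℕ) ⊕ (ℕ × ℕ) → Plane → Plane
  | Sum.inl s => fun q => (q.1 ^ s.1 / (s.1.factorial : ℝ) * (q.2 ^ s.2 / (s.2.factorial : ℝ)), 0)
  | Sum.inr s => fun q => (0, q.1 ^ s.1 / (s.1.factorial : ℝ) * (q.2 ^ s.2 / (s.2.factorial : ℝ)))

theorem contDiff_monomialField (i : (ℕ × ℕ) ⊕ (ℕ × ℕ)) : ContDiff ℝ ∞ (monomialField i) := by
  rcases i with i | i <;> simp only [monomialField] <;> fun_prop

theorem coefa_monomialField_inl (s : ℕ × ℕ) :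
    coefa (monomialField (Sum.inl s)) = monomialAt 0 s.1 s.2 0 := by
  funext w; simp [coefa, monomialField, monomialAt, Pt.base]

theorem coefb_monomialField_inr (s : ℕ × ℕ) :
    coefb (monomialField (Sum.inr s)) = monomialAt 0 s.1 s.2 0 := by
  funext w; simp [coefb, monomialField, monomialAt, Pt.base]

theorem polyFamily_monomialAt {k : ℕ} (i j : ℕ) :
    PolyFamily fun _ : Jet k => monomialAt 0 i j 0 := by
  have := (((PolyFamily.x (k := k)).pow i).div_const (i.factorial : ℝ)).mul
    (((PolyFamily.y (k := k)).pow j).div_const (j.factorial : ℝ))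
  convert! this using 3
  simp [monomialAt]

theorem polyFamily_coefa_monomialField {k : ℕ} (i : (ℕ × ℕ) ⊕ (ℕ × ℕ)) :
    PolyFamily fun _ : Jet k => coefa (monomialField i) := by
  rcases i with s | s
  · rw [coefa_monomialField_inl]; exact polyFamily_monomialAt _ _
  · exact PolyFamily.const 0

theorem polyFamily_coefb_monomialField {k : ℕ} (i : (ℕ × ℕ) ⊕ (ℕ × ℕ)) :
    PolyFamily fun _ : Jet k => coefb (monomialField i) := by
  rcases i with s | s
  · exact PolyFamily.const 0
  · rw [coefb_monomialField_inr]; exact polyFamily_monomialAt _ _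

/-- A vanishing combination of the prolongations is a polynomial field in the stabilizer of the
model jet. Its Taylor coefficients are the coefficients of the combination, supported in `SA` and
`SB`, and the linear system for the model forces them to vanish. -/
theorem linearIndependent_prolongVec_modelFun {k : ℕ} (hk : 4 ≤ k) (SA SB : Finset (ℕ × ℕ))
    (hSA : ∀ s ∈ SA,
      s.1 + s.2 < k ∨ 1 ≤ s.1 ∧ s.1 + s.2 = k ∨ 2 ≤ s.1 ∧ s.1 + s.2 = k + 1)
    (hSB : ∀ s ∈ SB, s.1 + s.2 < k ∨ 1 ≤ s.1 ∧ s.1 + s.2 = k ∨ 2 ≤ s.1 ∧ s.1 + s.2 = k + 1 ∨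
      2 ≤ s.1 ∧ s.1 + s.2 = k + 2)
    (h4 : k = 4 → (0, 1) ∉ SA ∧ (1, 1) ∉ SB ∧ (0, 2) ∉ SB) :
    LinearIndependent ℝ fun i : SA ⊕ SB => prolongVec (jetOf k modelFun 0)
      (monomialField (Sum.map Subtype.val Subtype.val i)) := by
  rw [Fintype.linearIndependent_iff]
  intro c hc
  let U : SA ⊕ SB → localFields (jetOf k modelFun 0).1.base := fun i =>
    ⟨monomialField (Sum.map Subtype.val Subtype.val i),
      ContDiff.smoothNear (contDiff_monomialField _) _⟩
  set W := ∑ i, c i • U i with hW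
  have hpr : prolong (jetOf k modelFun 0) W = 0 := by
    rw [hW, map_sum, ← hc]
    exact Finset.sum_congr rfl fun i _ => by rw [map_smul]; rfl
  have hWs : SmoothNear W.1 (0 : Pt).base := W.2
  have hv : prolongVec (jetOf k modelFun 0) W.1 = 0 := hpr
  rw [prolongVec_jetOf (smoothNear_modelFun 0) hWs] at hv
  have ha0 := congrArg (fun v => v.1.1) hv
  have hb0 := congrArg (fun v => v.1.2.1) hv
  have hA0 := congrArg (fun v => v.1.2.2) hv
  simp only [Prod.fst_zero, Prod.snd_zero] at ha0 hb0 hA0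
  have hWval : W.1 = fun q => ∑ i, c i • monomialField (Sum.map Subtype.val Subtype.val i) q := by
    rw [hW]
    funext q
    simp [U, Finset.sum_apply]
  set A : ℕ → ℕ → ℝ := fun l m => partialDeriv (l, m, 0) (coefa W.1) 0 with hA
  set B : ℕ → ℕ → ℝ := fun l m => partialDeriv (l, m, 0) (coefb W.1) 0 with hB
  have hs : ∀ i j : ℕ, SmoothNear (monomialAt 0 i j 0) 0 := fun i j =>
    ContDiff.smoothNear (contDiff_monomialAt 0 i j 0) 0
  have hAc : ∀ l m, A l m = ∑ s : SA, c (Sum.inl s) * if l = s.1.1 ∧ m = s.1.2 then 1 else 0 := by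
    intro l m
    have : coefa W.1 = fun w => ∑ s : SA, c (Sum.inl s) * monomialAt 0 s.1.1 s.1.2 0 w := by
      funext w
      have h1 : ∀ s : ℕ × ℕ, monomialAt 0 s.1 s.2 0 w = (monomialField (Sum.inl s) w.base).1 :=
        fun s => (congrFun (coefa_monomialField_inl s) w).symm
      simp only [h1]
      simp [coefa, hWval, Prod.fst_sum, monomialField]
    simp only [hA, this]
    rw [partialDeriv_sum _ _ fun s _ => (SmoothNear.const _ _).mul (hs _ _)]
    simp only [partialDeriv_const_mul (hs _ _), partialDeriv_monomialAt]
    simp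
  have hBc : ∀ l m, B l m = ∑ s : SB, c (Sum.inr s) * if l = s.1.1 ∧ m = s.1.2 then 1 else 0 := by
    intro l m
    have : coefb W.1 = fun w => ∑ s : SB, c (Sum.inr s) * monomialAt 0 s.1.1 s.1.2 0 w := by
      funext w
      have h1 : ∀ s : ℕ × ℕ, monomialAt 0 s.1 s.2 0 w = (monomialField (Sum.inr s) w.base).2 :=
        fun s => (congrFun (coefb_monomialField_inr s) w).symm
      simp only [h1]
      simp [coefb, hWval, Prod.snd_sum, monomialField]
    simp only [hB, this]
    rw [partialDeriv_sum _ _ fun s _ => (SmoothNear.const _ _).mul (hs _ _)]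
    simp only [partialDeriv_const_mul (hs _ _), partialDeriv_monomialAt]
    simp
  have hAne : ∀ l m, A l m ≠ 0 → (l, m) ∈ SA := by
    intro l m h
    by_contra hm
    refine h ?_
    rw [hAc]
    refine Finset.sum_eq_zero fun s _ => ?_
    rw [if_neg, mul_zero]
    rintro ⟨rfl, rfl⟩
    exact hm s.2
  have hBne : ∀ l m, B l m ≠ 0 → (l, m) ∈ SB := by
    intro l m h
    by_contra hm
    refine h ?_
    rw [hBc]
    refine Finset.sum_eq_zero fun s _ => ?_
    rw [if_neg, mul_zero]
    rintro ⟨rfl, rfl⟩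
    exact hm s.2
  have hexp := partialDeriv_genFun_modelFun hWs A B (fun _ _ => rfl) (fun _ _ => rfl)
  -- As `a`, `b` and `A` vanish at the origin, the transport terms of the prolongation drop out and
  -- only the generating function remains.
  have hgen : ∀ l m n, l + m + n ≤ k → partialDeriv (l, m, n) (genFun W.1 modelFun) 0 = 0 := by
    intro l m n hn
    have h1 := congrFun (congrArg Prod.snd hv) ⟨(l, m, n), hn⟩
    simp only [Prod.snd_zero, Pi.zero_apply] at h1
    rw [partialDeriv_prolongFun hWs (smoothNear_modelFun 0), ha0, hb0, hA0] at h1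
    simpa using h1
  have hz := coefficients_eq_zero hk A B ha0 hb0
    (by
      have h1 := coefA_eq_Dx hWs
      rw [hA0, Dx_eq] at h1
      have h2 : B 1 0 = pdx (coefb W.1) 0 := rfl
      rw [h2]
      simpa using h1.symm)
    (fun l m h => by rw [← (hexp l m).1]; exact hgen l m 0 (by omega))
    (fun l m h => by rw [← (hexp l m).2.1]; exact hgen l m 1 (by omega))
    (fun l m h => by
      have := (hexp l m).2.2.1
      rw [hgen l m 2 (by omega)] at this
      linarith)
    (fun l m h => by
      have := (hexp l m).2.2.2.1
      rw [hgen l m 3 (by omega)] at this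
      linarith)
    (fun l m h => by
      have := (hexp l m).2.2.2.2.1
      rw [hgen l m 4 (by omega)] at this
      linarith)
    (fun l m h => by
      have := (hexp l m).2.2.2.2.2
      rw [hgen l m 5 (by omega)] at this
      linarith)
    (fun l m h => hSA _ (hAne l m h)) (fun l m h => hSB _ (hBne l m h))
    (fun h => ⟨by_contra fun h' => (h4 h).1 (hAne _ _ h'),
      by_contra fun h' => (h4 h).2.1 (hBne _ _ h'), by_contra fun h' => (h4 h).2.2 (hBne _ _ h')⟩)
  rintro (⟨⟨l, m⟩, hs⟩ | ⟨⟨l, m⟩, hs⟩)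
  · have := (hz l m).1
    rw [hAc, Finset.sum_eq_single ⟨(l, m), hs⟩] at this
    · simpa using this
    · rintro ⟨⟨i, j⟩, hij⟩ _ hne
      rw [if_neg, mul_zero]
      rintro ⟨rfl, rfl⟩
      exact hne rfl
    · simp
  · have := (hz l m).2
    rw [hBc, Finset.sum_eq_single ⟨(l, m), hs⟩] at this
    · simpa using this
    · rintro ⟨⟨i, j⟩, hij⟩ _ hne
      rw [if_neg, mul_zero]
      rintro ⟨rfl, rfl⟩
      exact hne rfl
    · simp

/-- The exponents of the fields along `∂/∂x` in a complement of the stabilizer. -/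
def supportA (k : ℕ) : Finset (ℕ × ℕ) :=
  (triangle (k - 1)).disjUnion
    (((Finset.HasAntidiagonal.antidiagonal (k - 1)).image fun s => (s.1 + 1, s.2)) ∪
      (Finset.HasAntidiagonal.antidiagonal (k - 1)).image fun s => (s.1 + 2, s.2)) (by
    rw [Finset.disjoint_left]
    rintro ⟨a, b⟩ h h'
    rw [mem_triangle] at h
    simp only [Finset.mem_union, Finset.mem_image, Finset.HasAntidiagonal.mem_antidiagonal,
      Prod.mk.injEq, Prod.exists] at h'
    simp only at h
    obtain ⟨c, d, h1, h2, rfl⟩ | ⟨c, d, h1, h2, rfl⟩ := h' <;> omega)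

/-- The exponents of the fields along `∂/∂y` in a complement of the stabilizer. -/
def supportB (k : ℕ) : Finset (ℕ × ℕ) :=
  supportA k ∪ (Finset.HasAntidiagonal.antidiagonal k).image fun s => (s.1 + 2, s.2)

theorem mem_supportA {k : ℕ} (hk : 1 ≤ k) {s : ℕ × ℕ} : s ∈ supportA k ↔
    s.1 + s.2 < k ∨ 1 ≤ s.1 ∧ s.1 + s.2 = k ∨ 2 ≤ s.1 ∧ s.1 + s.2 = k + 1 := by
  obtain ⟨l, m⟩ := s
  simp only [supportA, Finset.mem_disjUnion, mem_triangle, Finset.mem_union, Finset.mem_image,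
    Finset.HasAntidiagonal.mem_antidiagonal, Prod.mk.injEq, Prod.exists]
  constructor
  · rintro (h | ⟨c, d, h1, rfl, rfl⟩ | ⟨c, d, h1, rfl, rfl⟩) <;> omega
  · rintro (h | ⟨h1, h2⟩ | ⟨h1, h2⟩)
    · exact Or.inl (by omega)
    · exact Or.inr (Or.inl ⟨l - 1, m, by omega, by omega, rfl⟩)
    · exact Or.inr (Or.inr ⟨l - 2, m, by omega, by omega, rfl⟩)

theorem mem_supportB {k : ℕ} (hk : 1 ≤ k) {s : ℕ × ℕ} : s ∈ supportB k ↔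
    s.1 + s.2 < k ∨ 1 ≤ s.1 ∧ s.1 + s.2 = k ∨ 2 ≤ s.1 ∧ s.1 + s.2 = k + 1 ∨
      2 ≤ s.1 ∧ s.1 + s.2 = k + 2 := by
  rw [supportB, Finset.mem_union, mem_supportA hk]
  obtain ⟨l, m⟩ := s
  simp only [Finset.mem_image, Finset.HasAntidiagonal.mem_antidiagonal, Prod.mk.injEq, Prod.exists]
  constructor
  · rintro (h | ⟨c, d, h1, rfl, rfl⟩) <;> omega
  · rintro h
    by_cases h' : 2 ≤ l ∧ l + m = k + 2
    · exact Or.inr ⟨l - 2, m, by omega, by omega, rfl⟩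
    · exact Or.inl (by omega)

/-- The count is twice `k(k + 1)/2 + 2k`, plus `k + 1` for the top degree along `∂/∂y`. -/
theorem card_supports {k : ℕ} (hk : 1 ≤ k) :
    (supportA k).card + (supportB k).card = k ^ 2 + 6 * k + 1 := by
  have hi : ∀ j : ℕ, Function.Injective fun s : ℕ × ℕ => (s.1 + j, s.2) := by
    rintro j ⟨a, b⟩ ⟨c, d⟩ h
    simp only [Prod.mk.injEq] at h
    ext <;> simp <;> omega
  have h1 := two_mul_card_triangle (k - 1)
  have hA : (supportA k).card = (triangle (k - 1)).card + (k + k) := by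
    rw [supportA, Finset.card_disjUnion, Finset.card_union_of_disjoint,
      Finset.card_image_of_injective _ (hi 1), Finset.card_image_of_injective _ (hi 2)]
    · simp only [Finset.Nat.card_antidiagonal]
      omega
    · rw [Finset.disjoint_left]
      rintro ⟨a, b⟩ h h'
      simp only [Finset.mem_image, Finset.HasAntidiagonal.mem_antidiagonal,
        Prod.mk.injEq, Prod.exists] at h h'
      obtain ⟨c, d, h1, rfl, rfl⟩ := h
      obtain ⟨c', d', h2, h3, rfl⟩ := h'
      omega
  have hB : (supportB k).card = (supportA k).card + (k + 1) := by
    rw [supportB, Finset.card_union_of_disjoint, Finset.card_image_of_injective _ (hi 2)]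
    · simp
    · rw [Finset.disjoint_left]
      rintro ⟨a, b⟩ h h'
      rw [mem_supportA hk] at h
      simp only [Finset.mem_image, Finset.HasAntidiagonal.mem_antidiagonal, Prod.mk.injEq,
        Prod.exists] at h h'
      obtain ⟨c, d, h1, h2, rfl⟩ := h'
      omega
  rw [hB, hA]
  obtain ⟨d, rfl⟩ := Nat.exists_eq_add_of_le' hk
  simp only [Nat.add_sub_cancel] at h1 ⊢
  nlinarith

theorem generically_finrank_orbitTangent {k : ℕ} (hk : 5 ≤ k) :
    Generically k fun θ => Module.finrank ℝ (orbitTangent θ) = k ^ 2 + 6 * k + 1 := by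
  have h := generically_le_finrank _ (fun i => contDiff_monomialField _)
    (fun i => polyFamily_coefa_monomialField _) (fun i => polyFamily_coefb_monomialField _) _
    (linearIndependent_prolongVec_modelFun (k := k) (by omega) (supportA k) (supportB k)
      (fun s => (mem_supportA (by omega)).1) (fun s => (mem_supportB (by omega)).1)
      (fun h => by omega))
  refine h.mono fun θ hθ => le_antisymm (finrank_orbitTangent_le (by omega) θ) ?_
  rwa [Fintype.card_sum, Fintype.card_coe, Fintype.card_coe, card_supports (by omega)] at hθ

theorem proj_surjective {j k : ℕ} (h : j ≤ k) :
    Function.Surjective (Jet.proj h) := by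
  intro η
  refine ⟨(η.1, fun ζ => if h' : ζ.1.1 + ζ.1.2.1 + ζ.1.2.2 ≤ j then η.2 ⟨ζ.1, h'⟩ else 0), ?_⟩
  refine Prod.ext rfl (funext fun ζ => ?_)
  simp [Jet.proj, ζ.2]

/-- The projection between jet spaces as a linear map. -/
def projLinear {j k : ℕ} (h : j ≤ k) : Jet k →ₗ[ℝ] Jet j where
  toFun := Jet.proj h
  map_add' _ _ := rfl
  map_smul' _ _ := rfl

/-- In order four the supports contain `41` exponents while `dim J^4 = 38`. The discarded fields are
multiples of `y ∂/∂x`, `xy ∂/∂y` and `y² ∂/∂y`, precisely those whose elimination would use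
relations of order five. The others span the tangent space at the model jet, and their projections
span in lower order. -/
theorem generically_orbitTangent_eq_top {k : ℕ} (hk : k ≤ 4) :
    Generically k fun θ => orbitTangent θ = ⊤ := by
  let SA := (supportA 4).erase (0, 1)
  let SB := ((supportB 4).erase (1, 1)).erase (0, 2)
  have hli := linearIndependent_prolongVec_modelFun (k := 4) le_rfl SA SB
    (fun s hs => (mem_supportA (by omega)).1 (Finset.mem_of_mem_erase hs))
    (fun s hs => (mem_supportB (by omega)).1
      (Finset.mem_of_mem_erase (Finset.mem_of_mem_erase hs)))
    (fun _ => by simp [SA, SB])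
  have hcard : Fintype.card (SA ⊕ SB) = Module.finrank ℝ (Jet 4) := by
    have h1 := six_mul_card_jetIdx 4
    have h2 := card_supports (k := 4) (by omega)
    rw [Fintype.card_sum, Fintype.card_coe, Fintype.card_coe, finrank_jet,
      Finset.card_erase_of_mem ((mem_supportA (by omega)).2 (by simp)),
      Finset.card_erase_of_mem (by
        rw [Finset.mem_erase, mem_supportB (by omega)]; simp),
      Finset.card_erase_of_mem ((mem_supportB (by omega)).2 (by simp))]
    have h3 : 1 ≤ (supportA 4).card :=
      Finset.card_pos.2 ⟨(0, 0), (mem_supportA (by omega)).2 (by simp)⟩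
    have h4 : 2 ≤ (supportB 4).card := by
      rw [← Finset.card_pair (a := ((0, 0) : ℕ × ℕ)) (b := (0, 1)) (by simp)]
      refine Finset.card_le_card fun s hs => ?_
      simp only [Finset.mem_insert, Finset.mem_singleton] at hs
      rw [mem_supportB (by omega)]
      rcases hs with rfl | rfl <;> simp
    omega
  have hspan := hli.span_eq_top_of_card_eq_finrank' hcard
  set θ₀ := jetOf k modelFun 0
  have hproj : ∀ i : SA ⊕ SB, prolongVec θ₀ (monomialField (Sum.map Subtype.val Subtype.val i))
      = projLinear hk (prolongVec (jetOf 4 modelFun 0)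
          (monomialField (Sum.map Subtype.val Subtype.val i))) := fun i =>
    prolongVec_proj hk (jetOf 4 modelFun 0) (ContDiff.smoothNear (contDiff_monomialField _) _)
  have hspan' : Submodule.span ℝ (Set.range fun i : SA ⊕ SB =>
      prolongVec θ₀ (monomialField (Sum.map Subtype.val Subtype.val i))) = ⊤ := by
    simp only [hproj]
    rw [Set.range_comp' (projLinear hk), ← Submodule.map_span, hspan, Submodule.map_top,
      LinearMap.range_eq_top]
    exact proj_surjective hk
  -- After projection the family still spans but may be dependent; an independent subfamily with the
  -- same span is needed for the Gram criterion.
  obtain ⟨κ, a, ha, hsp, hli'⟩ := exists_linearIndependent' ℝ fun i : SA ⊕ SB =>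
      prolongVec θ₀ (monomialField (Sum.map Subtype.val Subtype.val i))
  have : Finite κ := Finite.of_injective a ha
  have := Fintype.ofFinite κ
  have h := generically_le_finrank _ (fun i => contDiff_monomialField _)
    (fun i => polyFamily_coefa_monomialField _) (fun i => polyFamily_coefb_monomialField _) _ hli'
  refine h.mono fun θ hθ => Submodule.eq_top_of_finrank_eq (le_antisymm (Submodule.finrank_le _) ?_)
  rw [← finrank_span_eq_card hli', hsp, hspan', finrank_top] at hθ
  exact hθ

end LowerBound

/-! ### Commutators of a prolonged field with `D_x` and `∂/∂p` -/

section LieDerivative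

variable {z : Pt} {F G : Pt → ℝ} {V : Plane → Plane}

/-- The derivative of a function along the first prolongation `a ∂/∂x + b ∂/∂y + A ∂/∂p`
of `V`. -/
def lie (V : Plane → Plane) (F : Pt → ℝ) : Pt → ℝ := fun w =>
  coefa V w * pdx F w + coefb V w * pdy F w + coefA V w * pdp F w

theorem lie_eq_fderiv (V : Plane → Plane) (F : Pt → ℝ) (w : Pt) :
    lie V F w = fderiv ℝ F w (coefa V w, coefb V w, coefA V w) := by
  rw [fderiv_apply_eq]; rfl

theorem lie_mul (hF : SmoothNear F z) (hG : SmoothNear G z) :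
    lie V (fun w => F w * G w) z = lie V F z * G z + F z * lie V G z := by
  simp only [lie_eq_fderiv]
  exact dirDeriv_mul_apply hF.differentiableAt hG.differentiableAt _

theorem lie_add (hF : SmoothNear F z) (hG : SmoothNear G z) :
    lie V (fun w => F w + G w) z = lie V F z + lie V G z := by
  simp only [lie_eq_fderiv]
  exact dirDeriv_add_apply hF.differentiableAt hG.differentiableAt _

theorem lie_congr (h : F =ᶠ[𝓝 z] G) : lie V F z = lie V G z := by
  simp only [lie_eq_fderiv, h.fderiv_eq]

theorem lie_p (V : Plane → Plane) (w : Pt) : lie V (fun w => w.2.2) w = coefA V w := by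
  have h : fderiv ℝ (fun w : Pt => w.2.2) w =
      (ContinuousLinearMap.snd ℝ ℝ ℝ).comp (ContinuousLinearMap.snd ℝ ℝ (ℝ × ℝ)) :=
    ((ContinuousLinearMap.snd ℝ ℝ ℝ).comp (ContinuousLinearMap.snd ℝ ℝ (ℝ × ℝ))).fderiv
  rw [lie_eq_fderiv, h]
  rfl

theorem dirDeriv_lie (hV : SmoothNear V z.base) (hF : SmoothNear F z) (v : Pt) :
    dirDeriv v (lie V F) z =
      dirDeriv v (coefa V) z * pdx F z + dirDeriv v (coefb V) z * pdy F z
        + dirDeriv v (coefA V) z * pdp F z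
      + coefa V z * pdx (dirDeriv v F) z + coefb V z * pdy (dirDeriv v F) z
      + coefA V z * pdp (dirDeriv v F) z := by
  have ha := smoothNear_coefa hV
  have hb := smoothNear_coefb hV
  have hA := smoothNear_coefA hV
  have ex := (dirDeriv_comm hF v (1, 0, 0)).self_of_nhds
  have ey := (dirDeriv_comm hF v (0, 1, 0)).self_of_nhds
  have ep := (dirDeriv_comm hF v (0, 0, 1)).self_of_nhds
  have h1 := dirDeriv_add_apply ((ha.mul hF.pdx).add (hb.mul hF.pdy)).differentiableAt
    (hA.mul hF.pdp).differentiableAt v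
  have h2 := dirDeriv_add_apply (ha.mul hF.pdx).differentiableAt
    (hb.mul hF.pdy).differentiableAt v
  have h3 := dirDeriv_mul_apply ha.differentiableAt hF.pdx.differentiableAt v
  have h4 := dirDeriv_mul_apply hb.differentiableAt hF.pdy.differentiableAt v
  have h5 := dirDeriv_mul_apply hA.differentiableAt hF.pdp.differentiableAt v
  rw [h2, h3, h4, h5] at h1
  simp only [pdx_eq, pdy_eq, pdp_eq] at h1 ⊢
  rw [ex, ey, ep] at h1
  refine Eq.trans h1 ?_
  ring

/-- The first prolongation preserves the contact structure: its commutator with `D_x` has no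
component outside `D_x` and `∂/∂p`, because `A = D_x b - p D_x a` makes the `∂/∂y`-component equal
to `p D_x a`. -/
theorem Dx_lie (hV : SmoothNear V z.base) (hF : SmoothNear F z) :
    Dx (lie V F) z = lie V (Dx F) z + Dx (coefa V) z * Dx F z + Dx (coefA V) z * pdp F z := by
  have e : Dx F = fun w => pdx F w + w.2.2 * pdy F w := funext fun w => Dx_eq F w
  have h1 : lie V (Dx F) z = lie V (pdx F) z + (coefA V z * pdy F z
      + z.2.2 * lie V (pdy F) z) := by
    rw [e, lie_add hF.pdx (smoothNear_pp.mul hF.pdy), lie_mul smoothNear_pp hF.pdy, lie_p]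
  have hx := dirDeriv_lie hV hF (1, 0, 0)
  have hy := dirDeriv_lie hV hF (0, 1, 0)
  have hA := coefA_eq_Dx hV
  simp only [← pdx_eq, ← pdy_eq] at hx hy
  rw [h1, Dx_eq (lie V F), hx, hy, hA, Dx_eq (coefa V), Dx_eq (coefb V), Dx_eq F,
    Dx_eq (coefA V)]
  rw [Dx_eq, Dx_eq] at hA
  simp only [lie, hA]
  ring

theorem pdp_coefa (V : Plane → Plane) : pdp (coefa V) = fun _ => 0 :=
  pdp_comp_base fun q => (V q).1

theorem pdp_coefb (V : Plane → Plane) : pdp (coefb V) = fun _ => 0 :=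
  pdp_comp_base fun q => (V q).2

theorem pdp_lie (hV : SmoothNear V z.base) (hF : SmoothNear F z) :
    pdp (lie V F) z = lie V (pdp F) z + pdp (coefA V) z * pdp F z := by
  have h := dirDeriv_lie hV hF (0, 0, 1)
  simp only [← pdp_eq, pdp_coefa, pdp_coefb] at h
  rw [h]
  simp only [lie]
  ring

theorem pdp_p (w : Pt) : pdp (fun w => w.2.2) w = 1 := by
  have h : fderiv ℝ (fun w : Pt => w.2.2) w =
      (ContinuousLinearMap.snd ℝ ℝ ℝ).comp (ContinuousLinearMap.snd ℝ ℝ (ℝ × ℝ)) :=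
    ((ContinuousLinearMap.snd ℝ ℝ ℝ).comp (ContinuousLinearMap.snd ℝ ℝ (ℝ × ℝ))).fderiv
  change fderiv ℝ (fun w : Pt => w.2.2) w (0, 0, 1) = 1
  rw [h]
  rfl

/-- The commutator of `∂/∂p` and `D_x` is `∂/∂y`. -/
theorem pdp_Dx (hF : SmoothNear F z) : pdp (Dx F) z = Dx (pdp F) z + pdy F z := by
  have e : Dx F = fun w => pdx F w + w.2.2 * pdy F w := funext fun w => Dx_eq F w
  have h1 := dirDeriv_add_apply hF.pdx.differentiableAt
    (smoothNear_pp.mul hF.pdy).differentiableAt (0, 0, 1)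
  have h2 := dirDeriv_mul_apply (smoothNear_pp (z := z)).differentiableAt
    hF.pdy.differentiableAt (0, 0, 1)
  have h3 := pdp_p z
  have ex := (dirDeriv_comm hF (0, 0, 1) (1, 0, 0)).self_of_nhds
  have ey := (dirDeriv_comm hF (0, 0, 1) (0, 1, 0)).self_of_nhds
  simp only [pdx_eq, pdy_eq, pdp_eq] at *
  rw [h2, h3, ex, ey] at h1
  rw [Dx_eq (dirDeriv _ F), e]
  refine Eq.trans h1 ?_
  simp only [pdx_eq, pdy_eq]
  ring

/-- With `φ` the characteristic function of `V`, this combines `[∂/∂p, D_x] = ∂/∂y` with `∂φ/∂p =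
-a`; it is how `B₁` enters the transformation of second derivatives. -/
theorem pdp_coefA (hV : SmoothNear V z.base) :
    pdp (coefA V) z = coefB₁ V z + Dx (coefa V) z := by
  have hc := smoothNear_charFun hV
  have e : ∀ᶠ w in 𝓝 z, pdp (charFun V) w = - coefa V w := by
    filter_upwards [(smoothNear_coefa hV).eventually, (smoothNear_coefb hV).eventually]
      with w ha hb
    have h1 := dirDeriv_sub_apply hb.differentiableAt
      (smoothNear_pp.mul ha).differentiableAt (0, 0, 1)
    have h2 := dirDeriv_mul_apply (smoothNear_pp (z := w)).differentiableAt
      ha.differentiableAt (0, 0, 1)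
    have h3 := pdp_p w
    have h4 := congrFun (pdp_coefa V) w
    have h5 := congrFun (pdp_coefb V) w
    simp only [pdp_eq] at *
    rw [h2, h3, h4, h5] at h1
    refine Eq.trans h1 (by ring)
  have hD : Dx (pdp (charFun V)) z = - Dx (coefa V) z := by
    rw [(Dx_congr (G := fun w => - coefa V w) e).self_of_nhds]
    simp [Dx, along]
  have := pdp_Dx hc
  rw [hD] at this
  simp only [coefA, coefB₁]
  rw [this]; ring

end LieDerivative

/-! ### The infinitesimal action on slopes and equations -/

section Infinitesimal

variable {z : Pt} {V : Plane → Plane}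

theorem Dx_neg (F : Pt → ℝ) (w : Pt) : Dx (fun w => -F w) w = -Dx F w := by
  simp [Dx, along]

theorem pdp_neg (F : Pt → ℝ) (w : Pt) : pdp (fun w => -F w) w = -pdp F w := by
  simp [pdp, along]

theorem genFun_eq_lie (V : Plane → Plane) (h : Pt → ℝ) (w : Pt) :
    genFun V h w = coefB₀ V w + coefB₁ V w * h w - lie V h w := by
  simp only [genFun, lie]; ring

/-- Applying `lie V` to `P · D_x X = D_x Y` and commuting it with `D_x` shows that `-lie V P`
satisfies the linear equation imposed on `P'`. The commutator terms cancel by the equation itself,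
as `X` and `Y` do not depend on `p`, and `D_x X ≠ 0` gives uniqueness. -/
theorem infinitesimal_slope {X Y P X' Y' P' : Pt → ℝ} (hV : SmoothNear V z.base)
    (hX : SmoothNear X z) (hY : SmoothNear Y z) (hP : SmoothNear P z)
    (hXp : pdp X z = 0) (hYp : pdp Y z = 0) (hD : Dx X z ≠ 0)
    (eX : X' =ᶠ[𝓝 z] fun w => -lie V X w) (eY : Y' =ᶠ[𝓝 z] fun w => -lie V Y w)
    (eP : (fun w => P w * Dx X w) =ᶠ[𝓝 z] Dx Y)
    (eP' : P' z * Dx X z + P z * Dx X' z = Dx Y' z) : P' z = -lie V P z := by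
  rw [(Dx_congr eX).self_of_nhds, (Dx_congr eY).self_of_nhds, Dx_neg, Dx_neg, Dx_lie hV hX,
    Dx_lie hV hY, hXp, hYp] at eP'
  have h1 := lie_congr (V := V) eP
  rw [lie_mul hP hX.Dx] at h1
  have h2 := eP.self_of_nhds
  apply mul_right_cancel₀ hD
  linear_combination eP' + h1 + Dx (coefa V) z * h2

/-- The same comparison for the transformation law `f · P_p + D_x P = H · D_x X`, where primes stand
for parameter derivatives. The commutators now leave `D_x A = B₀` and `f (∂A/∂p - D_x a) = B₁ f` as
multiples of `P_p`, which together with `-lie V f` make up the generating function. -/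
theorem infinitesimal_genFun {X P f H X' P' H' f' : Pt → ℝ} (hV : SmoothNear V z.base)
    (hX : SmoothNear X z) (hP : SmoothNear P z) (hf : SmoothNear f z) (hH : SmoothNear H z)
    (hXp : pdp X z = 0) (hD : pdp P z ≠ 0)
    (eX : X' =ᶠ[𝓝 z] fun w => -lie V X w) (eP : P' =ᶠ[𝓝 z] fun w => -lie V P w)
    (eH : H' z = -lie V H z)
    (ef : (fun w => f w * pdp P w + Dx P w) =ᶠ[𝓝 z] fun w => H w * Dx X w)
    (ef' : f' z * pdp P z + f z * pdp P' z + Dx P' z = H' z * Dx X z + H z * Dx X' z) :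
    f' z = genFun V f z := by
  rw [(Dx_congr eX).self_of_nhds, (Dx_congr eP).self_of_nhds, Dx_neg, Dx_neg, Dx_lie hV hX,
    Dx_lie hV hP, hXp, eH] at ef'
  have e := (dirDeriv_congr eP (0, 0, 1)).self_of_nhds
  simp only [← pdp_eq] at e
  rw [e, pdp_neg, pdp_lie hV hP] at ef'
  have h1 := lie_congr (V := V) ef
  rw [lie_add (hf.mul hP.pdp) hP.Dx, lie_mul hf hP.pdp, lie_mul hH hX.Dx] at h1
  have h2 := ef.self_of_nhds
  have hA := pdp_coefA hV
  rw [hA] at ef'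
  have hB : coefB₀ V z = Dx (coefA V) z := rfl
  rw [genFun_eq_lie, hB]
  apply mul_right_cancel₀ hD
  simp only at h2
  linear_combination ef' + h1 + Dx (coefa V) z * h2

end Infinitesimal

/-! ### Differential operators on families of functions -/

section Families

variable {E : Type*} [NormedAddCommGroup E] [NormedSpace ℝ E]

/-- The action of an operator on functions of `ℝ³` on functions which depend on a parameter. -/
def parOp {E : Type*} (T : (Pt → ℝ) → Pt → ℝ) (F : E × Pt → ℝ) : E × Pt → ℝ := fun m =>
  T (fun w => F (m.1, w)) m.2

/-- An operator which acts on smooth families of functions, compatibly with differentiation with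
respect to the parameter. -/
structure FamilyOp (E : Type*) [NormedAddCommGroup E] [NormedSpace ℝ E]
    (T : (Pt → ℝ) → Pt → ℝ) : Prop where
  congr : ∀ (F G : E × Pt → ℝ) (m : E × Pt), F =ᶠ[𝓝 m] G → parOp T F =ᶠ[𝓝 m] parOp T G
  smooth : ∀ (F : E × Pt → ℝ) (m : E × Pt), SmoothNear F m → SmoothNear (parOp T F) m
  comm : ∀ (F : E × Pt → ℝ) (m : E × Pt), SmoothNear F m → ∀ τ : E,
    dirDeriv (τ, (0 : Pt)) (parOp T F) =ᶠ[𝓝 m] parOp T (dirDeriv (τ, (0 : Pt)) F)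

theorem eventually_slice {E : Type*} [TopologicalSpace E] {m : E × Pt} {S : E × Pt → Prop} (h : ∀ᶠ m' in 𝓝 m, S m') :
    ∀ᶠ w in 𝓝 m.2, S (m.1, w) :=
  (Continuous.prodMk_right m.1).continuousAt.eventually h

theorem SmoothNear.slice {F : E × Pt → ℝ} {m : E × Pt} (hF : SmoothNear F m) :
    SmoothNear (fun w => F (m.1, w)) m.2 :=
  SmoothNear.comp (f := fun w : Pt => (m.1, w)) hF
    ((SmoothNear.const m.1 m.2).prodMk (ContDiff.smoothNear contDiff_id m.2))

theorem parOp_dirDeriv_apply {F : E × Pt → ℝ} {m : E × Pt} (hF : DifferentiableAt ℝ F m)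
    (v : Pt) : parOp (dirDeriv v) F m = dirDeriv (0, v) F m := by
  have hl : HasFDerivAt (fun w : Pt => (m.1, w)) (ContinuousLinearMap.inr ℝ E Pt) m.2 :=
    hasFDerivAt_prodMk_right m.1 m.2
  have h := (hF.hasFDerivAt (x := (m.1, m.2))).comp m.2 hl
  have h' : fderiv ℝ (fun w => F (m.1, w)) m.2 = _ := h.fderiv
  simp [parOp, dirDeriv, h']

/-- On a jointly smooth function the slicewise derivative is the derivative in the direction `(0,
v)`, so compatibility with the parameter is the symmetry of second derivatives. -/
theorem FamilyOp.dirDeriv (v : Pt) : FamilyOp E (dirDeriv v) where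
  congr F G m h := by
    filter_upwards [h.eventuallyEq_nhds] with m' h'
    exact (dirDeriv_congr (eventually_slice h') v).self_of_nhds
  smooth F m hF := by
    refine (hF.dirDeriv ((0 : E), v)).congr ?_
    filter_upwards [hF.eventually] with m' h'
    exact parOp_dirDeriv_apply h'.differentiableAt v
  comm F m hF τ := by
    have e : parOp (PointODE.dirDeriv v) F =ᶠ[𝓝 m] PointODE.dirDeriv ((0 : E), v) F := by
      filter_upwards [hF.eventually] with m' h'
      exact parOp_dirDeriv_apply h'.differentiableAt v
    have e' : parOp (PointODE.dirDeriv v) (PointODE.dirDeriv (τ, (0 : Pt)) F) =ᶠ[𝓝 m]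
        PointODE.dirDeriv ((0 : E), v) (PointODE.dirDeriv (τ, (0 : Pt)) F) := by
      filter_upwards [(hF.dirDeriv (τ, (0 : Pt))).eventually] with m' h'
      exact parOp_dirDeriv_apply h'.differentiableAt v
    exact ((dirDeriv_congr e _).trans (dirDeriv_comm hF _ _)).trans e'.symm

theorem FamilyOp.comp {S T : (Pt → ℝ) → Pt → ℝ} (hS : FamilyOp E S) (hT : FamilyOp E T) :
    FamilyOp E (fun F => S (T F)) where
  congr F G m h := hS.congr _ _ m (hT.congr F G m h)
  smooth F m hF := hS.smooth _ m (hT.smooth F m hF)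
  comm F m hF τ := (hS.comm _ m (hT.smooth F m hF) τ).trans (hS.congr _ _ m (hT.comm F m hF τ))

theorem FamilyOp.iterate {T : (Pt → ℝ) → Pt → ℝ} (hT : FamilyOp E T) (n : ℕ) :
    FamilyOp E (T^[n]) := by
  induction n with
  | zero => exact ⟨fun _ _ _ h => h, fun _ _ h => h, fun _ _ _ _ => Filter.EventuallyEq.rfl⟩
  | succ n ih => exact ih.comp hT

theorem familyOp_pdx : FamilyOp E pdx := FamilyOp.dirDeriv _
theorem familyOp_pdy : FamilyOp E pdy := FamilyOp.dirDeriv _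
theorem familyOp_pdp : FamilyOp E pdp := FamilyOp.dirDeriv _

theorem familyOp_partialDeriv (ζ : ℕ × ℕ × ℕ) : FamilyOp E (partialDeriv ζ) :=
  (familyOp_pdx.iterate ζ.1).comp ((familyOp_pdy.iterate ζ.2.1).comp
    (familyOp_pdp.iterate ζ.2.2))

theorem parOp_Dx {E : Type*} (F : E × Pt → ℝ) :
    parOp Dx F = fun m => parOp pdx F m + m.2.2.2 * parOp pdy F m :=
  funext fun _ => Dx_eq _ _

theorem smoothNear_param_p (m : E × Pt) : SmoothNear (fun m : E × Pt => m.2.2.2) m :=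
  ContDiff.smoothNear (by fun_prop) m

theorem familyOp_Dx : FamilyOp E Dx where
  congr F G m h := by
    filter_upwards [familyOp_pdx.congr F G m h, familyOp_pdy.congr F G m h] with m' h₁ h₂
    simp only [parOp_Dx, h₁, h₂]
  smooth F m hF := by
    rw [parOp_Dx]
    exact (familyOp_pdx.smooth F m hF).add
      ((smoothNear_param_p m).mul (familyOp_pdy.smooth F m hF))
  comm F m hF τ := by
    rw [parOp_Dx, parOp_Dx]
    filter_upwards [familyOp_pdx.comm F m hF τ, familyOp_pdy.comm F m hF τ,
      (familyOp_pdx.smooth F m hF).eventually, (familyOp_pdy.smooth F m hF).eventually]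
      with m' h₁ h₂ s₁ s₂
    rw [dirDeriv_add_apply s₁.differentiableAt
      ((smoothNear_param_p m').mul s₂).differentiableAt,
      dirDeriv_mul_apply (smoothNear_param_p m').differentiableAt s₂.differentiableAt, h₁, h₂,
      dirDeriv_eq_zero_of_invariant' (f := fun m : E × Pt => m.2.2.2) (fun t => by simp)]
    ring

end Families

/-! ### Regular points of the prolongation of a plane map -/

section Regular

/-- The first prolongation of `φ` is a local diffeomorphism near `z`. -/
structure IsRegular (φ : Plane → Plane) (z : Pt) : Prop where
  smooth : SmoothNear φ z.base
  inv : (fderiv ℝ φ z.base).IsInvertible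
  ne : Dx (fun w => (φ w.base).1) z ≠ 0

theorem contDiff_base : ContDiff ℝ ∞ Pt.base := by unfold Pt.base; fun_prop

theorem fderiv_comp_base {F : Type*} [NormedAddCommGroup F] [NormedSpace ℝ F] {h : Plane → F}
    {z : Pt} (hh : DifferentiableAt ℝ h z.base) (v : Pt) :
    fderiv ℝ (fun w : Pt => h w.base) z v = fderiv ℝ h z.base v.base := by
  let L : Pt →L[ℝ] Plane := (ContinuousLinearMap.fst ℝ ℝ (ℝ × ℝ)).prod
    ((ContinuousLinearMap.fst ℝ ℝ ℝ).comp (ContinuousLinearMap.snd ℝ ℝ (ℝ × ℝ)))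
  have hL : HasFDerivAt Pt.base L z := L.hasFDerivAt
  have hc := (hh.hasFDerivAt (x := z.base)).comp z hL
  have e : fderiv ℝ (fun w : Pt => h w.base) z = _ := hc.fderiv
  rw [e]
  rfl

variable {φ : Plane → Plane} {z : Pt}

theorem dirDeriv_comp_base_fst (hφ : DifferentiableAt ℝ φ z.base) (v : Pt) :
    dirDeriv v (fun w => (φ w.base).1) z = (fderiv ℝ φ z.base v.base).1 := by
  have h := fderiv_comp_base (h := fun q => (φ q).1) hφ.fst v
  have h' : fderiv ℝ (fun q => (φ q).1) z.base = _ := (hφ.hasFDerivAt.fst).fderiv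
  rw [h'] at h
  exact h

theorem dirDeriv_comp_base_snd (hφ : DifferentiableAt ℝ φ z.base) (v : Pt) :
    dirDeriv v (fun w => (φ w.base).2) z = (fderiv ℝ φ z.base v.base).2 := by
  have h := fderiv_comp_base (h := fun q => (φ q).2) hφ.snd v
  have h' : fderiv ℝ (fun q => (φ q).2) z.base = _ := (hφ.hasFDerivAt.snd).fderiv
  rw [h'] at h
  exact h

theorem smoothNear_base_fst (hφ : SmoothNear φ z.base) :
    SmoothNear (fun w : Pt => (φ w.base).1) z := smoothNear_coefa hφ

theorem smoothNear_base_snd (hφ : SmoothNear φ z.base) :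
    SmoothNear (fun w : Pt => (φ w.base).2) z := smoothNear_coefb hφ

theorem IsRegular.eventually (h : IsRegular φ z) : ∀ᶠ w in 𝓝 z, IsRegular φ w := by
  obtain ⟨A, hA⟩ := h.inv
  have hb := contDiff_base.continuous.continuousAt (x := z)
  have h1 : ∀ᶠ w in 𝓝 z, (fderiv ℝ φ w.base).IsInvertible :=
    (h.smooth.fderiv.contDiffAt.continuousAt.comp_of_eq hb rfl).eventually
      (show ∀ᶠ B in 𝓝 (fderiv ℝ φ z.base), B.IsInvertible by
        rw [← hA]; exact ContinuousLinearEquiv.nhds A)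
  have h2 := (smoothNear_base_fst h.smooth).Dx.contDiffAt.continuousAt.eventually_ne h.ne
  filter_upwards [h1, h2, eventually_base h.smooth.eventually] with w a b c using ⟨c, a, b⟩

theorem slope_mul_Dx {w : Pt} (h : IsRegular φ w) :
    slope φ w * Dx (fun w => (φ w.base).1) w = Dx (fun w => (φ w.base).2) w :=
  div_mul_cancel₀ _ h.ne

theorem IsRegular.smoothNear_slope (h : IsRegular φ z) : SmoothNear (slope φ) z :=
  (smoothNear_base_snd h.smooth).Dx.div (smoothNear_base_fst h.smooth).Dx h.ne

theorem IsRegular.smoothNear_lift₁ (h : IsRegular φ z) : SmoothNear (lift₁ φ) z :=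
  (smoothNear_base_fst h.smooth).prodMk ((smoothNear_base_snd h.smooth).prodMk h.smoothNear_slope)

/-- If `P_p = 0`, the `p`-derivative of `P · D_x X = D_x Y` reads `P X_y = Y_y`. Together with that
equation the covector `(-P, 1)` annihilates the range of the differential of `φ`, which is the whole
plane. -/
theorem IsRegular.pdp_slope_ne (h : IsRegular φ z) : pdp (slope φ) z ≠ 0 := by
  intro h0
  have hX := smoothNear_base_fst h.smooth
  have hY := smoothNear_base_snd h.smooth
  have hP := h.smoothNear_slope
  have e : (fun w => slope φ w * Dx (fun w => (φ w.base).1) w) =ᶠ[𝓝 z]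
      Dx (fun w => (φ w.base).2) := by
    filter_upwards [h.eventually] with w hw using slope_mul_Dx hw
  have e1 := (dirDeriv_congr e (0, 0, 1)).self_of_nhds
  rw [dirDeriv_mul_apply hP.differentiableAt hX.Dx.differentiableAt] at e1
  simp only [← pdp_eq] at e1
  have hXp : pdp (fun w : Pt => (φ w.base).1) = fun _ => 0 := pdp_comp_base fun q => (φ q).1
  have hYp : pdp (fun w : Pt => (φ w.base).2) = fun _ => 0 := pdp_comp_base fun q => (φ q).2
  have hD0 : Dx (fun _ : Pt => (0 : ℝ)) z = 0 := by simp [Dx, along]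
  rw [pdp_Dx hX, pdp_Dx hY, hXp, hYp, hD0, h0] at e1
  have e2 := slope_mul_Dx h
  rw [Dx_eq, Dx_eq] at e2
  have d := h.smooth.differentiableAt
  have hx1 := dirDeriv_comp_base_fst d (1, 0, 0)
  have hy1 := dirDeriv_comp_base_fst d (0, 1, 0)
  have hx2 := dirDeriv_comp_base_snd d (1, 0, 0)
  have hy2 := dirDeriv_comp_base_snd d (0, 1, 0)
  simp only [← pdx_eq, ← pdy_eq] at hx1 hx2 hy1 hy2
  rw [hx1, hx2, hy1, hy2] at e2
  rw [hy1, hy2] at e1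
  obtain ⟨v, hv⟩ := h.inv.surjective (0, 1)
  have hlin : fderiv ℝ φ z.base v = v.1 • fderiv ℝ φ z.base (Pt.base (1, 0, 0))
      + v.2 • fderiv ℝ φ z.base (Pt.base (0, 1, 0)) := by
    rw [← map_smul, ← map_smul, ← map_add]
    congr 1
    ext <;> simp [Pt.base]
  rw [hlin] at hv
  have hv1 := congrArg Prod.fst hv
  have hv2 := congrArg Prod.snd hv
  simp only [Prod.fst_add, Prod.snd_add, Prod.smul_fst, Prod.smul_snd, smul_eq_mul] at hv1 hv2
  have : (0 : ℝ) = 1 := by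
    rw [← hv2]
    linear_combination (-slope φ z) * hv1 + v.1 * e2 + (v.2 - v.1 * z.2.2) * e1
  exact zero_ne_one this

/-- The equation which is mapped to `u = g` by the point transformation `φ`. -/
def pull (φ : Plane → Plane) (g : Pt → ℝ) : Pt → ℝ := fun w =>
  (g (lift₁ φ w) * Dx (fun w => (φ w.base).1) w - Dx (slope φ) w) / pdp (slope φ) w

theorem IsRegular.smoothNear_pull (h : IsRegular φ z) {g : Pt → ℝ}
    (hg : SmoothNear g (lift₁ φ z)) : SmoothNear (pull φ g) z :=
  (((hg.comp h.smoothNear_lift₁).mul (smoothNear_base_fst h.smooth).Dx).sub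
    h.smoothNear_slope.Dx).div h.smoothNear_slope.pdp h.pdp_slope_ne

theorem IsRegular.lift₂_pull (h : IsRegular φ z) (g : Pt → ℝ) :
    lift₂ φ z (pull φ g z) = g (lift₁ φ z) := by
  have h1 := h.pdp_slope_ne
  have h2 := h.ne
  simp only [lift₂, pull]
  rw [div_mul_cancel₀ _ h1, add_sub_cancel, mul_div_cancel_right₀ _ h2]

theorem IsRegular.pull_eq_of_lift₂ (h : IsRegular φ z) {f g : Pt → ℝ}
    (e : g (lift₁ φ z) = lift₂ φ z (f z)) : pull φ g z = f z := by
  have h1 := h.pdp_slope_ne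
  have h2 := h.ne
  simp only [pull]
  rw [e]
  simp only [lift₂]
  rw [div_mul_cancel₀ _ h2, add_sub_cancel_left, mul_div_cancel_right₀ _ h1]

/-- In the difference of the two preimages the term `D_x P` cancels, and a smooth multiple of `(f -
g) ∘ lift₁ φ` is left. -/
theorem IsRegular.jetOf_pull_congr (h : IsRegular φ z) {k : ℕ} {f g : Pt → ℝ}
    (hf : SmoothNear f (lift₁ φ z)) (hg : SmoothNear g (lift₁ φ z))
    (e : jetOf k f (lift₁ φ z) = jetOf k g (lift₁ φ z)) :
    jetOf k (pull φ f) z = jetOf k (pull φ g) z := by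
  rw [jetOf_eq_iff (h.smoothNear_pull hf) (h.smoothNear_pull hg)]
  have v := (((jetOf_eq_iff hf hg).1 e).comp h.smoothNear_lift₁ (hf.sub hg))
  have hq := (smoothNear_base_fst h.smooth).Dx.div h.smoothNear_slope.pdp h.pdp_slope_ne
  have hL := h.smoothNear_lift₁
  have v' := v.mul_smooth ((hf.comp hL).sub (hg.comp hL)) hq
  refine v'.congr (Filter.Eventually.of_forall fun w => ?_)
  simp only [pull]
  ring

/-- The differential is triangular: `φ` controls the plane directions, and `P_p ≠ 0` controls the
fibre. -/
theorem IsRegular.fderiv_lift₁_injective (h : IsRegular φ z) :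
    Function.Injective (fderiv ℝ (lift₁ φ) z) := by
  rw [injective_iff_map_eq_zero]
  intro v hv
  have hX := (smoothNear_base_fst h.smooth).differentiableAt.hasFDerivAt
  have hY := (smoothNear_base_snd h.smooth).differentiableAt.hasFDerivAt
  have hP := h.smoothNear_slope.differentiableAt.hasFDerivAt
  have e : fderiv ℝ (lift₁ φ) z = _ := (hX.prodMk (hY.prodMk hP)).fderiv
  rw [e] at hv
  have h1 : dirDeriv v (fun w => (φ w.base).1) z = 0 := congrArg Prod.fst hv
  have h2 : dirDeriv v (fun w => (φ w.base).2) z = 0 := congrArg (fun v : Pt => v.2.1) hv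
  have h3 : fderiv ℝ (slope φ) z v = 0 := congrArg (fun v : Pt => v.2.2) hv
  rw [dirDeriv_comp_base_fst h.smooth.differentiableAt] at h1
  rw [dirDeriv_comp_base_snd h.smooth.differentiableAt] at h2
  have h4 : fderiv ℝ φ z.base v.base = 0 := Prod.ext h1 h2
  have h5 : v.base = 0 := h.inv.injective (h4.trans (map_zero _).symm)
  have h6 : v.1 = 0 := congrArg Prod.fst h5
  have h7 : v.2.1 = 0 := congrArg Prod.snd h5
  rw [fderiv_apply_eq, h6, h7] at h3
  have h8 : v.2.2 = 0 := by simpa [h.pdp_slope_ne] using h3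
  exact Prod.ext h6 (Prod.ext h7 h8)

end Regular

/-! ### Smooth families of plane maps and their velocity fields -/

section RegularFamilies

variable {E : Type*} [NormedAddCommGroup E] [NormedSpace ℝ E] {φ : E × Plane → Plane}
  {g : E × Pt → ℝ} {m : E × Pt}

/-- The family of first components of a family of maps of the plane. -/
def famX (φ : E × Plane → Plane) : E × Pt → ℝ := fun m => (φ (m.1, m.2.base)).1

/-- The family of second components of a family of maps of the plane. -/
def famY (φ : E × Plane → Plane) : E × Pt → ℝ := fun m => (φ (m.1, m.2.base)).2

/-- The family of slopes of a family of maps of the plane. -/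
def famP (φ : E × Plane → Plane) : E × Pt → ℝ := fun m => slope (fun q => φ (m.1, q)) m.2

/-- The family of first prolongations of a family of maps of the plane. -/
def famLift (φ : E × Plane → Plane) : E × Pt → Pt := fun m => lift₁ (fun q => φ (m.1, q)) m.2

/-- The family of equations which are mapped to a family of equations by a family of maps. -/
def famPull (φ : E × Plane → Plane) (g : E × Pt → ℝ) : E × Pt → ℝ := fun m =>
  pull (fun q => φ (m.1, q)) (fun w => g (m.1, w)) m.2

/-- A smooth family of maps of the plane, regular at the point `m.2` for the parameter `m.1`. -/
structure IsRegularFamily (φ : E × Plane → Plane) (m : E × Pt) : Prop where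
  smooth : SmoothNear φ (m.1, m.2.base)
  regular : IsRegular (fun q => φ (m.1, q)) m.2

theorem contDiff_param_base : ContDiff ℝ ∞ fun m : E × Pt => (m.1, m.2.base) :=
  contDiff_fst.prodMk (contDiff_base.comp contDiff_snd)

theorem SmoothNear.comp_param_base (h : SmoothNear φ (m.1, m.2.base)) :
    SmoothNear (fun m : E × Pt => φ (m.1, m.2.base)) m :=
  SmoothNear.comp (f := fun m : E × Pt => (m.1, m.2.base)) h
    (ContDiff.smoothNear contDiff_param_base m)

theorem smoothNear_famX (h : SmoothNear φ (m.1, m.2.base)) : SmoothNear (famX φ) m :=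
  h.comp_param_base.fst

theorem smoothNear_famY (h : SmoothNear φ (m.1, m.2.base)) : SmoothNear (famY φ) m :=
  h.comp_param_base.snd

theorem IsRegularFamily.smoothNear_famP (h : IsRegularFamily φ m) : SmoothNear (famP φ) m :=
  (familyOp_Dx.smooth _ m (smoothNear_famY h.smooth)).div
    (familyOp_Dx.smooth _ m (smoothNear_famX h.smooth)) h.regular.ne

theorem IsRegularFamily.smoothNear_famLift (h : IsRegularFamily φ m) :
    SmoothNear (famLift φ) m :=
  (smoothNear_famX h.smooth).prodMk ((smoothNear_famY h.smooth).prodMk h.smoothNear_famP)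

theorem IsRegularFamily.smoothNear_famPull (h : IsRegularFamily φ m)
    (hg : SmoothNear g (m.1, famLift φ m)) : SmoothNear (famPull φ g) m :=
  (((SmoothNear.comp (f := fun m : E × Pt => (m.1, famLift φ m)) hg
    ((ContDiff.smoothNear contDiff_fst m).prodMk h.smoothNear_famLift)).mul
    (familyOp_Dx.smooth _ m (smoothNear_famX h.smooth))).sub
      (familyOp_Dx.smooth _ m h.smoothNear_famP)).div
    (familyOp_pdp.smooth _ m h.smoothNear_famP) h.regular.pdp_slope_ne

theorem IsRegularFamily.eventually (h : IsRegularFamily φ m) :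
    ∀ᶠ m' in 𝓝 m, IsRegularFamily φ m' := by
  obtain ⟨A, hA⟩ := h.regular.inv
  have hb := (contDiff_param_base (E := E)).continuous.continuousAt (x := m)
  have hs : ∀ᶠ m' : E × Pt in 𝓝 m, SmoothNear φ (m'.1, m'.2.base) :=
    hb.eventually h.smooth.eventually
  have hd : ∀ m' : E × Pt, SmoothNear φ (m'.1, m'.2.base) →
      fderiv ℝ (fun q => φ (m'.1, q)) m'.2.base =
        (fderiv ℝ φ (m'.1, m'.2.base)).comp (ContinuousLinearMap.inr ℝ E Plane) := fun m' hm' =>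
    ((hm'.differentiableAt.hasFDerivAt (x := (m'.1, m'.2.base))).comp m'.2.base
      (hasFDerivAt_prodMk_right m'.1 m'.2.base)).fderiv
  have h1 : ∀ᶠ m' : E × Pt in 𝓝 m, ((fderiv ℝ φ (m'.1, m'.2.base)).comp
      (ContinuousLinearMap.inr ℝ E Plane)).IsInvertible := by
    have hc : ContinuousAt (fun m' : E × Pt => (fderiv ℝ φ (m'.1, m'.2.base)).comp
        (ContinuousLinearMap.inr ℝ E Plane)) m :=
      ((h.smooth.fderiv.contDiffAt.continuousAt).comp_of_eq hb rfl).clm_comp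
        continuousAt_const
    refine hc.eventually (p := fun B => B.IsInvertible) ?_
    change ∀ᶠ B in 𝓝 ((fderiv ℝ φ (m.1, m.2.base)).comp
      (ContinuousLinearMap.inr ℝ E Plane)), B.IsInvertible
    rw [← hd m h.smooth, ← hA]
    exact ContinuousLinearEquiv.nhds A
  have h2 := (familyOp_Dx.smooth _ m (smoothNear_famX h.smooth)).contDiffAt.continuousAt.eventually_ne
    h.regular.ne
  filter_upwards [h1, h2, hs] with m' a b c
  refine ⟨c, ?_, by rwa [hd m' c], b⟩
  exact SmoothNear.comp (f := fun q : Plane => (m'.1, q)) c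
    ((SmoothNear.const m'.1 _).prodMk (ContDiff.smoothNear contDiff_id _))

/-- The vector field on the plane which generates the motion of the preimages of the points
under the family `φ`, as the parameter moves in the direction `τ`. -/
def velocity (φ : E × Plane → Plane) (e τ : E) : Plane → Plane := fun q =>
  -(fderiv ℝ (fun q => φ (e, q)) q).inverse (fderiv ℝ φ (e, q) (τ, 0))

theorem IsRegularFamily.smoothNear_velocity (h : IsRegularFamily φ m) (τ : E) :
    SmoothNear (velocity φ m.1 τ) m.2.base := by
  have hi : SmoothNear (fun q : Plane => (m.1, q)) m.2.base :=
    (SmoothNear.const m.1 _).prodMk (ContDiff.smoothNear contDiff_id _)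
  have h1 := h.regular.smooth.fderiv
  have hinv : SmoothNear (ContinuousLinearMap.inverse : (Plane →L[ℝ] Plane) → _)
      (fderiv ℝ (fun q => φ (m.1, q)) m.2.base) := by
    obtain ⟨A, hA⟩ := h.regular.inv
    rw [← hA]
    filter_upwards [ContinuousLinearEquiv.nhds A] with B hB
    exact ContinuousLinearMap.IsInvertible.contDiffAt_map_inverse hB
  have h2 := hinv.comp h1
  have h3 : SmoothNear (fun q : Plane => fderiv ℝ φ (m.1, q)) m.2.base :=
    SmoothNear.comp (f := fun q : Plane => (m.1, q)) h.smooth.fderiv hi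
  filter_upwards [h2, h3] with q a b
  exact (a.clm_apply (b.clm_apply contDiffAt_const)).neg

theorem fderiv_param_add_lie {F : E × Pt → ℝ} (hF : DifferentiableAt ℝ F m) (τ : E)
    (V : Plane → Plane) :
    fderiv ℝ F m (τ, (coefa V m.2, coefb V m.2, coefA V m.2)) =
      dirDeriv (τ, (0 : Pt)) F m + lie V (fun w => F (m.1, w)) m.2 := by
  have h := parOp_dirDeriv_apply hF (coefa V m.2, coefb V m.2, coefA V m.2)
  have e : ((τ, (coefa V m.2, coefb V m.2, coefA V m.2)) : E × Pt) =
      (τ, 0) + (0, (coefa V m.2, coefb V m.2, coefA V m.2)) := by simp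
  rw [e, map_add, lie_eq_fderiv]
  exact congrArg _ h.symm

/-- By definition the differential of `φ` sends the velocity to minus the parameter derivative. Only
the plane components of the prolonged velocity matter, since these functions do not involve `p`. -/
theorem IsRegularFamily.dirDeriv_famXY (h : IsRegularFamily φ m) (τ : E) :
    dirDeriv (τ, (0 : Pt)) (famX φ) m =
      -lie (velocity φ m.1 τ) (fun w => famX φ (m.1, w)) m.2 ∧
    dirDeriv (τ, (0 : Pt)) (famY φ) m =
      -lie (velocity φ m.1 τ) (fun w => famY φ (m.1, w)) m.2 := by
  have hφ := h.smooth.differentiableAt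
  have hb : HasFDerivAt (fun m : E × Pt => (m.1, m.2.base))
      (fderiv ℝ (fun m : E × Pt => (m.1, m.2.base)) m) m :=
    (contDiff_param_base.differentiable (by simp) m).hasFDerivAt
  have hb0 : fderiv ℝ (fun m : E × Pt => (m.1, m.2.base)) m (τ, 0) = (τ, 0) := by
    have : (fun m : E × Pt => (m.1, m.2.base)) = ((ContinuousLinearMap.id ℝ E).prodMap
        ((ContinuousLinearMap.fst ℝ ℝ (ℝ × ℝ)).prod ((ContinuousLinearMap.fst ℝ ℝ ℝ).comp
          (ContinuousLinearMap.snd ℝ ℝ (ℝ × ℝ)))) : E × Pt → E × Plane) := rfl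
    rw [this, ContinuousLinearMap.fderiv]
    simp
  have hc : fderiv ℝ (fun m : E × Pt => φ (m.1, m.2.base)) m = _ :=
    ((hφ.hasFDerivAt (x := (m.1, m.2.base))).comp m hb).fderiv
  have hd : DifferentiableAt ℝ (fun m : E × Pt => φ (m.1, m.2.base)) m :=
    h.smooth.comp_param_base.differentiableAt
  have hv : fderiv ℝ (fun q => φ (m.1, q)) m.2.base (velocity φ m.1 τ m.2.base) =
      -fderiv ℝ φ (m.1, m.2.base) (τ, 0) := by
    simp only [velocity, map_neg]
    rw [h.regular.inv.self_apply_inverse]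
  have hr := h.regular.smooth.differentiableAt
  have hX : fderiv ℝ (famX φ) m = _ := hd.hasFDerivAt.fst.fderiv
  have hY : fderiv ℝ (famY φ) m = _ := hd.hasFDerivAt.snd.fderiv
  simp only [dirDeriv, hX, hY, hc, lie_eq_fderiv]
  have e1 := dirDeriv_comp_base_fst hr (coefa (velocity φ m.1 τ) m.2,
    coefb (velocity φ m.1 τ) m.2, coefA (velocity φ m.1 τ) m.2)
  have e2 := dirDeriv_comp_base_snd hr (coefa (velocity φ m.1 τ) m.2,
    coefb (velocity φ m.1 τ) m.2, coefA (velocity φ m.1 τ) m.2)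
  have eb : Pt.base (coefa (velocity φ m.1 τ) m.2, coefb (velocity φ m.1 τ) m.2,
    coefA (velocity φ m.1 τ) m.2) = velocity φ m.1 τ m.2.base := rfl
  rw [eb, hv] at e1 e2
  constructor
  · refine Eq.trans ?_ (congrArg Neg.neg e1).symm
    simp [hb0]
  · refine Eq.trans ?_ (congrArg Neg.neg e2).symm
    simp [hb0]

end RegularFamilies

/-! ### The infinitesimal action of families on jets -/

section Action

variable {E : Type*} [NormedAddCommGroup E] [NormedSpace ℝ E] {φ : E × Plane → Plane}
  {g : E × Pt → ℝ} {m : E × Pt}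

theorem IsRegularFamily.eventually_slice (h : IsRegularFamily φ m) :
    ∀ᶠ w in 𝓝 m.2, IsRegularFamily φ (m.1, w) :=
  PointODE.eventually_slice h.eventually

theorem IsRegularFamily.dirDeriv_famP (h : IsRegularFamily φ m) (τ : E) :
    dirDeriv (τ, (0 : Pt)) (famP φ) m =
      -lie (velocity φ m.1 τ) (fun w => famP φ (m.1, w)) m.2 := by
  have hX := smoothNear_famX h.smooth
  have hY := smoothNear_famY h.smooth
  have hP := h.smoothNear_famP
  have hXD := familyOp_Dx.smooth _ m hX
  have e : (fun m => famP φ m * parOp Dx (famX φ) m) =ᶠ[𝓝 m] parOp Dx (famY φ) := by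
    filter_upwards [h.eventually] with m' hm' using slope_mul_Dx hm'.regular
  have e1 := (dirDeriv_congr e (τ, (0 : Pt))).self_of_nhds
  rw [dirDeriv_mul_apply hP.differentiableAt hXD.differentiableAt,
    (familyOp_Dx.comm _ m hX τ).self_of_nhds, (familyOp_Dx.comm _ m hY τ).self_of_nhds] at e1
  exact infinitesimal_slope (X := fun w => famX φ (m.1, w)) (Y := fun w => famY φ (m.1, w))
    (P := fun w => famP φ (m.1, w)) (X' := fun w => dirDeriv (τ, (0 : Pt)) (famX φ) (m.1, w))
    (Y' := fun w => dirDeriv (τ, (0 : Pt)) (famY φ) (m.1, w))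
    (P' := fun w => dirDeriv (τ, (0 : Pt)) (famP φ) (m.1, w))
    (h.smoothNear_velocity τ) hX.slice hY.slice hP.slice
    (congrFun (pdp_comp_base fun q => (φ (m.1, q)).1) m.2)
    (congrFun (pdp_comp_base fun q => (φ (m.1, q)).2) m.2) h.regular.ne
    (by filter_upwards [h.eventually_slice] with w hw using (hw.dirDeriv_famXY τ).1)
    (by filter_upwards [h.eventually_slice] with w hw using (hw.dirDeriv_famXY τ).2)
    (by filter_upwards [h.eventually_slice] with w hw using slope_mul_Dx hw.regular) e1

/-- Moving the parameter along `τ` and the point along the prolonged velocity keeps the image point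
fixed to first order: in each component the parameter derivative is minus the Lie derivative. -/
theorem IsRegularFamily.fderiv_famLift_velocity (h : IsRegularFamily φ m) (τ : E) :
    fderiv ℝ (famLift φ) m (τ, (coefa (velocity φ m.1 τ) m.2, coefb (velocity φ m.1 τ) m.2,
      coefA (velocity φ m.1 τ) m.2)) = 0 := by
  have hX := (smoothNear_famX h.smooth).differentiableAt
  have hY := (smoothNear_famY h.smooth).differentiableAt
  have hP := h.smoothNear_famP.differentiableAt
  have e : fderiv ℝ (famLift φ) m = _ :=
    (hX.hasFDerivAt.prodMk (hY.hasFDerivAt.prodMk hP.hasFDerivAt)).fderiv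
  rw [e]
  simp only [ContinuousLinearMap.prod_apply, fderiv_param_add_lie hX, fderiv_param_add_lie hY,
    fderiv_param_add_lie hP, h.dirDeriv_famP, (h.dirDeriv_famXY τ).1, (h.dirDeriv_famXY τ).2,
    neg_add_cancel]
  rfl

theorem IsRegularFamily.dirDeriv_comp_famLift (h : IsRegularFamily φ m)
    (hg : SmoothNear g (m.1, famLift φ m)) (τ : E)
    (hτ : dirDeriv (τ, (0 : Pt)) g (m.1, famLift φ m) = 0) :
    dirDeriv (τ, (0 : Pt)) (fun m => g (m.1, famLift φ m)) m =
      -lie (velocity φ m.1 τ) (fun w => g (m.1, famLift φ (m.1, w))) m.2 := by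
  have hi : HasFDerivAt (fun m : E × Pt => (m.1, famLift φ m)) _ m :=
    hasFDerivAt_fst.prodMk h.smoothNear_famLift.differentiableAt.hasFDerivAt
  have hc := (hg.differentiableAt.hasFDerivAt (x := (m.1, famLift φ m))).comp m hi
  have e : fderiv ℝ (fun m => g (m.1, famLift φ m)) m = _ := hc.fderiv
  have := fderiv_param_add_lie (F := fun m => g (m.1, famLift φ m)) hc.differentiableAt τ
    (velocity φ m.1 τ)
  rw [e] at this
  simp only [ContinuousLinearMap.comp_apply, ContinuousLinearMap.prod_apply,
    ContinuousLinearMap.coe_fst', h.fderiv_famLift_velocity τ] at this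
  have h0 : fderiv ℝ g (m.1, famLift φ m) (τ, 0) = 0 := hτ
  rw [h0] at this
  linarith

theorem IsRegularFamily.dirDeriv_famPull (h : IsRegularFamily φ m)
    (hg : SmoothNear g (m.1, famLift φ m)) (τ : E)
    (hτ : dirDeriv (τ, (0 : Pt)) g (m.1, famLift φ m) = 0) :
    dirDeriv (τ, (0 : Pt)) (famPull φ g) m =
      genFun (velocity φ m.1 τ) (fun w => famPull φ g (m.1, w)) m.2 := by
  have hX := smoothNear_famX h.smooth
  have hP := h.smoothNear_famP
  have hf := h.smoothNear_famPull hg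
  have hH : SmoothNear (fun m => g (m.1, famLift φ m)) m :=
    SmoothNear.comp (f := fun m : E × Pt => (m.1, famLift φ m)) hg
      ((ContDiff.smoothNear contDiff_fst m).prodMk h.smoothNear_famLift)
  have hXD := familyOp_Dx.smooth _ m hX
  have hPD := familyOp_Dx.smooth _ m hP
  have hPp := familyOp_pdp.smooth _ m hP
  have ep : ∀ m' : E × Pt, IsRegularFamily φ m' →
      famPull φ g m' * parOp pdp (famP φ) m' + parOp Dx (famP φ) m' =
        g (m'.1, famLift φ m') * parOp Dx (famX φ) m' := fun m' hm' => by
    have : famPull φ g m' * parOp pdp (famP φ) m' =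
        g (m'.1, famLift φ m') * parOp Dx (famX φ) m' - parOp Dx (famP φ) m' :=
      div_mul_cancel₀ _ hm'.regular.pdp_slope_ne
    rw [this, sub_add_cancel]
  have e : (fun m => famPull φ g m * parOp pdp (famP φ) m + parOp Dx (famP φ) m) =ᶠ[𝓝 m]
      fun m => g (m.1, famLift φ m) * parOp Dx (famX φ) m := by
    filter_upwards [h.eventually] with m' hm' using ep m' hm'
  have e1 := (dirDeriv_congr e (τ, (0 : Pt))).self_of_nhds
  rw [dirDeriv_add_apply (hf.mul hPp).differentiableAt hPD.differentiableAt,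
    dirDeriv_mul_apply hf.differentiableAt hPp.differentiableAt,
    dirDeriv_mul_apply hH.differentiableAt hXD.differentiableAt,
    (familyOp_Dx.comm _ m hX τ).self_of_nhds, (familyOp_Dx.comm _ m hP τ).self_of_nhds,
    (familyOp_pdp.comm _ m hP τ).self_of_nhds] at e1
  exact infinitesimal_genFun (X := fun w => famX φ (m.1, w)) (P := fun w => famP φ (m.1, w))
    (f := fun w => famPull φ g (m.1, w)) (H := fun w => g (m.1, famLift φ (m.1, w)))
    (X' := fun w => dirDeriv (τ, (0 : Pt)) (famX φ) (m.1, w))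
    (P' := fun w => dirDeriv (τ, (0 : Pt)) (famP φ) (m.1, w))
    (H' := fun w => dirDeriv (τ, (0 : Pt)) (fun m => g (m.1, famLift φ m)) (m.1, w))
    (f' := fun w => dirDeriv (τ, (0 : Pt)) (famPull φ g) (m.1, w))
    (h.smoothNear_velocity τ) hX.slice hP.slice hf.slice hH.slice
    (congrFun (pdp_comp_base fun q => (φ (m.1, q)).1) m.2) h.regular.pdp_slope_ne
    (by filter_upwards [h.eventually_slice] with w hw using (hw.dirDeriv_famXY τ).1)
    (by filter_upwards [h.eventually_slice] with w hw using hw.dirDeriv_famP τ)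
    (h.dirDeriv_comp_famLift hg τ hτ)
    (by filter_upwards [h.eventually_slice] with w hw using ep _ hw) e1

/-- The jets at the points `Z e` of the equations which are mapped to `g` by the family `φ`. -/
def jetFamily (k : ℕ) (φ : E × Plane → Plane) (g : E × Pt → ℝ) (Z : E → Pt) : E → Jet k :=
  fun e => jetOf k (fun w => famPull φ g (e, w)) (Z e)

variable {Z : E → Pt} {e : E} {k : ℕ}

theorem smoothNear_jetFamily (hZ : SmoothNear Z e) (h : IsRegularFamily φ (e, Z e))
    (hg : SmoothNear g (e, famLift φ (e, Z e))) : SmoothNear (jetFamily k φ g Z) e := by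
  have hi : SmoothNear (fun e => (e, Z e)) e := (ContDiff.smoothNear contDiff_id e).prodMk hZ
  refine hZ.prodMk (SmoothNear.pi fun ζ => ?_)
  exact SmoothNear.comp (f := fun e => (e, Z e))
    ((familyOp_partialDeriv ζ.1).smooth _ _ (h.smoothNear_famPull hg)) hi

/-- A point with stationary image must move with the prolonged velocity, because the differential of
the first prolongation is injective. -/
theorem fderiv_preimage (hZ : SmoothNear Z e) (h : IsRegularFamily φ (e, Z e)) {τ : E}
    (hY : fderiv ℝ (fun e => famLift φ (e, Z e)) e τ = 0) :
    fderiv ℝ Z e τ = (coefa (velocity φ e τ) (Z e), coefb (velocity φ e τ) (Z e),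
      coefA (velocity φ e τ) (Z e)) := by
  have hL := h.smoothNear_famLift.differentiableAt.hasFDerivAt
  have hi : HasFDerivAt (fun e => (e, Z e)) _ e :=
    (hasFDerivAt_id e).prodMk hZ.differentiableAt.hasFDerivAt
  have hc : fderiv ℝ (fun e => famLift φ (e, Z e)) e = _ := (HasFDerivAt.comp (f := fun e => (e, Z e)) e hL hi).fderiv
  have hs : fderiv ℝ (lift₁ fun q => φ (e, q)) (Z e) =
      (fderiv ℝ (famLift φ) (e, Z e)).comp (ContinuousLinearMap.inr ℝ E Pt) :=
    (hL.comp (Z e) (hasFDerivAt_prodMk_right e (Z e))).fderiv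
  rw [hc] at hY
  have hv := h.fderiv_famLift_velocity τ
  apply h.regular.fderiv_lift₁_injective
  simp only at hs ⊢
  rw [hs]
  have hY' : fderiv ℝ (famLift φ) (e, Z e) (τ, fderiv ℝ Z e τ) = 0 := hY
  have h1 := hY'.trans hv.symm
  simp only at h1
  have d : ∀ v : Pt, ((τ, v) : E × Pt) = (τ, 0) + (0, v) := fun v => by simp
  rw [d (fderiv ℝ Z e τ), d (coefa (velocity φ e τ) (Z e), coefb (velocity φ e τ) (Z e),
    coefA (velocity φ e τ) (Z e)), map_add, map_add] at h1
  exact add_left_cancel h1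

/-- Differentiation of the jets of the preimages of a fixed equation under a family of point
transformations yields a prolonged field. -/
theorem fderiv_jetFamily (hZ : SmoothNear Z e) (h : IsRegularFamily φ (e, Z e))
    (hg : SmoothNear g (e, famLift φ (e, Z e))) {τ : E}
    (hτ : ∀ m, dirDeriv (τ, (0 : Pt)) g m = 0)
    (hY : fderiv ℝ (fun e => famLift φ (e, Z e)) e τ = 0) :
    fderiv ℝ (jetFamily k φ g Z) e τ = prolongVec (jetFamily k φ g Z e) (velocity φ e τ) := by
  have hf := h.smoothNear_famPull hg
  have hfs := hf.slice
  have hV := h.smoothNear_velocity τ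
  have hZ' := fderiv_preimage hZ h hY
  have hi : HasFDerivAt (fun e => (e, Z e)) _ e :=
    (hasFDerivAt_id e).prodMk hZ.differentiableAt.hasFDerivAt
  have hζ : ∀ ζ : JetIdx k, HasFDerivAt
      (fun e => parOp (partialDeriv ζ.1) (famPull φ g) (e, Z e)) _ e := fun ζ =>
    HasFDerivAt.comp (f := fun e => (e, Z e)) e
      ((familyOp_partialDeriv ζ.1).smooth _ _ hf).differentiableAt.hasFDerivAt hi
  have hd : fderiv ℝ (jetFamily k φ g Z) e = _ :=
    (hZ.differentiableAt.hasFDerivAt.prodMk (hasFDerivAt_pi.2 hζ)).fderiv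
  rw [hd]
  have hp := prolongVec_jetOf (k := k) hfs hV
  refine Eq.trans ?_ hp.symm
  refine Prod.ext hZ' (funext fun ζ => ?_)
  have h1 := fderiv_param_add_lie
    ((familyOp_partialDeriv ζ.1).smooth _ _ hf).differentiableAt τ (velocity φ e τ)
  have h2 := ((familyOp_partialDeriv ζ.1).comm _ _ hf τ).self_of_nhds
  have hge : ∀ᶠ m' in 𝓝 (e, Z e), SmoothNear g (m'.1, famLift φ m') := by
    have hc : ContinuousAt (fun m' : E × Pt => (m'.1, famLift φ m')) (e, Z e) :=
      continuousAt_fst.prodMk h.smoothNear_famLift.contDiffAt.continuousAt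
    exact hc.eventually hg.eventually
  -- This identity holds on a neighbourhood in the slice, so `∂^ζ` may be applied to it. The motion
  -- of the base point `Z e` supplies the remaining transport terms of the prolongation.
  have h3 : (fun w => dirDeriv (τ, (0 : Pt)) (famPull φ g) (e, w)) =ᶠ[𝓝 (Z e)]
      genFun (velocity φ e τ) (fun w => famPull φ g (e, w)) := by
    filter_upwards [h.eventually_slice, PointODE.eventually_slice hge] with w hw hgw
    exact hw.dirDeriv_famPull hgw τ (hτ _)
  have h4 := (partialDeriv_congr h3 ζ.1).self_of_nhds
  have ex := (partialDeriv_dirDeriv hfs ζ.1 (1, 0, 0)).self_of_nhds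
  have ey := (partialDeriv_dirDeriv hfs ζ.1 (0, 1, 0)).self_of_nhds
  have ep := (partialDeriv_dirDeriv hfs ζ.1 (0, 0, 1)).self_of_nhds
  simp only [← pdx_eq, ← pdy_eq, ← pdp_eq] at ex ey ep
  refine Eq.trans ?_ (partialDeriv_prolongFun hV hfs ζ.1).symm
  change fderiv ℝ (parOp (partialDeriv ζ.1) (famPull φ g)) (e, Z e) (τ, fderiv ℝ Z e τ) = _
  rw [ex, ey, ep, ← h4, hZ']
  refine h1.trans ?_
  rw [h2]
  simp only [lie, parOp]
  ring

end Action

/-- The smooth inverse function theorem, with smoothness on the whole source and target. -/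
theorem exists_localDiffeo {E F : Type*} [NormedAddCommGroup E] [NormedSpace ℝ E]
    [CompleteSpace E] [NormedAddCommGroup F] [NormedSpace ℝ F] {f : E → F} {a : E}
    (hf : SmoothNear f a) (h : (fderiv ℝ f a).IsInvertible) :
    ∃ ψ : OpenPartialHomeomorph E F, a ∈ ψ.source ∧ (ψ : E → F) = f ∧
      (∀ x ∈ ψ.source, SmoothNear f x ∧ (fderiv ℝ f x).IsInvertible) ∧
      ∀ y ∈ ψ.target, ContDiffAt ℝ ∞ ψ.symm y := by
  obtain ⟨A, hA⟩ := h
  have hinv : ∀ᶠ x in 𝓝 a, (fderiv ℝ f x).IsInvertible :=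
    hf.fderiv.contDiffAt.continuousAt.eventually
      (show ∀ᶠ B in 𝓝 (fderiv ℝ f a), B.IsInvertible by
        rw [← hA]; exact ContinuousLinearEquiv.nhds A)
  have hd : HasFDerivAt f (A : E →L[ℝ] F) a := hA ▸ hf.differentiableAt.hasFDerivAt
  obtain ⟨S, hS, hSo, haS⟩ := mem_nhds_iff.1 (hf.eventually.and hinv)
  -- The local inverse is afterwards restricted to `S`, where `f` is smooth with invertible
  -- differential, so that the inverse is smooth at every point of the target and not only at the
  -- image of `a`.
  let ψ₀ := hf.contDiffAt.toOpenPartialHomeomorph f hd (by simp)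
  have h₀ : a ∈ ψ₀.source := hf.contDiffAt.mem_toOpenPartialHomeomorph_source hd (by simp)
  have hc : (ψ₀ : E → F) = f := hf.contDiffAt.toOpenPartialHomeomorph_coe hd (by simp)
  refine ⟨ψ₀.restrOpen S hSo, ⟨h₀, haS⟩, hc, fun x hx => hS hx.2, fun y hy => ?_⟩
  have hy' := (ψ₀.restrOpen S hSo).map_target hy
  obtain ⟨h₁, B, hB⟩ := hS hy'.2
  refine (ψ₀.restrOpen S hSo).contDiffAt_symm (f₀' := B) hy ?_ ?_
  · change HasFDerivAt ψ₀ _ _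
    rw [hc, hB]
    exact h₁.differentiableAt.hasFDerivAt
  · change ContDiffAt ℝ ∞ ψ₀ _
    rw [hc]
    exact h₁.contDiffAt

theorem isInvertible_of_injective {E F : Type*} [NormedAddCommGroup E] [NormedSpace ℝ E]
    [FiniteDimensional ℝ E] [NormedAddCommGroup F] [NormedSpace ℝ F] [FiniteDimensional ℝ F]
    {A : E →L[ℝ] F} (h : Function.Injective A)
    (hd : Module.finrank ℝ E = Module.finrank ℝ F) : A.IsInvertible := by
  have hb : Function.Bijective (A : E →ₗ[ℝ] F) :=
    ⟨h, (LinearMap.injective_iff_surjective_of_finrank_eq_finrank hd).1 h⟩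
  exact ⟨(LinearEquiv.ofBijective (A : E →ₗ[ℝ] F) hb).toContinuousLinearEquiv, by ext; rfl⟩

theorem prolongVec_congr {k : ℕ} (θ : Jet k) {V W : Plane → Plane}
    (h : V =ᶠ[𝓝 θ.1.base] W) : prolongVec θ V = prolongVec θ W := by
  have hb : ∀ᶠ w in 𝓝 θ.1, V w.base = W w.base := eventually_base h
  have ha : coefa V =ᶠ[𝓝 θ.1] coefa W := by
    filter_upwards [hb] with w hw using congrArg Prod.fst hw
  have hb : coefb V =ᶠ[𝓝 θ.1] coefb W := by
    filter_upwards [hb] with w hw using congrArg Prod.snd hw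
  have hc : charFun V =ᶠ[𝓝 θ.1] charFun W := by
    filter_upwards [ha, hb] with w h₁ h₂
    simp only [charFun, h₁, h₂]
  have hA : coefA V =ᶠ[𝓝 θ.1] coefA W := Dx_congr hc
  have hg : genFun V θ.taylor =ᶠ[𝓝 θ.1] genFun W θ.taylor := by
    filter_upwards [ha, hb, hA, Dx_congr hA, Dx_congr ha, dirDeriv_congr hc (0, 1, 0)]
      with w h₁ h₂ h₃ h₄ h₅ h₆
    simp only [← pdy_eq] at h₆
    have h₄ : coefB₀ V w = coefB₀ W w := h₄
    simp only [genFun, coefB₁, h₁, h₂, h₃, h₄, h₅, h₆]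
  have e : ∀ ζ : ℕ × ℕ × ℕ, partialDeriv ζ (genFun V θ.taylor) θ.1 =
      partialDeriv ζ (genFun W θ.taylor) θ.1 := fun ζ => (partialDeriv_congr hg ζ).self_of_nhds
  simp only [prolongVec, e, ha.self_of_nhds, hb.self_of_nhds, hA.self_of_nhds]

theorem Dx_base_fst (w : Pt) : Dx (fun w => w.base.1) w = 1 := by
  have h := fderiv_comp_base (h := fun q => q.1) (z := w) differentiableAt_fst (1, w.2.2, 0)
  refine h.trans ?_
  rw [show (fun q : Plane => q.1) = ContinuousLinearMap.fst ℝ ℝ ℝ from rfl,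
    ContinuousLinearMap.fderiv]
  rfl

theorem Dx_base_snd (w : Pt) : Dx (fun w => w.base.2) w = w.2.2 := by
  have h := fderiv_comp_base (h := fun q => q.2) (z := w) differentiableAt_snd (1, w.2.2, 0)
  refine h.trans ?_
  rw [show (fun q : Plane => q.2) = ContinuousLinearMap.snd ℝ ℝ ℝ from rfl,
    ContinuousLinearMap.fderiv]
  rfl

theorem lift₁_id (w : Pt) : lift₁ (fun q => q) w = w := by
  refine Prod.ext rfl (Prod.ext rfl ?_)
  simp only [lift₁, slope, Dx_base_fst, Dx_base_snd, div_one]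

theorem isRegular_id (z : Pt) : IsRegular (fun q => q) z := by
  refine ⟨ContDiff.smoothNear contDiff_id _, ?_, ?_⟩
  · rw [fderiv_fun_id]
    exact ⟨ContinuousLinearEquiv.refl ℝ Plane, rfl⟩
  · rw [Dx_base_fst]
    exact one_ne_zero

theorem pull_id (g : Pt → ℝ) : pull (fun q => q) g = g := by
  have hs : slope (fun q => q) = fun w => w.2.2 :=
    funext fun w => congrArg (fun v : Pt => v.2.2) (lift₁_id w)
  funext w
  refine (isRegular_id w).pull_eq_of_lift₂ ?_
  have h0 : Dx (fun w => w.2.2) w = 0 := by rw [Dx_eq, pdx_p, pdy_p]; ring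
  simp only [lift₁_id, lift₂, hs, Dx_base_fst, pdp_p, h0]
  simp

/-! ### Deformation of a plane map along given fields -/

section Deformation

variable {k r : ℕ}

/-- The deformation `φ₀ ∘ (id + ∑ tᵢ Vᵢ)` of the map `φ₀`, as a family with parameters `t` and
an inert parameter. -/
def deform (k : ℕ) (φ₀ : Plane → Plane) (V : Fin r → Plane → Plane) :
    ((Fin r → ℝ) × Jet k) × Plane → Plane := fun m =>
  φ₀ (m.2 + ∑ i, m.1.1 i • V i m.2)

/-- The Taylor polynomials of the jets, as a family of functions. -/
def taylorFamily (k r : ℕ) : ((Fin r → ℝ) × Jet k) × Pt → ℝ := fun m => m.1.2.taylor m.2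

theorem contDiff_taylorFamily : ContDiff ℝ ∞ (taylorFamily k r) := by
  unfold taylorFamily Jet.taylor
  fun_prop

variable {φ₀ : Plane → Plane} {V : Fin r → Plane → Plane} {z₀ : Pt}

theorem deform_zero (θ : Jet k) (q : Plane) : deform k φ₀ V ((0, θ), q) = φ₀ q := by
  simp [deform]

theorem smoothNear_deform (h₀ : IsRegular φ₀ z₀) (hV : ∀ i, SmoothNear (V i) z₀.base)
    (θ : Jet k) : SmoothNear (deform k φ₀ V) ((0, θ), z₀.base) := by
  have hs : SmoothNear (fun m : ((Fin r → ℝ) × Jet k) × Plane => m.2 + ∑ i, m.1.1 i • V i m.2)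
      ((0, θ), z₀.base) := by
    have hVs : ∀ᶠ m in 𝓝 (((0, θ), z₀.base) : ((Fin r → ℝ) × Jet k) × Plane),
        ∀ i, ContDiffAt ℝ ∞ (V i) m.2 :=
      Filter.eventually_all.2 fun i => continuousAt_snd.eventually (hV i)
    filter_upwards [hVs] with m hm
    refine contDiffAt_snd.add (ContDiffAt.sum fun i _ => ?_)
    have h1 : ContDiffAt ℝ ∞ (fun m : ((Fin r → ℝ) × Jet k) × Plane => m.1.1 i) m := by fun_prop
    exact h1.smul ((hm i).comp m contDiffAt_snd)
  refine SmoothNear.comp (f := fun m : ((Fin r → ℝ) × Jet k) × Plane =>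
    m.2 + ∑ i, m.1.1 i • V i m.2) ?_ hs
  simpa using h₀.smooth

theorem isRegularFamily_deform (h₀ : IsRegular φ₀ z₀) (hV : ∀ i, SmoothNear (V i) z₀.base)
    (θ : Jet k) : IsRegularFamily (deform k φ₀ V) ((0, θ), z₀) := by
  refine ⟨smoothNear_deform h₀ hV θ, ?_⟩
  simpa only [deform_zero] using h₀

/-- At `t = 0` the parameter derivative is the differential of `φ₀` applied to `∑ τᵢ Vᵢ`; the
inverse differential in the velocity undoes it and the sign remains. -/
theorem velocity_deform (h₀ : IsRegular φ₀ z₀) (hV : ∀ i, SmoothNear (V i) z₀.base)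
    (θ : Jet k) (τ : Fin r → ℝ) :
    velocity (deform k φ₀ V) (0, θ) (τ, 0) =ᶠ[𝓝 z₀.base] fun q => -∑ i, τ i • V i q := by
  obtain ⟨A, hA⟩ := h₀.inv
  have hinv : ∀ᶠ q in 𝓝 z₀.base, (fderiv ℝ φ₀ q).IsInvertible :=
    h₀.smooth.fderiv.contDiffAt.continuousAt.eventually
      (show ∀ᶠ B in 𝓝 (fderiv ℝ φ₀ z₀.base), B.IsInvertible by
        rw [← hA]; exact ContinuousLinearEquiv.nhds A)
  have hs : ∀ᶠ q in 𝓝 z₀.base, SmoothNear (deform k φ₀ V) ((0, θ), q) :=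
    (Continuous.prodMk_right ((0, θ) : (Fin r → ℝ) × Jet k)).continuousAt.eventually
      (smoothNear_deform h₀ hV θ).eventually
  filter_upwards [hinv, hs, h₀.smooth.eventually] with q h₁ h₂ h₃
  have hd : fderiv ℝ (deform k φ₀ V) ((0, θ), q) (((τ, 0), 0) : ((Fin r → ℝ) × Jet k) × Plane) =
      fderiv ℝ φ₀ q (∑ i, τ i • V i q) := by
    have hl : HasDerivAt (fun s : ℝ => ((s • τ, θ), q)) ((τ, (0 : Jet k)), (0 : Plane)) 0 := by
      have := ((hasDerivAt_id (0 : ℝ)).smul_const τ)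
      simp only [one_smul] at this
      exact (this.prodMk (hasDerivAt_const _ _)).prodMk (hasDerivAt_const _ _)
    have e0 : (((0 : ℝ) • τ, θ), q) = (((0, θ), q) : ((Fin r → ℝ) × Jet k) × Plane) := by simp
    have h4 : HasFDerivAt (deform k φ₀ V) (fderiv ℝ (deform k φ₀ V) ((0, θ), q))
        (((0 : ℝ) • τ, θ), q) := by
      rw [e0]; exact h₂.differentiableAt.hasFDerivAt
    have h5 := h4.comp_hasDerivAt (0 : ℝ) hl
    have hl' : HasDerivAt (fun s : ℝ => q + s • ∑ i, τ i • V i q) (∑ i, τ i • V i q) 0 := by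
      simpa using ((hasDerivAt_id (0 : ℝ)).smul_const (∑ i, τ i • V i q)).const_add q
    have h6 : HasFDerivAt φ₀ (fderiv ℝ φ₀ q) (q + (0 : ℝ) • ∑ i, τ i • V i q) := by
      simpa using h₃.differentiableAt.hasFDerivAt
    have h7 := h6.comp_hasDerivAt (0 : ℝ) hl'
    refine h5.unique ?_
    convert h7 using 1
    funext s
    simp [deform, Finset.smul_sum, mul_smul]
  simp only [velocity]
  rw [hd]
  simp only [deform_zero]
  rw [h₁.inverse_apply_self]

end Deformation

/-- The local action of a family of point transformations on jets: for jets near `θ`, the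
derivatives in the direction of the parameters are the values of prolonged fields. -/
theorem exists_local_action {k r : ℕ} {φ₀ : Plane → Plane} {z₀ : Pt} (h₀ : IsRegular φ₀ z₀)
    {V : Fin r → Plane → Plane} (hV : ∀ i, SmoothNear (V i) z₀.base) {θ : Jet k}
    (hθ : θ.1 = lift₁ φ₀ z₀) :
    ∃ Φ : (Fin r → ℝ) × Jet k → Jet k, SmoothNear Φ (0, θ) ∧
      Φ (0, θ) = jetOf k (pull φ₀ θ.taylor) z₀ ∧
      (∀ᶠ e in 𝓝 (0, θ), (∀ τ : Fin r → ℝ, fderiv ℝ Φ e (τ, 0) ∈ orbitTangent (Φ e)) ∧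
        e.2 ∈ orbit (Φ e)) ∧
      (∀ τ : Fin r → ℝ, fderiv ℝ Φ (0, θ) (τ, 0) =
        prolongVec (Φ (0, θ)) (-∑ i, τ i • V i)) ∧
      ((∀ q, φ₀ q = q) → ∀ᶠ η in 𝓝 θ, Φ (0, η) = η) := by
  set φ := deform k φ₀ V with hφ
  set g := taylorFamily k r
  let e₀ : (Fin r → ℝ) × Jet k := (0, θ)
  have hreg : IsRegularFamily φ (e₀, z₀) := isRegularFamily_deform h₀ hV θ
  have hg : ∀ m, SmoothNear g m := fun m => ContDiff.smoothNear contDiff_taylorFamily m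
  -- Inverting `G` solves `lift₁ φ_e z = base point of η` for `z`, smoothly in `e = (t, η)`. The
  -- solution `Z e` is the base point of the jet `Φ e`, which is obtained by pulling back the Taylor
  -- polynomial of `η`.
  let G : ((Fin r → ℝ) × Jet k) × Pt → ((Fin r → ℝ) × Jet k) × Pt := fun m => (m.1, famLift φ m)
  have hG : SmoothNear G (e₀, z₀) :=
    (ContDiff.smoothNear contDiff_fst _).prodMk hreg.smoothNear_famLift
  have hφ0 : ∀ η : Jet k, (fun q => φ ((0, η), q)) = φ₀ := fun η =>
    funext fun q => deform_zero η q
  have hGz : G (e₀, z₀) = (e₀, θ.1) := by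
    refine Prod.ext rfl ?_
    change lift₁ (fun q => φ ((0, θ), q)) z₀ = θ.1
    rw [hφ0, hθ]
  have hinv : (fderiv ℝ G (e₀, z₀)).IsInvertible := by
    refine isInvertible_of_injective ?_ rfl
    have hL := hreg.smoothNear_famLift.differentiableAt.hasFDerivAt
    have hd : fderiv ℝ G (e₀, z₀) = _ := (hasFDerivAt_fst.prodMk hL).fderiv
    have hs : fderiv ℝ (lift₁ fun q => φ (e₀, q)) z₀ = _ :=
      (hL.comp z₀ (hasFDerivAt_prodMk_right e₀ z₀)).fderiv
    rw [injective_iff_map_eq_zero]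
    rintro ⟨a, v⟩ hv
    rw [hd] at hv
    have ha : a = 0 := congrArg Prod.fst hv
    subst ha
    have hv2 : fderiv ℝ (lift₁ fun q => φ (e₀, q)) z₀ v = 0 := by
      rw [hs]; exact congrArg Prod.snd hv
    have := hreg.regular.fderiv_lift₁_injective (hv2.trans (map_zero _).symm)
    rw [this]; rfl
  obtain ⟨ψ, hψ, hψG, -, hψs⟩ := exists_localDiffeo hG hinv
  let ι : (Fin r → ℝ) × Jet k → ((Fin r → ℝ) × Jet k) × Pt := fun e => (e, e.2.1)
  have hιc : ContDiff ℝ ∞ ι := by fun_prop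
  have hι₀ : ι e₀ = ψ (e₀, z₀) := by rw [hψG, hGz]
  have hιt : ∀ᶠ e in 𝓝 e₀, ι e ∈ ψ.target := by
    refine hιc.continuous.continuousAt.eventually (ψ.open_target.mem_nhds ?_)
    rw [hι₀]
    exact ψ.map_source hψ
  let Z : (Fin r → ℝ) × Jet k → Pt := fun e => (ψ.symm (ι e)).2
  have hZs : SmoothNear Z e₀ := by
    filter_upwards [hιt] with e he
    exact ((hψs _ he).comp e hιc.contDiffAt).snd
  have hZ₀ : Z e₀ = z₀ := by
    change (ψ.symm (ι e₀)).2 = z₀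
    rw [hι₀, ψ.left_inv hψ]
  have hZL : ∀ e, ι e ∈ ψ.target → famLift φ (e, Z e) = e.2.1 := fun e he => by
    have h1 := ψ.right_inv he
    rw [hψG] at h1
    have h2 : (ψ.symm (ι e)).1 = e := congrArg Prod.fst h1
    have h3 : famLift φ (ψ.symm (ι e)) = e.2.1 := congrArg Prod.snd h1
    have h4 : ψ.symm (ι e) = (e, Z e) := Prod.ext h2 rfl
    rwa [h4] at h3
  have hZe : ∀ᶠ e in 𝓝 e₀, (fun e => famLift φ (e, Z e)) =ᶠ[𝓝 e] fun e => e.2.1 := by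
    filter_upwards [hιt.eventually_nhds] with e he
    filter_upwards [he] with e' he' using hZL e' he'
  have hregZ : ∀ᶠ e in 𝓝 e₀, IsRegularFamily φ (e, Z e) := by
    have hc : ContinuousAt (fun e => (e, Z e)) e₀ :=
      continuousAt_id.prodMk hZs.contDiffAt.continuousAt
    refine hc.eventually (p := fun m => IsRegularFamily φ m) ?_
    change ∀ᶠ m in 𝓝 (e₀, Z e₀), _
    rw [hZ₀]
    exact hreg.eventually
  -- In the directions `(τ, 0)` neither the target equation nor its base point changes, so the
  -- derivative is the prolongation of the velocity, also for `t ≠ 0`.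
  have hder : ∀ᶠ e in 𝓝 e₀, ∀ τ : Fin r → ℝ, fderiv ℝ (jetFamily k φ g Z) e (τ, 0) =
      prolongVec (jetFamily k φ g Z e) (velocity φ e (τ, 0)) := by
    filter_upwards [hregZ, hZs.eventually, hZe] with e h₁ h₂ h₃ τ
    refine fderiv_jetFamily h₂ h₁ (hg _)
      (fun m => dirDeriv_eq_zero_of_invariant' fun t => ?_) ?_
    · simp [g, taylorFamily]
    · rw [h₃.fderiv_eq]
      have : (fun e : (Fin r → ℝ) × Jet k => e.2.1) = ((ContinuousLinearMap.fst ℝ Pt _).comp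
        (ContinuousLinearMap.snd ℝ (Fin r → ℝ) (Jet k)) : (Fin r → ℝ) × Jet k → Pt) := rfl
      rw [this, ContinuousLinearMap.fderiv]
      rfl
  refine ⟨jetFamily k φ g Z, smoothNear_jetFamily hZs hregZ.self_of_nhds (hg _), ?_, ?_, ?_, ?_⟩
  · change jetOf k (pull (fun q => φ ((0, θ), q)) θ.taylor) (Z e₀) = _
    rw [hφ0, hZ₀]
  · filter_upwards [hregZ, hder, hιt] with e h₁ h₂ h₃
    refine ⟨fun τ => ?_, ?_⟩
    · rw [h₂ τ]
      exact ⟨⟨_, h₁.smoothNear_velocity (τ, 0)⟩, rfl⟩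
    · obtain ⟨χ, hχ, hχφ, hχ₁, hχ₂⟩ := exists_localDiffeo h₁.regular.smooth h₁.regular.inv
      have hL := hZL e h₃
      refine ⟨χ, fun w => famPull φ g (e, w), e.2.taylor, ⟨fun q hq => ?_, fun q hq => ?_⟩,
        hχ, ?_, ?_, (h₁.smoothNear_famPull (hg _)).slice, smoothNear_taylor _ _, rfl,
        jetOf_taylor _, ?_⟩
      · rw [hχφ]
        exact (hχ₁ q hq).1.contDiffAt.contDiffWithinAt
      · exact (hχ₂ q hq).contDiffWithinAt
      · rw [hχφ]; exact h₁.regular.ne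
      · rw [hχφ]; exact hL
      · rw [hχφ]
        filter_upwards [h₁.eventually_slice] with w hw
        exact (hw.regular.lift₂_pull _).symm
  · intro τ
    rw [hder.self_of_nhds τ]
    refine prolongVec_congr _ ?_
    change velocity φ e₀ (τ, 0) =ᶠ[𝓝 (Z e₀).base] _
    rw [hZ₀]
    filter_upwards [velocity_deform h₀ hV θ τ] with q hq
    rw [hq]
    simp
  · intro hid
    have hid' : φ₀ = fun q => q := funext hid
    have hz : z₀ = θ.1 := by rw [hθ, hid', lift₁_id]
    have hc : Continuous fun η : Jet k => (((0, η), η.1) : ((Fin r → ℝ) × Jet k) × Pt) := by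
      fun_prop
    have hs : ∀ᶠ η : Jet k in 𝓝 θ, (((0, η), η.1) : ((Fin r → ℝ) × Jet k) × Pt) ∈ ψ.source := by
      refine hc.continuousAt.eventually (ψ.open_source.mem_nhds ?_)
      change (((0, θ), θ.1) : ((Fin r → ℝ) × Jet k) × Pt) ∈ ψ.source
      rw [← hz]; exact hψ
    filter_upwards [hs] with η hη
    have h1 : ψ ((0, η), η.1) = ι (0, η) := by
      rw [hψG]
      refine Prod.ext rfl ?_
      change lift₁ (fun q => φ ((0, η), q)) η.1 = η.1
      rw [hφ0, hid', lift₁_id]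
    have hZη : Z (0, η) = η.1 := by
      change (ψ.symm (ι (0, η))).2 = η.1
      rw [← h1, ψ.left_inv hη]
    change jetOf k (pull (fun q => φ ((0, η), q)) η.taylor) (Z (0, η)) = η
    rw [hφ0, hid', pull_id, hZη, jetOf_taylor]

/-- The joint map of finitely many linearly independent functionals is surjective. -/
theorem pi_surjective_of_linearIndependent {M ι : Type*} [NormedAddCommGroup M]
    [NormedSpace ℝ M] [Fintype ι] {f : ι → M →L[ℝ] ℝ} (h : LinearIndependent ℝ f) :
    Function.Surjective (ContinuousLinearMap.pi f) := by
  classical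
  have hr : LinearMap.range (LinearMap.pi fun i => (f i : M →ₗ[ℝ] ℝ)) = ⊤ := by
    by_contra hne
    obtain ⟨c, hc0, hc⟩ := Submodule.exists_le_ker_of_lt_top _ (lt_top_iff_ne_top.2 hne)
    apply hc0
    have hrel : ∑ i, c (fun j => if i = j then 1 else 0) • f i = 0 := by
      ext v
      have h1 : c (fun i => f i v) = 0 := hc ⟨v, rfl⟩
      rw [LinearMap.pi_apply_eq_sum_univ] at h1
      simpa [sum_apply, mul_comm] using h1
    have h2 := Fintype.linearIndependent_iff.1 h _ hrel
    refine LinearMap.pi_ext' fun i => LinearMap.ext_ring ?_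
    have e : (Pi.single i 1 : ι → ℝ) = fun j => if i = j then 1 else 0 :=
      funext fun j => by simp [Pi.single_apply, eq_comm]
    simpa [e] using h2 i
  exact LinearMap.range_eq_top.1 hr

/-- If the differential of `J` vanishes on the kernel of the differential of the submersion `I`,
then `J` is locally a smooth function of `I`. -/
theorem exists_local_factorization {M ι : Type*} [NormedAddCommGroup M] [NormedSpace ℝ M]
    [FiniteDimensional ℝ M] [Fintype ι] {I : M → ι → ℝ} {J : M → ℝ} {a : M}
    (hI : SmoothNear I a) (hJ : SmoothNear J a)
    (hs : Function.Surjective (fderiv ℝ I a))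
    (hker : ∀ᶠ x in 𝓝 a, ∀ v, fderiv ℝ I x v = 0 → fderiv ℝ J x v = 0)
    {S : Set M} (hS : S ∈ 𝓝 a) :
    ∃ W ⊆ S, IsOpen W ∧ a ∈ W ∧ ∃ (O : Set (ι → ℝ)) (F : (ι → ℝ) → ℝ), IsOpen O ∧
      ContDiffOn ℝ ∞ F O ∧ ∀ x ∈ W, I x ∈ O ∧ J x = F (I x) := by
  let K : Submodule ℝ M := LinearMap.ker (fderiv ℝ I a : M →ₗ[ℝ] ι → ℝ)
  obtain ⟨π₀, hπ₀⟩ := K.subtype.exists_leftInverse_of_injective K.ker_subtype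
  let π : M →L[ℝ] K := LinearMap.toContinuousLinearMap π₀
  have hπ : ∀ v : K, π v = v := fun v => LinearMap.congr_fun hπ₀ v
  -- A projection onto the kernel of the differential completes `I` to a chart.
  let G : M → (ι → ℝ) × K := fun x => (I x, π x)
  have hG : SmoothNear G a := hI.prodMk (ContDiff.smoothNear π.contDiff a)
  have hGd : fderiv ℝ G a = (fderiv ℝ I a).prod π :=
    (hI.differentiableAt.hasFDerivAt.prodMk π.hasFDerivAt).fderiv
  have hinv : (fderiv ℝ G a).IsInvertible := by
    refine isInvertible_of_injective ?_ ?_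
    · rw [injective_iff_map_eq_zero]
      intro v hv
      rw [hGd] at hv
      have h1 : fderiv ℝ I a v = 0 := congrArg Prod.fst hv
      have h2 : π v = 0 := congrArg Prod.snd hv
      have h3 := hπ ⟨v, h1⟩
      simp only [h2] at h3
      exact (congrArg Subtype.val h3).symm
    · have h1 := LinearMap.finrank_range_add_finrank_ker (fderiv ℝ I a : M →ₗ[ℝ] ι → ℝ)
      rw [LinearMap.range_eq_top.2 hs, finrank_top] at h1
      rw [Module.finrank_prod, h1]
  obtain ⟨ψ, hψ, hψG, -, hψs⟩ := exists_localDiffeo hG hinv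
  have hGa : ψ a = (I a, π a) := by rw [hψG]
  have hat : (I a, π a) ∈ ψ.target := hGa ▸ ψ.map_source hψ
  have hgood : ∀ᶠ y in 𝓝 (I a, π a), y ∈ ψ.target ∧ ψ.symm y ∈ S ∧
      SmoothNear J (ψ.symm y) ∧ SmoothNear I (ψ.symm y) ∧
      ∀ v, fderiv ℝ I (ψ.symm y) v = 0 → fderiv ℝ J (ψ.symm y) v = 0 := by
    have hc : Filter.Tendsto ψ.symm (𝓝 (I a, π a)) (𝓝 a) := by
      have := (ψ.symm.continuousAt (x := (I a, π a)) hat).tendsto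
      rwa [← hGa, ψ.left_inv hψ, hGa] at this
    filter_upwards [ψ.open_target.mem_nhds hat, hc.eventually hS,
      hc.eventually hJ.eventually, hc.eventually hI.eventually, hc.eventually hker]
      with y h₁ h₂ h₃ h₄ h₅ using ⟨h₁, h₂, h₃, h₄, h₅⟩
  obtain ⟨ε, hε, hball⟩ := Metric.eventually_nhds_iff_ball.1 hgood
  rw [← ball_prod_same] at hball
  -- In the chart the first coordinate is `I`, so directions along `K` lie in the kernel of its
  -- differential and `J` has zero derivative along them. The slices are balls, hence convex, and
  -- `J` is constant on each.
  have hconst : ∀ y ∈ Metric.ball (I a) ε, ∀ u ∈ Metric.ball (π a) ε,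
      J (ψ.symm (y, u)) = J (ψ.symm (y, π a)) := by
    intro y hy u hu
    have hd : ∀ u ∈ Metric.ball (π a) ε,
        HasFDerivAt (fun u => J (ψ.symm (y, u))) (0 : K →L[ℝ] ℝ) u := by
      intro u hu
      obtain ⟨h₁, -, h₃, h₄, h₅⟩ := hball (y, u) ⟨hy, hu⟩
      have hsymm := ((hψs _ h₁).differentiableAt (by simp)).hasFDerivAt
      have hin := hsymm.comp u (hasFDerivAt_prodMk_right y u)
      have hJd := HasFDerivAt.comp (f := fun u => ψ.symm (y, u)) u
        h₃.differentiableAt.hasFDerivAt hin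
      have hId := HasFDerivAt.comp (f := fun u => ψ.symm (y, u)) u
        h₄.differentiableAt.hasFDerivAt hin
      have hIc : (fun u => I (ψ.symm (y, u))) =ᶠ[𝓝 u] fun _ => y := by
        have ht : ∀ᶠ u' in 𝓝 u, (y, u') ∈ ψ.target :=
          (Continuous.prodMk_right y).continuousAt.eventually (ψ.open_target.mem_nhds h₁)
        filter_upwards [ht] with u' hu'
        have := ψ.right_inv hu'
        rw [hψG] at this
        exact congrArg Prod.fst this
      have hI0 := hId.unique ((hasFDerivAt_const y u).congr_of_eventuallyEq hIc)
      exact hJd.congr_fderiv (ContinuousLinearMap.ext fun v =>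
        h₅ _ (congrArg (fun L : K →L[ℝ] ι → ℝ => L v) hI0))
    refine (convex_ball (π a) ε).is_const_of_fderivWithin_eq_zero (𝕜 := ℝ)
      (fun u hu => (hd u hu).differentiableAt.differentiableWithinAt) (fun u hu => ?_) hu
      (Metric.mem_ball_self hε)
    rw [fderivWithin_of_isOpen Metric.isOpen_ball hu]
    exact (hd u hu).fderiv
  refine ⟨ψ.source ∩ ψ ⁻¹' (Metric.ball (I a) ε ×ˢ Metric.ball (π a) ε), ?_,
    ψ.isOpen_inter_preimage (Metric.isOpen_ball.prod Metric.isOpen_ball), ⟨hψ, ?_⟩,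
    Metric.ball (I a) ε, fun y => J (ψ.symm (y, π a)), Metric.isOpen_ball, ?_, ?_⟩
  · rintro x ⟨hx, hx'⟩
    have := (hball _ hx').2.1
    rwa [ψ.left_inv hx] at this
  · change ψ a ∈ Metric.ball (I a) ε ×ˢ Metric.ball (π a) ε
    rw [hGa]
    exact ⟨Metric.mem_ball_self hε, Metric.mem_ball_self hε⟩
  · intro y hy
    obtain ⟨h₁, -, h₃, -⟩ := hball (y, π a) ⟨hy, Metric.mem_ball_self hε⟩
    have hp : ContDiffAt ℝ ∞ (fun y : ι → ℝ => (y, π a)) y := contDiffAt_id.prodMk contDiffAt_const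
    exact (ContDiffAt.comp (f := fun y : ι → ℝ => ψ.symm (y, π a)) y h₃.contDiffAt
      ((hψs _ h₁).comp y hp)).contDiffWithinAt
  · rintro x ⟨hx, hx'⟩
    have e : ψ x = (I x, π x) := by rw [hψG]
    have hx'' : (I x, π x) ∈ Metric.ball (I a) ε ×ˢ Metric.ball (π a) ε := e ▸ hx'
    refine ⟨hx''.1, ?_⟩
    change J x = J (ψ.symm (I x, π a))
    rw [← hconst _ hx''.1 _ hx''.2, ← e, ψ.left_inv hx]

/-! ### Existence and completeness of differential invariants -/

section Invariants

variable {k : ℕ}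

theorem IsInvariantOn.mono {U W : Set (Jet k)} {I : Jet k → ℝ} (h : IsInvariantOn U I)
    (hW : W ⊆ U) : IsInvariantOn W I :=
  ⟨h.1.mono hW, fun θ hθ => h.2 θ (hW hθ)⟩

theorem IsInvariantOn.smoothNear {U : Set (Jet k)} {I : Jet k → ℝ} (h : IsInvariantOn U I)
    (hU : IsOpen U) {θ : Jet k} (hθ : θ ∈ U) : SmoothNear I θ := by
  filter_upwards [hU.mem_nhds hθ] with η hη using h.1.contDiffAt (hU.mem_nhds hη)

/-- Invariants with independent differentials are basic when their number is the codimension of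
the orbits. -/
theorem exists_isBasicFamily {ι : Type} [Fintype ι] {U : Set (Jet k)} (hU : IsOpen U)
    {I : ι → Jet k → ℝ} (hI : ∀ i, IsInvariantOn U (I i))
    (hrank : ∀ θ ∈ U, Module.finrank ℝ (orbitTangent θ) + Fintype.card ι =
      Module.finrank ℝ (Jet k))
    {θ₀ : Jet k} (hθ₀ : θ₀ ∈ U) (hli : LinearIndependent ℝ fun i => fderiv ℝ (I i) θ₀) :
    ∃ U' ⊆ U, θ₀ ∈ U' ∧ IsBasicFamily U' I := by
  have hev : ∀ᶠ θ in 𝓝 θ₀, LinearIndependent ℝ fun i => fderiv ℝ (I i) θ := by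
    have hc : ContinuousAt (fun θ i => fderiv ℝ (I i) θ) θ₀ := continuousAt_pi.2 fun i =>
      ((hI i).smoothNear hU hθ₀).fderiv.contDiffAt.continuousAt
    exact hc.eventually hli.eventually
  obtain ⟨U', hU'U, hU'o, hθ₀'⟩ := mem_nhds_iff.1 (hev.and (hU.mem_nhds hθ₀))
  refine ⟨U', fun θ hθ => (hU'U hθ).2, hθ₀', hU'o, fun i => (hI i).mono fun θ hθ => (hU'U hθ).2,
    fun θ hθ => (hU'U hθ).1, ?_⟩
  intro W hWU hWo J hJ θ hθ
  have hsm : ∀ η ∈ U, ∀ i, SmoothNear (I i) η := fun η hη i => (hI i).smoothNear hU hη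
  have hpi : ∀ η ∈ U, fderiv ℝ (fun η i => I i η) η =
      ContinuousLinearMap.pi fun i => fderiv ℝ (I i) η := fun η hη =>
    (hasFDerivAt_pi.2 fun i => (hsm η hη i).differentiableAt.hasFDerivAt).fderiv
  obtain ⟨W', hW', hW'o, hθW', O, F, hO, hF, h⟩ := exists_local_factorization
    (I := fun η i => I i η) (J := J) (SmoothNear.pi (hsm θ (hU'U (hWU hθ)).2))
    (hJ.smoothNear hWo hθ)
    (by
      rw [hpi θ (hU'U (hWU hθ)).2]
      exact pi_surjective_of_linearIndependent (hU'U (hWU hθ)).1)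
    (by
      filter_upwards [hWo.mem_nhds hθ] with η hη v hv
      obtain ⟨hη₁, hη₂⟩ := hU'U (hWU hη)
      rw [hpi η hη₂] at hv
      have hle : orbitTangent η ≤ LinearMap.ker
          (ContinuousLinearMap.pi fun i => fderiv ℝ (I i) η : Jet k →ₗ[ℝ] ι → ℝ) := by
        rintro _ ⟨V, rfl⟩
        exact funext fun i => (hI i).2 η hη₂ V
      have hd := LinearMap.finrank_range_add_finrank_ker
        (ContinuousLinearMap.pi fun i => fderiv ℝ (I i) η : Jet k →ₗ[ℝ] ι → ℝ)
      rw [LinearMap.range_eq_top.2 (pi_surjective_of_linearIndependent hη₁), finrank_top,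
        Module.finrank_fintype_fun_eq_card] at hd
      have hr := hrank η hη₂
      -- Equal dimensions make the tangent space of the orbit the whole common kernel of the
      -- differentials, and an invariant `J` is stationary on it by definition.
      have heq := Submodule.eq_of_le_of_finrank_eq hle (by omega)
      have hv' : v ∈ orbitTangent η := by
        rw [heq]; exact hv
      obtain ⟨V, rfl⟩ := hv'
      exact hJ.2 η hη V)
    (hWo.mem_nhds hθ)
  exact ⟨W', hW', hW'o, hθW', O, F, hO, hF, h⟩

/-- Near a point around which the orbits have constant dimension, every functional which
annihilates the tangent space of the orbit is the differential of an invariant. -/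
theorem exists_invariants {θ₀ : Jet k} {r : ℕ}
    (hr : ∀ᶠ θ in 𝓝 θ₀, Module.finrank ℝ (orbitTangent θ) = r) :
    ∃ U, IsOpen U ∧ θ₀ ∈ U ∧ (∀ θ ∈ U, Module.finrank ℝ (orbitTangent θ) = r) ∧
      ∀ α : Jet k →L[ℝ] ℝ, (∀ v ∈ orbitTangent θ₀, α v = 0) →
        ∃ I, IsInvariantOn U I ∧ fderiv ℝ I θ₀ = α := by
  let b := Module.finBasisOfFinrankEq ℝ (orbitTangent θ₀) hr.self_of_nhds
  choose V hV using fun i => (b i).2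
  obtain ⟨C, hC⟩ := Submodule.exists_isCompl (orbitTangent θ₀)
  obtain ⟨Φ, hΦs, -, hΦt, hΦ₀, hΦid⟩ := exists_local_action (isRegular_id θ₀.1)
    (V := fun i => (V i).1) (fun i => (V i).2) (lift₁_id θ₀.1).symm
  have hid : ∀ᶠ η in 𝓝 θ₀, Φ (0, η) = η := hΦid fun q => rfl
  let j : (Fin r → ℝ) × C →L[ℝ] (Fin r → ℝ) × Jet k :=
    (ContinuousLinearMap.id ℝ (Fin r → ℝ)).prodMap C.subtypeL
  let e : (Fin r → ℝ) × C → (Fin r → ℝ) × Jet k := fun x => (0, θ₀) + j x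
  have he : ∀ x, HasFDerivAt e j x := fun x => j.hasFDerivAt.const_add _
  have hes : ∀ x, SmoothNear e x := fun x =>
    ContDiff.smoothNear (contDiff_const.add j.contDiff) x
  have he0 : e 0 = (0, θ₀) := by simp [e]
  -- The chart moves the transversal `θ₀ + C` by the local action. Its differential at zero is minus
  -- the basis of the tangent space in the first variables and the inclusion of `C` in the second.
  let Ψ : (Fin r → ℝ) × C → Jet k := fun x => Φ (e x)
  have hΨs : SmoothNear Ψ 0 := SmoothNear.comp (f := e) (by rwa [he0]) (hes 0)
  have hΨd : ∀ x, DifferentiableAt ℝ Φ (e x) → fderiv ℝ Ψ x = (fderiv ℝ Φ (e x)).comp j :=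
    fun x hx => (HasFDerivAt.comp x hx.hasFDerivAt (he x)).fderiv
  have hΨ0 : Ψ 0 = θ₀ := by
    change Φ (e 0) = θ₀
    rw [he0]; exact hid.self_of_nhds
  have hder : ∀ v : (Fin r → ℝ) × C, fderiv ℝ Ψ 0 v =
      -((∑ i, v.1 i • b i : orbitTangent θ₀) : Jet k) + v.2 := by
    intro v
    have hd : DifferentiableAt ℝ Φ (e 0) := by rw [he0]; exact hΦs.differentiableAt
    rw [hΨd 0 hd, he0]
    have h1 : j v = (v.1, 0) + (0, (v.2 : Jet k)) := by
      rw [Prod.mk_add_mk, add_zero, zero_add]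
      rfl
    have h2 : fderiv ℝ Φ (0, θ₀) (0, (v.2 : Jet k)) = v.2 := by
      have h3 := hΦs.differentiableAt.hasFDerivAt.comp θ₀ (hasFDerivAt_prodMk_right 0 θ₀)
      have h4 := h3.unique ((hasFDerivAt_id θ₀).congr_of_eventuallyEq hid)
      exact congrArg (fun L : Jet k →L[ℝ] Jet k => L v.2) h4
    have h5 : fderiv ℝ Φ (0, θ₀) (v.1, 0) =
        -((∑ i, v.1 i • b i : orbitTangent θ₀) : Jet k) := by
      rw [hΦ₀, hid.self_of_nhds]
      have h6 : (-∑ i, v.1 i • (V i).1 : Plane → Plane) =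
          ((-∑ i, v.1 i • V i : localFields θ₀.1.base) : Plane → Plane) := by simp
      rw [h6]
      change prolong θ₀ (-∑ i, v.1 i • V i) = _
      rw [map_neg, map_sum]
      simp [hV]
    rw [ContinuousLinearMap.comp_apply, h1, map_add, h2, h5]
  have hinv : (fderiv ℝ Ψ 0).IsInvertible := by
    refine isInvertible_of_injective ?_ ?_
    · rw [injective_iff_map_eq_zero]
      intro v hv
      rw [hder] at hv
      have h1 : ((∑ i, v.1 i • b i : orbitTangent θ₀) : Jet k) = v.2 :=
        neg_add_eq_zero.1 hv
      have h2 : (v.2 : Jet k) = 0 := (Submodule.disjoint_def.1 hC.disjoint) _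
        (h1 ▸ (∑ i, v.1 i • b i : orbitTangent θ₀).2) v.2.2
      rw [h2] at h1
      have h3 := Fintype.linearIndependent_iff.1 b.linearIndependent v.1 (Subtype.ext h1)
      exact Prod.ext (funext h3) (Subtype.ext h2)
    · have h1 := Submodule.finrank_add_eq_of_isCompl hC
      rw [hr.self_of_nhds] at h1
      rw [Module.finrank_prod, Module.finrank_fintype_fun_eq_card, Fintype.card_fin, h1]
  obtain ⟨ψ, hψ, hψΨ, hψd, hψs⟩ := exists_localDiffeo hΨs hinv
  have hψ0 : ψ 0 = θ₀ := by rw [hψΨ, hΨ0]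
  have ht : θ₀ ∈ ψ.target := hψ0 ▸ ψ.map_source hψ
  have hgood : ∀ᶠ η in 𝓝 θ₀, η ∈ ψ.target ∧ Module.finrank ℝ (orbitTangent η) = r ∧
      SmoothNear Φ (e (ψ.symm η)) ∧ ∀ τ : Fin r → ℝ,
        fderiv ℝ Φ (e (ψ.symm η)) (τ, 0) ∈ orbitTangent (Φ (e (ψ.symm η))) := by
    have hc : Filter.Tendsto (fun η => e (ψ.symm η)) (𝓝 θ₀) (𝓝 (0, θ₀)) := by
      have h1 := (ψ.symm.continuousAt (x := θ₀) ht).tendsto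
      have h2 : ψ.symm θ₀ = 0 := by rw [← hψ0, ψ.left_inv hψ]
      have h3 := (he 0).continuousAt.tendsto
      rw [he0] at h3
      rw [h2] at h1
      exact h3.comp h1
    filter_upwards [ψ.open_target.mem_nhds ht, hr, hc.eventually hΦs.eventually,
      hc.eventually hΦt] with η h₁ h₂ h₃ h₄ using ⟨h₁, h₂, h₃, h₄.1⟩
  obtain ⟨U, hU, hUo, hθU⟩ := mem_nhds_iff.1 hgood
  refine ⟨U, hUo, hθU, fun θ hθ => (hU hθ).2.1, fun α hα => ?_⟩
  -- The invariant is `α` evaluated on the transversal coordinate.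
  let I : Jet k → ℝ := fun η => α ((ψ.symm η).2 : C)
  have hIs : ∀ η ∈ ψ.target, ContDiffAt ℝ ∞ I η := fun η hη =>
    (α.contDiff.comp C.subtypeL.contDiff).contDiffAt.comp η (hψs η hη).snd
  have hI : ∀ x ∈ ψ.source, ∀ v, fderiv ℝ I (Ψ x) (fderiv ℝ Ψ x v) = α (v.2 : C) := by
    intro x hx v
    have hΨx : Ψ x ∈ ψ.target := by rw [← hψΨ]; exact ψ.map_source hx
    have h1 := ((hIs _ hΨx).differentiableAt (by simp)).hasFDerivAt.comp x
      (hψd x hx).1.differentiableAt.hasFDerivAt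
    have h2 : HasFDerivAt (fun x : (Fin r → ℝ) × C => α (x.2 : C))
        ((α.comp C.subtypeL).comp (ContinuousLinearMap.snd ℝ (Fin r → ℝ) C)) x :=
      ((α.comp C.subtypeL).comp (ContinuousLinearMap.snd ℝ (Fin r → ℝ) C)).hasFDerivAt
    have h3 : (I ∘ Ψ) =ᶠ[𝓝 x] fun x => α (x.2 : C) := by
      filter_upwards [ψ.open_source.mem_nhds hx] with x' hx'
      simp only [Function.comp_apply, I]
      rw [← hψΨ, ψ.left_inv hx']
    exact congrArg (fun L : (Fin r → ℝ) × C →L[ℝ] ℝ => L v)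
      (h1.unique (h2.congr_of_eventuallyEq h3))
  refine ⟨I, ⟨fun η hη => (hIs η (hU hη).1).contDiffWithinAt, fun η hη X => ?_⟩, ?_⟩
  · obtain ⟨h₁, h₂, h₃, h₄⟩ := hU hη
    set x := ψ.symm η
    have hx : x ∈ ψ.source := ψ.map_target h₁
    have hΨx : Ψ x = η := by rw [← hψΨ, ψ.right_inv h₁]
    have hΦx : Φ (e x) = η := hΨx
    rw [hΦx] at h₄
    have hLd := hΨd x h₃.differentiableAt
    have hinj := (hψd x hx).2.injective
    let L : (Fin r → ℝ) →ₗ[ℝ] Jet k := (fderiv ℝ Ψ x : _ →ₗ[ℝ] Jet k).comp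
      (LinearMap.inl ℝ (Fin r → ℝ) C)
    have hLinj : Function.Injective L := hinj.comp LinearMap.inl_injective
    have hLle : LinearMap.range L ≤ orbitTangent η := by
      rintro _ ⟨τ, rfl⟩
      have : L τ = fderiv ℝ Φ (e x) (τ, 0) := by
        change fderiv ℝ Ψ x (τ, 0) = _
        rw [hLd]
        simp [j]
      rw [this]
      exact h₄ τ
    -- Constancy of the rank is used here: the `r` independent derivatives in the `t`-directions are
    -- tangent to the orbit at `η`, so they span its tangent space, and `I` does not change along
    -- them.
    have hLeq := Submodule.eq_of_le_of_finrank_eq hLle (by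
      rw [LinearMap.finrank_range_of_inj hLinj, h₂, Module.finrank_fintype_fun_eq_card,
        Fintype.card_fin])
    have hX : prolong η X ∈ LinearMap.range L := by
      rw [hLeq]; exact ⟨X, rfl⟩
    obtain ⟨τ, hτ⟩ := hX
    rw [← hτ]
    have := hI x hx (τ, 0)
    rw [hΨx] at this
    exact this.trans (map_zero α)
  · refine ContinuousLinearMap.ext fun w => ?_
    obtain ⟨v, rfl⟩ := hinv.surjective w
    have h1 := hI 0 hψ v
    rw [hΨ0] at h1
    rw [h1, hder, map_add, map_neg, hα _ (Subtype.prop _)]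
    simp

end Invariants

/-! ### Numbers of basic invariants and open orbits -/

section Counting

variable {k : ℕ}

/-- An independent family in a finite dimensional space extends to a basis. -/
theorem exists_linearIndependent_extension_fin {N : Type*} [AddCommGroup N] [Module ℝ N]
    [FiniteDimensional ℝ N] {ι : Type} [Fintype ι] {β : ι → N} (hβ : LinearIndependent ℝ β)
    {m : ℕ} (hm : Module.finrank ℝ N = Fintype.card ι + m) :
    ∃ γ : Fin m → N, LinearIndependent ℝ (Sum.elim β γ) := by
  obtain ⟨C, hC⟩ := Submodule.exists_isCompl (Submodule.span ℝ (Set.range β))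
  have hCd : Module.finrank ℝ C = m := by
    have h1 := Submodule.finrank_add_eq_of_isCompl hC
    rw [finrank_span_eq_card hβ, hm] at h1
    omega
  let c := Module.finBasisOfFinrankEq ℝ C hCd
  have hc : LinearIndependent ℝ fun i => (c i : N) :=
    c.linearIndependent.map' C.subtype C.ker_subtype
  have hcC : Submodule.span ℝ (Set.range fun i => (c i : N)) ≤ C :=
    Submodule.span_le.2 (by rintro _ ⟨i, rfl⟩; exact (c i).2)
  exact ⟨fun i => c i, hβ.sum_type hc (hC.disjoint.mono_right hcC)⟩

/-- An independent family in a subspace extends to a basis of this subspace. -/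
theorem exists_linearIndependent_extension_mem {N : Type*} [AddCommGroup N] [Module ℝ N]
    [FiniteDimensional ℝ N] (A : Submodule ℝ N) {ι : Type} [Fintype ι] {β : ι → N}
    (hβ : LinearIndependent ℝ β) (hA : ∀ i, β i ∈ A) {m : ℕ}
    (hm : Module.finrank ℝ A = Fintype.card ι + m) :
    ∃ γ : Fin m → N, (∀ i, γ i ∈ A) ∧ LinearIndependent ℝ (Sum.elim β γ) := by
  obtain ⟨γ, hγ⟩ := exists_linearIndependent_extension_fin (β := fun i => (⟨β i, hA i⟩ : A))
    (LinearIndependent.of_comp A.subtype hβ) hm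
  refine ⟨fun i => γ i, fun i => (γ i).2, ?_⟩
  have h := hγ.map' A.subtype A.ker_subtype
  have e : Sum.elim β (fun i => (γ i : N)) =
      A.subtype ∘ Sum.elim (fun i => (⟨β i, hA i⟩ : A)) γ := by
    funext i
    cases i <;> rfl
  rw [e]
  exact h

/-- Independent functionals which annihilate a subspace extend to a maximal independent family
of such functionals. -/
theorem exists_extension_annihilator {M : Type*} [NormedAddCommGroup M] [NormedSpace ℝ M]
    [FiniteDimensional ℝ M] (R : Submodule ℝ M) {ι : Type} [Fintype ι] {β : ι → M →L[ℝ] ℝ}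
    (hβ : LinearIndependent ℝ β) (hβR : ∀ i, ∀ v ∈ R, β i v = 0) {m : ℕ}
    (hm : Module.finrank ℝ R + (Fintype.card ι + m) = Module.finrank ℝ M) :
    ∃ γ : Fin m → M →L[ℝ] ℝ, (∀ i, ∀ v ∈ R, γ i v = 0) ∧
      LinearIndependent ℝ (Sum.elim β γ) := by
  have hAd : Module.finrank ℝ R.dualAnnihilator = Fintype.card ι + m := by
    have h1 := Subspace.finrank_add_finrank_dualAnnihilator_eq R
    omega
  let T : Module.Dual ℝ M ≃ₗ[ℝ] M →L[ℝ] ℝ := LinearMap.toContinuousLinearMap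
  have hβ' : LinearIndependent ℝ fun i => T.symm (β i) :=
    hβ.map' T.symm.toLinearMap (LinearEquiv.ker _)
  obtain ⟨γ, hγR, hγ⟩ := exists_linearIndependent_extension_mem R.dualAnnihilator hβ'
    (fun i => (Submodule.mem_dualAnnihilator _).2 (hβR i)) hAd
  refine ⟨fun i => T (γ i), fun i => (Submodule.mem_dualAnnihilator _).1 (hγR i), ?_⟩
  have h := hγ.map' T.toLinearMap (LinearEquiv.ker _)
  have e : Sum.elim β (fun i => T (γ i)) =
      T.toLinearMap ∘ Sum.elim (fun i => T.symm (β i)) γ := by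
    funext i
    cases i with
    | inl i => exact (T.apply_symm_apply (β i)).symm
    | inr i => rfl
  rw [e]
  exact h

/-- The differentials of the given invariants annihilate the tangent space of the orbit at `θ₀`.
They are completed to a basis of its annihilator, and the added functionals are realized as
differentials of invariants. -/
theorem exists_isBasicFamily_extending {θ₀ : Jet k} {r m : ℕ}
    (hr : ∀ᶠ θ in 𝓝 θ₀, Module.finrank ℝ (orbitTangent θ) = r) {ι : Type} [Fintype ι]
    {U₁ : Set (Jet k)} (hU₁ : IsOpen U₁) (hθ₁ : θ₀ ∈ U₁) {I : ι → Jet k → ℝ}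
    (hI : ∀ i, IsInvariantOn U₁ (I i))
    (hli : LinearIndependent ℝ fun i => fderiv ℝ (I i) θ₀)
    (hm : r + (Fintype.card ι + m) = Module.finrank ℝ (Jet k)) :
    ∃ (K : Fin m → Jet k → ℝ), ∃ U ⊆ U₁, θ₀ ∈ U ∧ IsBasicFamily U (Sum.elim I K) := by
  obtain ⟨U₂, hU₂, hθ₂, hr₂, hex⟩ := exists_invariants hr
  obtain ⟨γ, hγ, hli'⟩ := exists_extension_annihilator (orbitTangent θ₀) hli
    (fun i v hv => by
      obtain ⟨V, rfl⟩ := hv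
      exact (hI i).2 θ₀ hθ₁ V)
    (by rw [hr.self_of_nhds]; exact hm)
  choose K hK hKd using fun i => hex (γ i) (hγ i)
  obtain ⟨U, hU, hθU, h⟩ := exists_isBasicFamily (U := U₁ ∩ U₂) (I := Sum.elim I K)
    (hU₁.inter hU₂)
    (by
      rintro (i | i)
      · exact (hI i).mono Set.inter_subset_left
      · exact (hK i).mono Set.inter_subset_right)
    (fun θ hθ => by
      rw [hr₂ θ hθ.2, Fintype.card_sum, Fintype.card_fin, hm])
    ⟨hθ₁, hθ₂⟩
    (by
      convert hli' using 1
      funext i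
      cases i with
      | inl i => rfl
      | inr i => exact hKd i)
  exact ⟨K, U, hU.trans Set.inter_subset_left, hθU, h⟩

theorem hasBasicInvariants {θ₀ : Jet k} {r n : ℕ}
    (hr : ∀ᶠ θ in 𝓝 θ₀, Module.finrank ℝ (orbitTangent θ) = r)
    (hn : r + n = Module.finrank ℝ (Jet k)) : HasBasicInvariants θ₀ n := by
  obtain ⟨U₂, hU₂, hθ₂, hr₂, hex⟩ := exists_invariants hr
  obtain ⟨γ, hγ, hli⟩ := exists_extension_annihilator (orbitTangent θ₀) (ι := Empty)
    (β := Empty.elim) linearIndependent_empty_type (fun i => i.elim) (m := n)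
    (by rw [hr.self_of_nhds]; simpa using hn)
  choose K hK hKd using fun i => hex (γ i) (hγ i)
  obtain ⟨U, -, hθU, h⟩ := exists_isBasicFamily (I := K) hU₂ hK
    (fun θ hθ => by rw [hr₂ θ hθ, Fintype.card_fin, hn]) hθ₂
    (by
      simp only [hKd]
      exact hli.comp Sum.inr Sum.inr_injective)
  exact ⟨U, K, hθU, h⟩

/-- Prolongation commutes with the projection of jets, so invariants of order `k - 1` pull back to
invariants; surjectivity of the projection keeps their differentials independent. They then extend
to a basic family of order `k`. -/
theorem hasPureOrderInvariants {θ₀ : Jet k} {r r' n m : ℕ}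
    (hr : ∀ᶠ θ in 𝓝 θ₀, Module.finrank ℝ (orbitTangent θ) = r)
    (hr' : ∀ᶠ θ in 𝓝 (θ₀.proj (Nat.sub_le k 1)), Module.finrank ℝ (orbitTangent θ) = r')
    (hn : r' + n = Module.finrank ℝ (Jet (k - 1)))
    (hm : r + (n + m) = Module.finrank ℝ (Jet k)) : HasPureOrderInvariants θ₀ m := by
  obtain ⟨U₀, I₀, hθ, hI₀⟩ := hasBasicInvariants hr' hn
  let π : Jet k →L[ℝ] Jet (k - 1) :=
    LinearMap.toContinuousLinearMap (projLinear (Nat.sub_le k 1))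
  have hd : ∀ (i : Fin n) (θ : Jet k), π θ ∈ U₀ →
      fderiv ℝ (fun η : Jet k => I₀ i (η.proj (Nat.sub_le k 1))) θ =
        (fderiv ℝ (I₀ i) (π θ)).comp π := fun i θ hθ =>
    (HasFDerivAt.comp θ ((hI₀.invariant i).smoothNear hI₀.isOpen hθ).differentiableAt.hasFDerivAt
      π.hasFDerivAt).fderiv
  obtain ⟨K, U, hU, hθU, h⟩ := exists_isBasicFamily_extending hr
    (I := fun i η => I₀ i (η.proj (Nat.sub_le k 1)))
    (hI₀.isOpen.preimage π.continuous) hθ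
    (fun i => ⟨(hI₀.invariant i).1.comp π.contDiff.contDiffOn fun θ hθ => hθ, fun θ hθ V => by
      rw [hd i θ hθ]
      have := (hI₀.invariant i).2 (π θ) hθ V
      have e : π (prolong θ V) = prolong (π θ) V :=
        (prolongVec_proj (Nat.sub_le k 1) θ V.2).symm
      rw [ContinuousLinearMap.comp_apply, e]
      exact this⟩)
    (by
      have e : (fun i => fderiv ℝ (fun η : Jet k => I₀ i (η.proj (Nat.sub_le k 1))) θ₀) =
          fun i => (fderiv ℝ (I₀ i) (π θ₀)).comp π := funext fun i => hd i θ₀ hθ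
      rw [e, Fintype.linearIndependent_iff]
      intro g hg
      refine Fintype.linearIndependent_iff.1 (hI₀.independent _ hθ) g
        (ContinuousLinearMap.ext fun w => ?_)
      obtain ⟨v, rfl⟩ := proj_surjective (Nat.sub_le k 1) w
      have := congrArg (fun L : Jet k →L[ℝ] ℝ => L v) hg
      simp only [sum_apply, smul_apply, ContinuousLinearMap.comp_apply] at this ⊢
      exact this)
    (by rw [Fintype.card_fin]; exact hm)
  exact ⟨n, U₀, I₀, U, K, hθ, hI₀, hθU, hU, h⟩

/-- The orbit is open if its tangent space is the whole space. -/
theorem isOpen_orbit {θ : Jet k} (hθ : orbitTangent θ = ⊤) : IsOpen (orbit θ) := by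
  rw [isOpen_iff_mem_nhds]
  rintro θ' ⟨φ, f, g, ⟨hφ, hφs⟩, hb, hne, hL, hf, hg, hfθ, hgθ, hfg⟩
  obtain ⟨n, hn⟩ : ∃ n, Module.finrank ℝ (orbitTangent θ) = n := ⟨_, rfl⟩
  let b := Module.finBasisOfFinrankEq ℝ (orbitTangent θ) hn
  choose V hV using fun i => (b i).2
  have hsm : SmoothNear φ θ.1.base := by
    filter_upwards [φ.open_source.mem_nhds hb] with q hq
      using hφ.contDiffAt (φ.open_source.mem_nhds hq)
  have hreg : IsRegular φ θ.1 := by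
    refine ⟨hsm, ?_, hne⟩
    have h1 := (hφs.contDiffAt (φ.open_target.mem_nhds (φ.map_source hb))).differentiableAt
      (by simp)
    have h2 := h1.hasFDerivAt.comp _ hsm.differentiableAt.hasFDerivAt
    have h3 : (φ.symm ∘ φ) =ᶠ[𝓝 θ.1.base] id := by
      filter_upwards [φ.open_source.mem_nhds hb] with q hq using φ.left_inv hq
    have h4 := h2.unique ((hasFDerivAt_id _).congr_of_eventuallyEq h3)
    refine isInvertible_of_injective (fun v w hvw => ?_) rfl
    have h5 := congrArg (fun L : Plane →L[ℝ] Plane => L v) h4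
    have h6 := congrArg (fun L : Plane →L[ℝ] Plane => L w) h4
    simp only [ContinuousLinearMap.comp_apply, hvw] at h5 h6
    exact h5.symm.trans h6
  obtain ⟨Φ, hΦs, hΦ₀, hΦ, hΦd, -⟩ := exists_local_action hreg (V := fun i => (V i).1)
    (fun i => (V i).2) hL.symm
  have hval : Φ (0, θ') = θ := by
    have hg' : SmoothNear g (lift₁ φ θ.1) := by rwa [hL]
    rw [hΦ₀, hreg.jetOf_pull_congr (smoothNear_taylor θ' _) hg'
      (by rw [hL, hgθ]; exact jetOf_taylor θ')]
    have e : pull φ g =ᶠ[𝓝 θ.1] f := by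
      filter_upwards [hfg, hreg.eventually] with w h₁ h₂ using h₂.pull_eq_of_lift₂ h₁
    have e' : jetOf k (pull φ g) θ.1 = jetOf k f θ.1 :=
      Prod.ext rfl (funext fun ζ => (partialDeriv_congr e ζ.1).self_of_nhds)
    exact e'.trans hfθ
  -- A submersion at `(0, θ')` with value `(θ, θ')`: the first component is onto through the
  -- parameters, because the tangent space at `θ` is everything. For `η'` near `θ'` there is thus
  -- `t` with `Φ (t, η') = θ`, and `η'` lies in the orbit of `Φ (t, η')`. No composition of point
  -- transformations is needed.
  let H : (Fin n → ℝ) × Jet k → Jet k × Jet k :=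
    fun e => (Φ e, e.2)
  have hHd : HasStrictFDerivAt H ((fderiv ℝ Φ (0, θ')).prod (ContinuousLinearMap.snd ℝ _ _))
      (0, θ') :=
    (hΦs.contDiffAt.hasStrictFDerivAt (by simp)).prodMk hasStrictFDerivAt_snd
  have hsurj : ((fderiv ℝ Φ (0, θ')).prod (ContinuousLinearMap.snd ℝ _ _)).range = ⊤ := by
    rw [LinearMap.range_eq_top]
    rintro ⟨u, v⟩
    have hu : u - fderiv ℝ Φ (0, θ') (0, v) ∈ orbitTangent θ :=
      Submodule.eq_top_iff'.1 hθ _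
    let c : Fin n → ℝ := fun i => b.repr ⟨_, hu⟩ i
    refine ⟨(-c, v), ?_⟩
    have h1 : fderiv ℝ Φ (0, θ') (-c, 0) = u - fderiv ℝ Φ (0, θ') (0, v) := by
      rw [hΦd, hval]
      have h6 : (-∑ i, (-c) i • (V i).1 : Plane → Plane) =
          ((∑ i, c i • V i : localFields θ.1.base) : Plane → Plane) := by simp
      rw [h6]
      change prolong θ (∑ i, c i • V i) = _
      rw [map_sum]
      simp only [map_smul, hV]
      have := congrArg Subtype.val (b.sum_repr ⟨_, hu⟩)
      simpa only [Submodule.coe_sum, Submodule.coe_smul] using this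
    have h2 : ((-c, v) : (Fin n → ℝ) × Jet k) =
        (-c, 0) + (0, v) := by simp
    refine Prod.ext ?_ rfl
    change fderiv ℝ Φ (0, θ') (-c, v) = u
    rw [h2, map_add, h1, sub_add_cancel]
  have hmap := hHd.map_nhds_eq_of_surj hsurj
  have himg : H '' {e | e.2 ∈ orbit (Φ e)} ∈ 𝓝 (θ, θ') := by
    have : H (0, θ') = (θ, θ') := Prod.ext hval rfl
    rw [← this, ← hmap]
    exact Filter.image_mem_map (hΦ.mono fun e he => he.2)
  have := (Continuous.prodMk_right θ).continuousAt.preimage_mem_nhds (x := θ') himg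
  filter_upwards [this] with η' hη'
  obtain ⟨e, he, heq⟩ := hη'
  have h1 : Φ e = θ := congrArg Prod.fst heq
  have h2 : e.2 = η' := congrArg Prod.snd heq
  rw [← h1, ← h2]
  exact he

end Counting

/-! ### Arithmetic of the dimensions and the main theorem -/

theorem stabilizerCodim_eq {k : ℕ} (θ : Jet k) :
    stabilizerCodim θ = Module.finrank ℝ (orbitTangent θ) :=
  (prolong θ).quotKerEquivRange.finrank_eq

theorem six_mul_finrank_jet (k : ℕ) :
    6 * Module.finrank ℝ (Jet k) = k ^ 3 + 6 * k ^ 2 + 11 * k + 24 := by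
  have h := six_mul_card_jetIdx k
  rw [finrank_jet, mul_add, h]
  ring

theorem exists_codim {k : ℕ} (hk : 5 ≤ k) :
    ∃ n : ℕ, (n : ℚ) = ((k : ℚ) ^ 3 - 25 * k + 18) / 6 ∧
      k ^ 2 + 6 * k + 1 + n = Module.finrank ℝ (Jet k) := by
  have h := six_mul_finrank_jet k
  have h1 : k ^ 2 + 6 * k + 1 ≤ Module.finrank ℝ (Jet k) := by
    -- Since `6 (dim J^k - k² - 6k - 1) = k³ - 25k + 18`, the bound `k ≥ 5` makes the codimension a
    -- natural number.
    have : 25 * k ≤ k ^ 3 := by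
      calc 25 * k ≤ k ^ 2 * k := Nat.mul_le_mul_right k (by nlinarith)
        _ = k ^ 3 := by ring
    omega
  obtain ⟨n, hn⟩ := Nat.exists_eq_add_of_le h1
  refine ⟨n, ?_, hn.symm⟩
  rw [hn] at h
  have h' : (6 : ℚ) * ((k : ℚ) ^ 2 + 6 * k + 1 + n) = (k : ℚ) ^ 3 + 6 * k ^ 2 + 11 * k + 24 := by
    exact_mod_cast h
  linarith

theorem generically_hasPureOrderInvariants {k : ℕ} (hk : 5 < k) :
    ∃ m : ℕ, (m : ℚ) = (k : ℚ) * (k - 1) / 2 - 4 ∧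
      Generically k fun θ => HasPureOrderInvariants θ m := by
  obtain ⟨j, rfl⟩ : ∃ j, k = j + 1 := ⟨k - 1, by omega⟩
  have hj : 5 ≤ j := by omega
  obtain ⟨n', hn', hd'⟩ := exists_codim hj
  obtain ⟨n, hn, hd⟩ := exists_codim (k := j + 1) (by omega)
  have hle : n' ≤ n := by
    have h5 : (5 : ℚ) ≤ j := by exact_mod_cast hj
    have : (n' : ℚ) ≤ n := by
      rw [hn, hn']
      push_cast
      nlinarith
    exact_mod_cast this
  obtain ⟨m, rfl⟩ := Nat.exists_eq_add_of_le hle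
  refine ⟨m, ?_, ?_⟩
  · push_cast at hn ⊢
    rw [hn'] at hn
    linear_combination hn
  · have h₁ := (generically_finrank_orbitTangent (k := j + 1) (by omega)).eventually
    have h₂ := (generically_finrank_orbitTangent hj).eventually.proj (Nat.sub_le (j + 1) 1)
    exact (h₁.and h₂).mono fun θ hθ => hasPureOrderInvariants hθ.1 hθ.2 hd' hd

end PointODE

end

theorem mainTheorem5 :
    -- the codimension of the stabilizer of a generic point
    (∀ k : ℕ, 5 ≤ k →
      PointODE.Generically k fun θ => PointODE.stabilizerCodim θ = k ^ 2 + 6 * k + 1) ∧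
    -- the codimension of a generic orbit and the number of basic invariants of order `≤ k`
    (∀ k : ℕ, 5 ≤ k → ∃ n : ℕ, (n : ℚ) = ((k : ℚ) ^ 3 - 25 * k + 18) / 6 ∧
      PointODE.Generically k fun θ =>
        Module.finrank ℝ (PointODE.Jet k ⧸ PointODE.orbitTangent θ) = n ∧
        PointODE.HasBasicInvariants θ n) ∧
    -- the number of basic invariants of pure order `k`
    (∀ k : ℕ, 5 < k → ∃ m : ℕ, (m : ℚ) = (k : ℚ) * (k - 1) / 2 - 4 ∧
      PointODE.Generically k fun θ => PointODE.HasPureOrderInvariants θ m) ∧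
    -- generic orbits are open for `k ≤ 4`
    (∀ k : ℕ, k ≤ 4 → PointODE.Generically k fun θ =>
      IsOpen (PointODE.orbit θ) ∧
      PointODE.stabilizerCodim θ = Module.finrank ℝ (PointODE.Jet k) ∧
      PointODE.HasBasicInvariants θ 0) ∧
    -- three invariants in order 5
    PointODE.Generically 5 fun θ =>
      PointODE.HasBasicInvariants θ 3 ∧ PointODE.HasPureOrderInvariants θ 3 := by
  open PointODE in
  refine ⟨fun k hk => ?_, fun k hk => ?_, fun k hk => generically_hasPureOrderInvariants hk,
    fun k hk => ?_, ?_⟩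
  · exact (generically_finrank_orbitTangent hk).mono fun θ hθ => (stabilizerCodim_eq θ).trans hθ
  · obtain ⟨n, hn, hd⟩ := exists_codim hk
    refine ⟨n, hn, (generically_finrank_orbitTangent hk).eventually.mono fun θ hθ =>
      ⟨?_, hasBasicInvariants hθ hd⟩⟩
    have h := Submodule.finrank_quotient_add_finrank (orbitTangent θ)
    rw [hθ.self_of_nhds, ← hd] at h
    omega
  · refine (generically_orbitTangent_eq_top hk).eventually.mono fun θ hθ => ?_
    have hr : ∀ᶠ η in 𝓝 θ, Module.finrank ℝ (orbitTangent η) = Module.finrank ℝ (Jet k) :=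
      hθ.mono fun η hη => by rw [hη, finrank_top]
    exact ⟨isOpen_orbit hθ.self_of_nhds, (stabilizerCodim_eq θ).trans hr.self_of_nhds,
      hasBasicInvariants hr rfl⟩
  · have h₁ := (generically_finrank_orbitTangent (k := 5) le_rfl).eventually
    -- Order five is separate, as order four has open orbits and no invariants; all three invariants
    -- of order at most five are therefore of pure order five.
    have h₂ := (generically_orbitTangent_eq_top (k := 4) le_rfl).eventually.proj
      (Nat.sub_le 5 1)
    have hd : 5 ^ 2 + 6 * 5 + 1 + 3 = Module.finrank ℝ (Jet 5) := by
      have := six_mul_finrank_jet 5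
      omega
    refine (h₁.and h₂).mono fun θ hθ => ⟨hasBasicInvariants hθ.1 hd, ?_⟩
    have hr : ∀ᶠ η in 𝓝 (θ.proj (Nat.sub_le 5 1)), Module.finrank ℝ (orbitTangent η) =
        Module.finrank ℝ (Jet 4) := hθ.2.mono fun η hη => by rw [hη, finrank_top]
    exact hasPureOrderInvariants hθ.1 hr rfl hd
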